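/- **Setting.** Let $d\ge 1$ be an integer, $n>0$, $\Theta\subseteq\mathbb R^d$ open, $v:\Theta\to\mathbb R$ of class $C^5$ on $\Theta$, and suppose $v$ has a unique global minimizer $\hat x\in\Theta$ with $H_v:=\nabla^2 v(\hat x)\succ 0$. Put $V=nv$, $H_V=\nabla^2V(\hat x)=nH_v$, and let $\pi\propto e^{-nv}$ be the probability measure on $\Theta$ with density proportional to $e^{-nv}$. For a positive definite $H$ write $\|x\|_H=\sqrt{x^{\top}Hx}$, and for a symmetric tensor $T$ of order $k$ let $\|T\|_H=\sup_{\|u\|_H=1}|\langle T,u^{\otimes k}\rangle|$ be its $H$-weighted operator norm. Let $$\mathcal U(s)=\{x\in\mathbb R^d:\|x-\hat x\|_{H_v}\le s\sqrt{d/n}\},\qquad c_k(s)=\sup_{x\in\mathcal U(s)}\|\nabla^kv(x)\|_{H_v}\quad(k=3,4,5),$$ $$\epsilon_3=c_3(0)\frac{d}{\sqrt n},\qquad \epsilon_4(s)=c_4(s)^{1/2}\frac{d}{\sqrt n},\qquad \epsilon_5(s)=c_5(s)^{1/3}\frac{d}{\sqrt n}.$$ Suppose there are $s_0>0$ and $0<c_0\le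 1$ such that $$v(x)-v(\hat x)\ge c_0\sqrt{d/n}\,\|x-\hat x\|_{H_v}\qquad\text{for all }x\in\Theta\setminus\mathcal U(s_0).$$ Let $$E(s)=\exp\!\big((\epsilon_3^2+\epsilon_4(s)^2)s^4\big),\qquad \tau(s)=d\,e^{-c_0sd/8},\qquad s^*=\max\!\big(s_0,\tfrac{8}{c_0}\log\tfrac{2e}{c_0}\big).$$ The Laplace approximation of $\pi$ is $\hat\gamma=\mathcal N(\hat x,H_V^{-1})$, and the skew-corrected Laplace approximation is the signed measure $$d\hat\gamma_S=(1+S)\,d\hat\gamma,\qquad S(x)=-\tfrac16\langle\nabla^3V(\hat x),(x-\hat x)^{\otimes3}\rangle .$$ Let $G:\mathbb R^d\to\mathbb R$ be measurable with $\mathrm{Var}_{\hat\gamma}(G)>0$ and, for some $a_G\ge0$, $$\Big|G(x)-\int G\,d\hat\gamma\Big|\le a_G\exp\!\big(c_0\sqrt d\,\|x-\hat x\|_{H_V}/2\big)\qquad\text{for all }x\in\mathbb R^d,$$ and set $$g=\frac{G-\int G\,d\hat\gamma}{\sqrt{\mathrm{Var}_{\hat\gamma}(G)}},\qquad a_g=\frac{a_G}{\sqrt{\mathrm{Var}_{\hat\gamma}(G)}},\qquad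 \Delta_g(\hat\gamma_S)=\int g\,d\pi-\int g(1+S)\,d\hat\gamma .$$ **Theorem.** For every $K>0$ there is a constant $C>0$ depending only on $K$ such that the following holds in the setting above. If $s\ge s^*$, $\mathcal U(s)\subseteq\Theta$, $\epsilon_3\le K$, $\epsilon_4(s)\le K$, and $g$ is odd about $\hat x$, i.e. $g(\hat x-y)=-g(\hat x+y)$ for all $y\in\mathbb R^d$, then $\pi$ is a well-defined probability measure (that is, $\int_\Theta e^{-nv}<\infty$), both integrals in $\Delta_g(\hat\gamma_S)$ converge absolutely, and $$|\Delta_g(\hat\gamma_S)|\le C\Big(E(s)\big(\epsilon_3^2+\epsilon_4(s)^2\big)\big(\epsilon_3+\epsilon_4(s)^2\big)+d^{-1/2}\epsilon_5(s)^3+\max(a_g,1)\,\tau(s)\Big).$$ -/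

import Mathlib

namespace SkewLaplace

open MeasureTheory ProbabilityTheory
open scoped Matrix

noncomputable section

/-- `ℝ^d` with its Euclidean structure. -/
abbrev Vec (d : ℕ) : Type := EuclideanSpace ℝ (Fin d)

/-- The Hessian matrix of `f` at `x`. -/
def hessian {d : ℕ} (f : Vec d → ℝ) (x : Vec d) : Matrix (Fin d) (Fin d) ℝ :=
  Matrix.of fun i j =>
    iteratedFDeriv ℝ 2 f x ![EuclideanSpace.single i 1, EuclideanSpace.single j 1]

/-- The weighted norm `‖x‖_H = √(xᵀ H x)`. -/
def wNorm {d : ℕ} (H : Matrix (Fin d) (Fin d) ℝ) (x : Vec d) : ℝ :=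
  √(x.ofLp ⬝ᵥ (H *ᵥ x.ofLp))

/-- The `H`-weighted operator norm `sup_{‖u‖_H = 1} |⟨T, u^{⊗k}⟩|` of a symmetric tensor of order
`k`, the tensor being given as a `k`-linear form. -/
def opNorm {d k : ℕ} (H : Matrix (Fin d) (Fin d) ℝ)
    (T : ContinuousMultilinearMap ℝ (fun _ : Fin k => Vec d) ℝ) : ℝ :=
  sSup {t : ℝ | ∃ u : Vec d, wNorm H u = 1 ∧ t = |T fun _ => u|}

/-- The local region `U(s) = {x : ‖x - xhat‖_{H_v} ≤ s √(d/n)}`, where `H_v = ∇²v(xhat)`. -/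
def localRegion {d : ℕ} (n : ℝ) (v : Vec d → ℝ) (xhat : Vec d) (s : ℝ) : Set (Vec d) :=
  {x | wNorm (hessian v xhat) (x - xhat) ≤ s * √((d : ℝ) / n)}

/-- `c_k(s) = sup_{x ∈ U(s)} ‖∇^k v(x)‖_{H_v}`. -/
def derivBound {d : ℕ} (n : ℝ) (v : Vec d → ℝ) (xhat : Vec d) (k : ℕ) (s : ℝ) : ℝ :=
  sSup ((fun x => opNorm (hessian v xhat) (iteratedFDeriv ℝ k v x)) '' localRegion n v xhat s)

/-- `ε₃ = c₃(0) d / √n`. -/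
def eps3 {d : ℕ} (n : ℝ) (v : Vec d → ℝ) (xhat : Vec d) : ℝ :=
  derivBound n v xhat 3 0 * ((d : ℝ) / √n)

/-- `ε₄(s) = c₄(s)^{1/2} d / √n`. -/
def eps4 {d : ℕ} (n : ℝ) (v : Vec d → ℝ) (xhat : Vec d) (s : ℝ) : ℝ :=
  derivBound n v xhat 4 s ^ (1 / 2 : ℝ) * ((d : ℝ) / √n)

/-- `ε₅(s) = c₅(s)^{1/3} d / √n`. -/
def eps5 {d : ℕ} (n : ℝ) (v : Vec d → ℝ) (xhat : Vec d) (s : ℝ) : ℝ :=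
  derivBound n v xhat 5 s ^ (1 / 3 : ℝ) * ((d : ℝ) / √n)

/-- `E(s) = exp((ε₃² + ε₄(s)²) s⁴)`. -/
def expFactor {d : ℕ} (n : ℝ) (v : Vec d → ℝ) (xhat : Vec d) (s : ℝ) : ℝ :=
  Real.exp ((eps3 n v xhat ^ 2 + eps4 n v xhat s ^ 2) * s ^ 4)

/-- `τ(s) = d exp(-c₀ s d / 8)`. -/
def tailTerm (d : ℕ) (c₀ s : ℝ) : ℝ :=
  (d : ℝ) * Real.exp (-(c₀ * s * (d : ℝ) / 8))

/-- `s* = max(s₀, (8 / c₀) log(2e / c₀))`. -/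
def sStar (s₀ c₀ : ℝ) : ℝ :=
  max s₀ (8 / c₀ * Real.log (2 * Real.exp 1 / c₀))

/-- The probability measure `π ∝ e^{-n v}` on `Θ`. -/
def posterior {d : ℕ} (n : ℝ) (Θ : Set (Vec d)) (v : Vec d → ℝ) : Measure (Vec d) :=
  (∫⁻ x in Θ, ENNReal.ofReal (Real.exp (-(n * v x))))⁻¹ •
    (volume.restrict Θ).withDensity fun x => ENNReal.ofReal (Real.exp (-(n * v x)))

/-- The Laplace approximation `N(xhat, H_V⁻¹)`, where `V = n v` and `H_V = ∇²V(xhat)`. -/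
def laplaceApprox {d : ℕ} (n : ℝ) (v : Vec d → ℝ) (xhat : Vec d) : Measure (Vec d) :=
  multivariateGaussian xhat (hessian (fun y => n * v y) xhat)⁻¹

/-- The skew correction `S(x) = -(1/6) ⟨∇³V(xhat), (x - xhat)^{⊗3}⟩`, where `V = n v`. -/
def skewCorrection {d : ℕ} (n : ℝ) (v : Vec d → ℝ) (xhat x : Vec d) : ℝ :=
  -(1 / 6) * iteratedFDeriv ℝ 3 (fun y => n * v y) xhat fun _ => x - xhat

/-- The standardization `(G - ∫ G dμ) / √(Var_μ G)` of an observable `G`. -/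
def standardize {d : ℕ} (μ : Measure (Vec d)) (G : Vec d → ℝ) (x : Vec d) : ℝ :=
  (G x - ∫ y, G y ∂μ) / √(variance G μ)

/-- The error `∫ g dπ - ∫ g (1 + S) dγ` of the skew-corrected Laplace approximation, where `γ` is
the Laplace approximation to `π`. -/
def skewError {d : ℕ} (n : ℝ) (Θ : Set (Vec d)) (v : Vec d → ℝ) (xhat : Vec d)
    (g : Vec d → ℝ) : ℝ :=
  (∫ x, g x ∂posterior n Θ v) -
    ∫ x, g x * (1 + skewCorrection n v xhat x) ∂laplaceApprox n v xhat

end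

end SkewLaplace

open SkewLaplace MeasureTheory

open SkewLaplace MeasureTheory

/-! ### Gaussian integrals: density, exponential moments, rotation invariance, tails. -/

namespace SkewLaplace

open ProbabilityTheory Real
open scoped ENNReal RealInnerProductSpace

/-! Whitening by `y = H_V^{1/2} (x - xhat)` turns the Laplace approximation into the standard
Gaussian `γ`, and turns `π` into `ρ dγ / Z`. On the ball of radius `s√d` one has `ρ = exp (-r)`,
where `r` is the Taylor remainder of order two: a cubic `p = B(y,y,y)/6` of size `σ = ε₃`, plus an
error of size `η = ε₄²`. The skew correction becomes `-p`. With `N = ∫ g ρ dγ` and `Q = ∫ g p dγ`,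
oddness gives `∫ g dγ = 0`, so the error equals `N/Z + Q = ((N + Q) + Q (Z - 1)) / Z`.

Parity supplies the extra order. Since `g` is odd, `N` sees only the odd part of `ρ`. The odd part
of `exp (-r)` is `-p` up to the products `η(σ+η)` and `(σ+η)³`, and up to the odd part of `r - p`.
The fourth-order Taylor term is even and drops out of the latter, leaving a fifth-order remainder of
size `ε₅³ ‖y‖⁵/d³`, which is `d^{-1/2} ε₅³` for typical `‖y‖ ~ √d`. By symmetry of `γ`, `Z - 1` sees
only the even part of `ρ` and is `O(σ² + η)`, while `Q = O(σ)`. A lower bound on `Z` comes from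
convexity of `exp`, because the cubic cancels in `r(y) + r(-y)`.

Constants must not depend on `d`. The bound `|p| ≲ σ‖y‖³/d` alone would give size `σ√d`; the true
size is `σ`. This is shown by decoupling: `B(x,x,x)` is a convex combination of rotated copies of
`(13/3) B(x,x,y)` with `x, y` independent (`TriForm.IsSymm.diag_eq`,
`TriForm.IsSymm.lintegral_convex_le`), and given `x` the latter is Gaussian with standard deviation
`O(σ‖x‖²/d)`. This yields the polynomial moments (`exists_lintegral_cubic_pow_le`) and the
exponential moment on the ball that produces `E(s)` (`TriForm.IsSymm.setLIntegral_exp_le`). Outside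
the ball, linear growth of `v` beats the growth of `g` and leaves `τ(s)` (`lintegral_tail_le`).

All integrands are dominated by multiples of one function `D` with bounded integral
(`exists_dominating`). `LocalExpansion` isolates what is needed of `ρ`,
`exists_abs_div_add_integral_le` proves the estimate in that setting, and `IsRegular.localExpansion`
verifies it by Taylor's formula. -/

/-- The density of the standard Gaussian measure on `ℝ^d`. -/
noncomputable def stdDensity (d : ℕ) (y : Vec d) : ℝ :=
  (2 * π) ^ (-(d / 2) : ℝ) * exp (-(1 / 2) * ‖y‖ ^ 2)

lemma stdDensity_pos {d : ℕ} (y : Vec d) : 0 < stdDensity d y := by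
  unfold stdDensity; positivity

lemma continuous_stdDensity (d : ℕ) : Continuous (stdDensity d) := by
  unfold stdDensity; fun_prop

/-- A non-integrable function has Bochner integral `0`, whereas the known value here is positive. -/
lemma integrable_exp_neg_mul_sq_norm {d : ℕ} {b : ℝ} (hb : 0 < b) :
    Integrable (fun y : Vec d => exp (-b * ‖y‖ ^ 2)) := by
  by_contra h
  have h1 := GaussianFourier.integral_rexp_neg_mul_sq_norm (V := Vec d) hb
  rw [integral_undef h] at h1
  have : (0 : ℝ) < (π / b) ^ (Module.finrank ℝ (Vec d) / 2 : ℝ) := by positivity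
  linarith

/-- Both measures are finite and have the same characteristic function. -/
lemma stdGaussian_eq_withDensity (d : ℕ) :
    stdGaussian (Vec d) = volume.withDensity fun y => ENNReal.ofReal (stdDensity d y) := by
  have hint : Integrable (stdDensity d) :=
    (integrable_exp_neg_mul_sq_norm (by norm_num : (0 : ℝ) < 1 / 2)).const_mul _
  have : IsFiniteMeasure (volume.withDensity fun y => ENNReal.ofReal (stdDensity d y)) :=
    isFiniteMeasure_withDensity_ofReal hint.2
  apply Measure.ext_of_charFun
  ext t
  rw [charFun_stdGaussian, charFun_apply, integral_withDensity_eq_integral_toReal_smul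
    (by have := (continuous_stdDensity d).measurable; fun_prop) (by simp)]
  have h := GaussianFourier.integral_cexp_neg_mul_sq_norm_add (V := Vec d) (b := (1 / 2 : ℂ))
    (by norm_num) Complex.I t
  have h2 : ∀ y : Vec d, (ENNReal.ofReal (stdDensity d y)).toReal • Complex.exp (⟪y, t⟫ * Complex.I)
      = (((2 * π) ^ (-(d / 2) : ℝ) : ℝ) : ℂ) *
        Complex.exp (-(1 / 2 : ℂ) * ‖y‖ ^ 2 + Complex.I * ⟪t, y⟫) := by
    intro y
    rw [ENNReal.toReal_ofReal (stdDensity_pos y).le, stdDensity, Complex.exp_add, real_inner_comm,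
      mul_comm Complex.I, Complex.real_smul]
    push_cast
    ring
  simp_rw [h2]
  rw [integral_const_mul, h, ← mul_assoc]
  have h3 : (((2 * π) ^ (-(d / 2) : ℝ) : ℝ) : ℂ) *
      ((π : ℂ) / (1 / 2)) ^ ((Module.finrank ℝ (Vec d) : ℂ) / 2) = 1 := by
    have e : ((π : ℂ) / (1 / 2)) ^ ((Module.finrank ℝ (Vec d) : ℂ) / 2)
        = (((2 * π) ^ (d / 2 : ℝ) : ℝ) : ℂ) := by
      rw [Complex.ofReal_cpow (by positivity)]
      congr 1
      · push_cast; ring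
      · simp
    rw [e, ← Complex.ofReal_mul, ← rpow_add (by positivity)]
    simp
  rw [h3, one_mul]
  congr 1
  simp
  ring

lemma lintegral_exp_sq_norm {d : ℕ} {q : ℝ} (hq : q < 1 / 2) :
    ∫⁻ y, ENNReal.ofReal (exp (q * ‖y‖ ^ 2)) ∂stdGaussian (Vec d) =
      ENNReal.ofReal ((1 - 2 * q) ^ (-(d / 2) : ℝ)) := by
  have hm : Measurable fun y : Vec d => ENNReal.ofReal (stdDensity d y) := by
    have := (continuous_stdDensity d).measurable; fun_prop
  rw [stdGaussian_eq_withDensity, lintegral_withDensity_eq_lintegral_mul _ hm (by fun_prop)]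
  have h2 : ∀ y : Vec d, ((fun y => ENNReal.ofReal (stdDensity d y)) *
      (fun y => ENNReal.ofReal (exp (q * ‖y‖ ^ 2))) : Vec d → ℝ≥0∞) y =
      ENNReal.ofReal ((2 * π) ^ (-(d / 2) : ℝ) * exp (-(1 / 2 - q) * ‖y‖ ^ 2)) := by
    intro y
    rw [Pi.mul_apply, ← ENNReal.ofReal_mul (stdDensity_pos y).le, stdDensity, mul_assoc,
      ← exp_add]
    ring_nf
  have hq' : 0 < 1 / 2 - q := by linarith
  simp_rw [h2]
  rw [← ofReal_integral_eq_lintegral_ofReal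
    ((integrable_exp_neg_mul_sq_norm hq').const_mul _) (ae_of_all _ fun y => by positivity),
    integral_const_mul, GaussianFourier.integral_rexp_neg_mul_sq_norm hq']
  congr 1
  have e : π / (1 / 2 - q) = (2 * π) * (1 - 2 * q)⁻¹ := by field_simp
  have h1 : 0 < 1 - 2 * q := by linarith
  simp only [finrank_euclideanSpace, Fintype.card_fin]
  rw [e, mul_rpow (x := 2 * π) (by positivity) (by positivity), ← mul_assoc,
    ← rpow_add (by positivity),
    inv_rpow h1.le, rpow_neg h1.le]
  simp

lemma lintegral_exp_sq_norm_le {d : ℕ} {q : ℝ} (h0 : 0 ≤ q) (hq : q ≤ 1 / 4) :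
    ∫⁻ y, ENNReal.ofReal (exp (q * ‖y‖ ^ 2)) ∂stdGaussian (Vec d) ≤
      ENNReal.ofReal (exp (2 * q * d)) := by
  rw [lintegral_exp_sq_norm (by linarith)]
  apply ENNReal.ofReal_le_ofReal
  have h1 : 0 < 1 - 2 * q := by linarith
  rw [rpow_def_of_pos h1, exp_le_exp]
  -- `(1 + 4q)(1 - 2q) ≥ 1` holds exactly for `0 ≤ q ≤ 1/4`; this is the source of the threshold
  -- `1/4`.
  have h2 : -(4 * q) ≤ log (1 - 2 * q) := by
    have := one_sub_inv_le_log_of_pos h1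
    have h3 : (1 - 2 * q)⁻¹ ≤ 1 + 4 * q := by
      rw [inv_le_iff_one_le_mul₀ h1]
      nlinarith
    linarith
  have hd : (0 : ℝ) ≤ d := by positivity
  nlinarith

lemma stdGaussian_map_dual {d : ℕ} (L : Vec d →L[ℝ] ℝ) :
    (stdGaussian (Vec d)).map L = gaussianReal 0 (‖L‖ ^ 2).toNNReal := by
  rw [IsGaussian.map_eq_gaussianReal, variance_dual_stdGaussian, integral_strongDual_stdGaussian]

lemma lintegral_exp_dual {d : ℕ} (L : Vec d →L[ℝ] ℝ) :
    ∫⁻ y, ENNReal.ofReal (exp (L y)) ∂stdGaussian (Vec d) =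
      ENNReal.ofReal (exp (‖L‖ ^ 2 / 2)) := by
  have h := mgf_gaussianReal (stdGaussian_map_dual L) 1
  have hi : Integrable (fun y => exp (L y)) (stdGaussian (Vec d)) := by
    have := integrable_exp_mul_gaussianReal (μ := 0) (v := (‖L‖ ^ 2).toNNReal) 1
    rw [← stdGaussian_map_dual L, integrable_map_measure (by fun_prop) (by fun_prop)] at this
    simpa [Function.comp_def] using this
  rw [← ofReal_integral_eq_lintegral_ofReal hi (ae_of_all _ fun y => by positivity)]
  simpa [mgf] using congrArg ENNReal.ofReal h

/-- Under the standard Gaussian, `L` has the law of `‖L‖` times a standard normal variable. -/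
lemma lintegral_dual_pow {d : ℕ} (L : Vec d →L[ℝ] ℝ) (k : ℕ) :
    ∫⁻ y, ENNReal.ofReal (L y ^ k) ∂stdGaussian (Vec d) =
      ENNReal.ofReal (‖L‖ ^ k) * ∫⁻ x, ENNReal.ofReal (x ^ k) ∂gaussianReal 0 1 := by
  have e : (stdGaussian (Vec d)).map L = (gaussianReal 0 1).map (‖L‖ * ·) := by
    rw [stdGaussian_map_dual, gaussianReal_map_const_mul]
    congr 1
    · simp
    · ext; simp
  have h1 : ∫⁻ y, ENNReal.ofReal (L y ^ k) ∂stdGaussian (Vec d) =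
      ∫⁻ x, ENNReal.ofReal (x ^ k) ∂((stdGaussian (Vec d)).map L) := by
    rw [lintegral_map (by fun_prop) (by fun_prop)]
  rw [h1, e, lintegral_map (by fun_prop) (by fun_prop), ← lintegral_const_mul _ (by fun_prop)]
  congr 1 with x
  rw [mul_pow, ENNReal.ofReal_mul (by positivity)]

lemma lintegral_gaussianReal_pow_lt_top {k : ℕ} (hk : Even k) :
    ∫⁻ x, ENNReal.ofReal (x ^ k) ∂gaussianReal 0 1 < ∞ := by
  rcases Nat.eq_zero_or_pos k with rfl | hk0
  · simp
  have h := (memLp_id_gaussianReal (μ := 0) (v := 1) (k : NNReal)).integrable_norm_pow'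
  have h2 : Integrable (fun x : ℝ => x ^ k) (gaussianReal 0 1) := by
    simpa [hk.pow_abs, hk0.ne'] using h
  exact h2.lintegral_lt_top

/-- A rotation of a pair of independent copies preserves their joint law; decoupling rests on this.
-/
lemma lintegral_rotation {d : ℕ} (θ : ℝ) {F : Vec d × Vec d → ℝ≥0∞} (hF : Measurable F) :
    ∫⁻ z, F (cos θ • z.1 + sin θ • z.2, -sin θ • z.1 + cos θ • z.2)
        ∂(stdGaussian (Vec d)).prod (stdGaussian (Vec d)) =
      ∫⁻ z, F z ∂(stdGaussian (Vec d)).prod (stdGaussian (Vec d)) := by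
  have h := IsGaussian.map_rotation_eq_self (μ := stdGaussian (Vec d)) (by simp) θ
  conv_rhs => rw [← h]
  rw [lintegral_map hF (by fun_prop)]
  simp [ContinuousLinearMap.rotation_apply]

lemma stdGaussian_map_neg (d : ℕ) :
    (stdGaussian (Vec d)).map (fun y => -y) = stdGaussian (Vec d) :=
  stdGaussian_map (LinearIsometryEquiv.neg ℝ (E := Vec d))

lemma measurePreserving_neg_stdGaussian (d : ℕ) :
    MeasurePreserving (fun y : Vec d => -y) (stdGaussian (Vec d)) (stdGaussian (Vec d)) :=
  ⟨by fun_prop, stdGaussian_map_neg d⟩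

lemma integral_exp_neg_mul_abs {a : ℝ} (ha : 0 < a) : ∫ x : ℝ, exp (-a * |x|) = 2 / a := by
  rw [integral_comp_abs (f := fun x => exp (-a * x)), integral_exp_mul_Ioi (by linarith)]
  simp; field_simp

lemma lintegral_exp_neg_sum_abs (d : ℕ) {a : ℝ} (ha : 0 < a) :
    ∫⁻ y : Vec d, ENNReal.ofReal (exp (-a * ∑ i, |y i|)) = ENNReal.ofReal ((2 / a) ^ d) := by
  have h1 : Integrable fun x : ℝ => exp (-a * |x|) := by
    by_contra h
    have := integral_exp_neg_mul_abs ha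
    rw [integral_undef h] at this
    have : 0 < 2 / a := by positivity
    linarith
  rw [← (PiLp.volume_preserving_toLp (Fin d)).lintegral_comp_emb
    (MeasurableEquiv.toLp 2 _).measurableEmbedding]
  have h2 : ∀ y : Fin d → ℝ, exp (-a * ∑ i, |(WithLp.toLp 2 y : Vec d) i|) =
      ∏ i, exp (-a * |y i|) := by
    intro y
    rw [Finset.mul_sum, exp_sum]
  simp_rw [h2]
  rw [volume_pi, ← ofReal_integral_eq_lintegral_ofReal (Integrable.fintype_prod fun _ => h1)
    (ae_of_all _ fun y => Finset.prod_nonneg fun i _ => by positivity),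
    integral_fintype_prod_eq_pow fun x : ℝ => exp (-a * |x|),
    integral_exp_neg_mul_abs ha]
  simp

lemma sum_abs_le_sqrt_mul_norm {d : ℕ} (y : Vec d) : ∑ i, |y i| ≤ √d * ‖y‖ := by
  rw [EuclideanSpace.norm_eq]
  have := sum_mul_le_sqrt_mul_sqrt Finset.univ (fun _ : Fin d => (1 : ℝ)) (fun i => |y i|)
  simpa using this

/-- The factor `exp (‖y‖²/2)` cancels the Gaussian density and leaves `exp (-c√d‖y‖/2)`. Half of the
exponent is spent on `‖y‖ > s√d`; the other half dominates `(c/4) ∑ |y i|`, whose exponential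
factors over coordinates. -/
lemma lintegral_tail_le {d : ℕ} {c s : ℝ} (hc : 0 < c)
    (hs : 8 / c * log (2 * exp 1 / c) ≤ s) :
    ∫⁻ y in {y : Vec d | s * √d < ‖y‖},
      ENNReal.ofReal (exp (‖y‖ ^ 2 / 2 - c * √d * ‖y‖ / 2)) ∂stdGaussian (Vec d) ≤
      ENNReal.ofReal (exp (-(c * s * d / 8))) := by
  have hm : Measurable fun y : Vec d => ENNReal.ofReal (stdDensity d y) := by
    have := (continuous_stdDensity d).measurable; fun_prop
  have hS : MeasurableSet {y : Vec d | s * √d < ‖y‖} := measurableSet_lt (by fun_prop) (by fun_prop)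
  rw [stdGaussian_eq_withDensity, setLIntegral_withDensity_eq_setLIntegral_mul _ hm
    (by fun_prop) hS]
  -- Per coordinate the factors are `(2π)^{-1/2} ≤ 1/2`, then `e^{-cs/8} ≤ c/(2e)` from the lower
  -- bound on `s`, then `8/c`. Their product is at most `2/e < 1`, and `exp (-csd/8)` is left over.
  have hq : (2 * π) ^ (-(d / 2) : ℝ) * exp (-(c * s * d / 4)) * (2 / (c / 4)) ^ d ≤
      exp (-(c * s * d / 8)) := by
    have h1 : exp (-(c * s / 8)) ≤ c / (2 * exp 1) := by
      have : log (2 * exp 1 / c) ≤ c * s / 8 := by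
        have := mul_le_mul_of_nonneg_left hs hc.le
        field_simp at this
        linarith
      have h2 : exp (-(c * s / 8)) ≤ exp (-log (2 * exp 1 / c)) := exp_le_exp.2 (by linarith)
      rwa [exp_neg (log _), exp_log (by positivity), inv_div] at h2
    have h3 : (2 * π) ^ (-(d / 2) : ℝ) ≤ (1 / 2) ^ d := by
      have e : (1 / 2 : ℝ) ^ d = 4 ^ (-(d / 2) : ℝ) := by
        rw [show (4 : ℝ) = 2 ^ (2 : ℝ) by norm_num, ← rpow_mul (by norm_num), ← rpow_natCast,
          one_div, inv_rpow (by norm_num), ← rpow_neg (by norm_num)]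
        congr 1; ring
      rw [e]
      apply rpow_le_rpow_of_nonpos (by norm_num)
      · have := Real.pi_gt_three; linarith
      · have : (0 : ℝ) ≤ d := by positivity
        linarith
    have e4 : exp (-(c * s * d / 4)) = exp (-(c * s / 8)) ^ d * exp (-(c * s * d / 8)) := by
      rw [← exp_nat_mul, ← exp_add]; ring_nf
    calc (2 * π) ^ (-(d / 2) : ℝ) * exp (-(c * s * d / 4)) * (2 / (c / 4)) ^ d
        ≤ (1 / 2) ^ d * ((c / (2 * exp 1)) ^ d * exp (-(c * s * d / 8))) * (2 / (c / 4)) ^ d := by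
          rw [e4]; gcongr
      _ = (2 / exp 1) ^ d * exp (-(c * s * d / 8)) := by
          have : (2 / exp 1) ^ d = (1 / 2) ^ d * (c / (2 * exp 1)) ^ d * (2 / (c / 4)) ^ d := by
            rw [← mul_pow, ← mul_pow]; congr 1; field_simp; norm_num
          rw [this]; ring
      _ ≤ 1 * exp (-(c * s * d / 8)) := by
          gcongr
          apply pow_le_one₀ (by positivity)
          rw [div_le_one (by positivity)]
          have := exp_one_gt_d9; linarith
      _ = _ := one_mul _
  have hpt : ∀ y ∈ {y : Vec d | s * √d < ‖y‖}, ((fun y => ENNReal.ofReal (stdDensity d y)) *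
      (fun y => ENNReal.ofReal (exp (‖y‖ ^ 2 / 2 - c * √d * ‖y‖ / 2))) : Vec d → ℝ≥0∞) y ≤
      ENNReal.ofReal ((2 * π) ^ (-(d / 2) : ℝ) * exp (-(c * s * d / 4))) *
        ENNReal.ofReal (exp (-(c / 4) * ∑ i, |y i|)) := by
    intro y hy
    rw [Pi.mul_apply, ← ENNReal.ofReal_mul (stdDensity_pos y).le,
      ← ENNReal.ofReal_mul (by positivity)]
    apply ENNReal.ofReal_le_ofReal
    rw [stdDensity, mul_assoc, mul_assoc ((2 * π) ^ (-(d / 2) : ℝ)), ← exp_add, ← exp_add]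
    refine mul_le_mul_of_nonneg_left (exp_le_exp.2 ?_) (by positivity)
    have h1 := sum_abs_le_sqrt_mul_norm y
    have h2 : s * d ≤ √d * ‖y‖ := by
      have h3 : √d * (s * √d) ≤ √d * ‖y‖ := mul_le_mul_of_nonneg_left (le_of_lt hy) (by positivity)
      have h4 : √(d : ℝ) * √d = d := mul_self_sqrt (by positivity)
      calc s * d = √d * (s * √d) := by linear_combination -s * h4
        _ ≤ _ := h3
    nlinarith [mul_le_mul_of_nonneg_left h1 hc.le, mul_le_mul_of_nonneg_left h2 hc.le]
  calc _ ≤ ∫⁻ y in {y : Vec d | s * √d < ‖y‖},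
        ENNReal.ofReal ((2 * π) ^ (-(d / 2) : ℝ) * exp (-(c * s * d / 4))) *
        ENNReal.ofReal (exp (-(c / 4) * ∑ i, |y i|)) := setLIntegral_mono' hS hpt
    _ ≤ ∫⁻ y : Vec d,
        ENNReal.ofReal ((2 * π) ^ (-(d / 2) : ℝ) * exp (-(c * s * d / 4))) *
        ENNReal.ofReal (exp (-(c / 4) * ∑ i, |y i|)) := setLIntegral_le_lintegral _ _
    _ = ENNReal.ofReal ((2 * π) ^ (-(d / 2) : ℝ) * exp (-(c * s * d / 4)) *
        (2 / (c / 4)) ^ d) := by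
        rw [lintegral_const_mul' _ _ ENNReal.ofReal_ne_top,
          lintegral_exp_neg_sum_abs d (by positivity), ← ENNReal.ofReal_mul (by positivity)]
    _ ≤ _ := ENNReal.ofReal_le_ofReal hq

end SkewLaplace

/-! ### Symmetric cubic forms of a Gaussian vector: decoupling and dimension-free moments. -/

namespace SkewLaplace

open ProbabilityTheory Real
open scoped ENNReal RealInnerProductSpace

/-- Continuous trilinear forms on `ℝ^d`, in curried form. -/
abbrev TriForm (d : ℕ) : Type := Vec d →L[ℝ] Vec d →L[ℝ] Vec d →L[ℝ] ℝ

/-- Symmetry of a trilinear form under permutations of its arguments. -/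
structure TriForm.IsSymm {d : ℕ} (B : TriForm d) : Prop where
  swap_left : ∀ x y z, B x y z = B y x z
  swap_right : ∀ x y z, B x y z = B x z y

section Cubic

variable {d : ℕ} {B : TriForm d}

lemma TriForm.IsSymm.apply_comb (hB : B.IsSymm) (x y : Vec d) (a b c e : ℝ) :
    B (a • x + b • y) (a • x + b • y) (c • x + e • y) =
      a ^ 2 * c * B x x x + (2 * a * b * c + a ^ 2 * e) * B x x y +
        (b ^ 2 * c + 2 * a * b * e) * B y y x + b ^ 2 * e * B y y y := by
  have h1 : B y x x = B x x y := by rw [hB.swap_left, hB.swap_right]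
  have h2 : B x y x = B x x y := by rw [hB.swap_right]
  have h3 : B x y y = B y y x := by rw [hB.swap_left, hB.swap_right]
  have h4 : B y x y = B y y x := by rw [hB.swap_right]
  simp only [map_add, map_smul, add_apply, smul_apply,
    smul_eq_mul, h1, h2, h3, h4]
  ring

/-- A symmetric cubic form on one copy of `ℝ^d` is a convex combination of rotated copies of a
bilinearly decoupled form on two copies. -/
lemma TriForm.IsSymm.diag_eq (hB : B.IsSymm) (x y : Vec d) :
    B x x x = 5 / 13 * (13 / 3 * B (cos (-(π / 2)) • x + sin (-(π / 2)) • y)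
        (cos (-(π / 2)) • x + sin (-(π / 2)) • y) (-sin (-(π / 2)) • x + cos (-(π / 2)) • y)) +
      (4 / 13 * (13 / 3 * B (cos (-(π / 6)) • x + sin (-(π / 6)) • y)
        (cos (-(π / 6)) • x + sin (-(π / 6)) • y) (-sin (-(π / 6)) • x + cos (-(π / 6)) • y)) +
      4 / 13 * (13 / 3 * B (cos (π / 6 - π) • x + sin (π / 6 - π) • y)
        (cos (π / 6 - π) • x + sin (π / 6 - π) • y)
        (-sin (π / 6 - π) • x + cos (π / 6 - π) • y))) := by
  simp only [hB.apply_comb, cos_neg, sin_neg, cos_pi_div_two, sin_pi_div_two, cos_pi_div_six,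
    sin_pi_div_six, cos_sub_pi, sin_sub_pi]
  -- The angles `-π/6` and `π/6 - π` share the sine and have opposite cosines, so the terms odd in
  -- the cosine (`B x x y` and `B y y y`) cancel. The angle `-π/2` contributes only `B y y x` and
  -- removes what remains of it. The weights `5/3, 4/3, 4/3` sum to `13/3`, hence the normalization
  -- by `13/3`.
  have h3 : √3 ^ 2 = (3 : ℝ) := sq_sqrt (by norm_num)
  linear_combination (-(1 / 3) * B x x x + (2 / 3) * B y y x) * h3

lemma TriForm.IsSymm.abs_apply_le (hB : B.IsSymm) {t : ℝ} (hb : ∀ y, |B y y y| ≤ t * ‖y‖ ^ 3)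
    (x z : Vec d) : |B x x z| ≤ 3 * t * ‖x‖ ^ 2 * ‖z‖ := by
  rcases eq_or_ne x 0 with rfl | hx
  · simp
  rcases eq_or_ne z 0 with rfl | hz
  · simp
  have hx' : 0 < ‖x‖ := norm_pos_iff.2 hx
  have hz' : 0 < ‖z‖ := norm_pos_iff.2 hz
  have ht : 0 ≤ t := by
    have := (abs_nonneg _).trans (hb x)
    by_contra h
    have : t * ‖x‖ ^ 3 < 0 := mul_neg_of_neg_of_pos (not_le.1 h) (by positivity)
    linarith
  -- Polarization on normalized vectors. The three cubes are bounded by `8t + 8t + 2t = 18t`, which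
  -- gives the constant `3 = 18/6`.
  have key : 6 * B x x z * (‖x‖⁻¹ ^ 2 * ‖z‖⁻¹) =
      B (‖x‖⁻¹ • x + ‖z‖⁻¹ • z) (‖x‖⁻¹ • x + ‖z‖⁻¹ • z) (‖x‖⁻¹ • x + ‖z‖⁻¹ • z) -
      B (‖x‖⁻¹ • x + (-‖z‖⁻¹) • z) (‖x‖⁻¹ • x + (-‖z‖⁻¹) • z) (‖x‖⁻¹ • x + (-‖z‖⁻¹) • z) -
      2 * B (‖z‖⁻¹ • z) (‖z‖⁻¹ • z) (‖z‖⁻¹ • z) := by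
    simp only [hB.apply_comb, map_smul, smul_apply, smul_eq_mul]
    ring
  have n1 : ‖‖x‖⁻¹ • x‖ = 1 := by rw [norm_smul]; simp [hx'.ne']
  have n2 : ‖‖z‖⁻¹ • z‖ = 1 := by rw [norm_smul]; simp [hz'.ne']
  have n3 : ‖‖x‖⁻¹ • x + ‖z‖⁻¹ • z‖ ≤ 2 := (norm_add_le _ _).trans (by rw [n1, n2]; norm_num)
  have n4 : ‖‖x‖⁻¹ • x + (-‖z‖⁻¹) • z‖ ≤ 2 :=
    (norm_add_le _ _).trans (by rw [n1, neg_smul, norm_neg, n2]; norm_num)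
  have b1 := hb (‖x‖⁻¹ • x + ‖z‖⁻¹ • z)
  have b2 := hb (‖x‖⁻¹ • x + (-‖z‖⁻¹) • z)
  have b3 := hb (‖z‖⁻¹ • z)
  have c1 : t * ‖‖x‖⁻¹ • x + ‖z‖⁻¹ • z‖ ^ 3 ≤ t * 2 ^ 3 := by gcongr
  have c2 : t * ‖‖x‖⁻¹ • x + (-‖z‖⁻¹) • z‖ ^ 3 ≤ t * 2 ^ 3 := by gcongr
  rw [n2] at b3
  have h18 : |6 * B x x z * (‖x‖⁻¹ ^ 2 * ‖z‖⁻¹)| ≤ 18 * t := by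
    rw [key]
    rw [abs_le] at b1 b2 b3 ⊢
    constructor <;> linarith [b1.1, b1.2, b2.1, b2.2, b3.1, b3.2]
  rw [abs_mul, abs_mul, abs_of_pos (by positivity : 0 < ‖x‖⁻¹ ^ 2 * ‖z‖⁻¹),
    abs_of_pos (by norm_num : (0 : ℝ) < 6)] at h18
  have e : |B x x z| = (6 * |B x x z| * (‖x‖⁻¹ ^ 2 * ‖z‖⁻¹)) * (‖x‖ ^ 2 * ‖z‖) / 6 := by
    field_simp
  rw [e]
  calc _ ≤ 18 * t * (‖x‖ ^ 2 * ‖z‖) / 6 := by gcongr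
    _ = _ := by ring

lemma TriForm.IsSymm.norm_apply_le (hB : B.IsSymm) {t : ℝ} (ht : 0 ≤ t)
    (hb : ∀ y, |B y y y| ≤ t * ‖y‖ ^ 3) (x : Vec d) : ‖B x x‖ ≤ 3 * t * ‖x‖ ^ 2 :=
  ContinuousLinearMap.opNorm_le_bound _ (by positivity) fun z => hB.abs_apply_le hb x z

/-- Decoupling: convex functionals of a symmetric cubic form of a Gaussian vector are controlled by
those of the form with one argument replaced by an independent copy. -/
lemma TriForm.IsSymm.lintegral_convex_le (hB : B.IsSymm) {Φ : ℝ → ℝ} (hΦ : ConvexOn ℝ Set.univ Φ)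
    (hm : Measurable Φ) (h0 : ∀ x, 0 ≤ Φ x) {ψ : ℝ → ℝ≥0∞} (hψ : Measurable ψ) :
    ∫⁻ z, ENNReal.ofReal (Φ (B z.1 z.1 z.1)) * ψ (‖z.1‖ ^ 2 + ‖z.2‖ ^ 2)
        ∂(stdGaussian (Vec d)).prod (stdGaussian (Vec d)) ≤
      ∫⁻ z, ENNReal.ofReal (Φ (13 / 3 * B z.1 z.1 z.2)) * ψ (‖z.1‖ ^ 2 + ‖z.2‖ ^ 2)
        ∂(stdGaussian (Vec d)).prod (stdGaussian (Vec d)) := by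
  set F : Vec d × Vec d → ℝ≥0∞ := fun z =>
    ENNReal.ofReal (Φ (13 / 3 * B z.1 z.1 z.2)) * ψ (‖z.1‖ ^ 2 + ‖z.2‖ ^ 2) with hF
  have hFm : Measurable F := by
    have h1 : Measurable fun z : Vec d × Vec d => 13 / 3 * B z.1 z.1 z.2 :=
      Continuous.measurable (by fun_prop)
    have h2 : Measurable fun z : Vec d × Vec d => ‖z.1‖ ^ 2 + ‖z.2‖ ^ 2 := by fun_prop
    exact (hm.comp h1).ennreal_ofReal.mul (hψ.comp h2)
  let R : ℝ → Vec d × Vec d → Vec d × Vec d := fun θ z =>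
    (cos θ • z.1 + sin θ • z.2, -sin θ • z.1 + cos θ • z.2)
  have hRm : ∀ θ, Measurable (R θ) := fun θ => by fun_prop
  -- Rotations preserve the total squared norm, so a weight depending only on it survives
  -- decoupling. It will serve as a truncation.
  have hnorm : ∀ θ z, ‖(R θ z).1‖ ^ 2 + ‖(R θ z).2‖ ^ 2 = ‖z.1‖ ^ 2 + ‖z.2‖ ^ 2 := by
    intro θ z
    simp only [R, norm_add_sq_real, norm_smul, mul_pow, norm_eq_abs, sq_abs, real_inner_smul_left,
      real_inner_smul_right]
    rw [neg_sq]
    linear_combination (‖z.1‖ ^ 2 + ‖z.2‖ ^ 2) * sin_sq_add_cos_sq θ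
  have hpt : ∀ z : Vec d × Vec d,
      ENNReal.ofReal (Φ (B z.1 z.1 z.1)) * ψ (‖z.1‖ ^ 2 + ‖z.2‖ ^ 2) ≤
      ENNReal.ofReal (5 / 13) * F (R (-(π / 2)) z) + (ENNReal.ofReal (4 / 13) * F (R (-(π / 6)) z) +
        ENNReal.ofReal (4 / 13) * F (R (π / 6 - π) z)) := by
    intro z
    simp only [hF, hnorm]
    rw [← mul_assoc, ← mul_assoc, ← mul_assoc, ← add_mul, ← add_mul,
      ← ENNReal.ofReal_mul (by norm_num), ← ENNReal.ofReal_mul (by norm_num),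
      ← ENNReal.ofReal_mul (by norm_num),
      ← ENNReal.ofReal_add (mul_nonneg (by norm_num) (h0 _)) (mul_nonneg (by norm_num) (h0 _)),
      ← ENNReal.ofReal_add (mul_nonneg (by norm_num) (h0 _))
        (add_nonneg (mul_nonneg (by norm_num) (h0 _)) (mul_nonneg (by norm_num) (h0 _)))]
    gcongr
    conv_lhs => rw [hB.diag_eq z.1 z.2]
    have h3 : ∀ u v w : ℝ, Φ (5 / 13 * u + (4 / 13 * v + 4 / 13 * w)) ≤
        5 / 13 * Φ u + (4 / 13 * Φ v + 4 / 13 * Φ w) := by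
      intro u v w
      have e1 := hΦ.2 (Set.mem_univ u) (Set.mem_univ (1 / 2 * v + 1 / 2 * w))
        (by norm_num : (0 : ℝ) ≤ 5 / 13) (by norm_num : (0 : ℝ) ≤ 8 / 13) (by norm_num)
      have e2 := hΦ.2 (Set.mem_univ v) (Set.mem_univ w)
        (by norm_num : (0 : ℝ) ≤ 1 / 2) (by norm_num : (0 : ℝ) ≤ 1 / 2) (by norm_num)
      simp only [smul_eq_mul] at e1 e2
      have e3 : 5 / 13 * u + 8 / 13 * (1 / 2 * v + 1 / 2 * w) =
        5 / 13 * u + (4 / 13 * v + 4 / 13 * w) := by ring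
      rw [e3] at e1
      linarith
    exact h3 _ _ _
  refine (lintegral_mono hpt).trans ?_
  have hm1 : ∀ θ, Measurable fun z => F (R θ z) := fun θ => hFm.comp (hRm θ)
  rw [lintegral_add_left ((hm1 _).const_mul _), lintegral_add_left ((hm1 _).const_mul _),
    lintegral_const_mul _ (hm1 _), lintegral_const_mul _ (hm1 _), lintegral_const_mul _ (hm1 _)]
  simp only [R, lintegral_rotation _ hFm]
  rw [← add_mul, ← add_mul, ← ENNReal.ofReal_add (by norm_num) (by norm_num),
    ← ENNReal.ofReal_add (by norm_num) (by norm_num)]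
  norm_num

/-- Chernoff's bound with `exp (‖y‖²/4)`: the probability is at most `e^{-d} e^{d/2} ≤ e^{-1/2}`. -/
lemma measure_lt_norm_le (hd : 1 ≤ d) {s : ℝ} (hs : 2 ≤ s) :
    stdGaussian (Vec d) {y | s * √d < ‖y‖} ≤ ENNReal.ofReal (2 / 3) := by
  have hd' : (1 : ℝ) ≤ d := by exact_mod_cast hd
  have h1 : stdGaussian (Vec d) {y | s * √d < ‖y‖} ≤
      ∫⁻ y, ENNReal.ofReal (exp (-d)) * ENNReal.ofReal (exp (1 / 4 * ‖y‖ ^ 2))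
        ∂stdGaussian (Vec d) := by
    have hS : MeasurableSet {y : Vec d | s * √d < ‖y‖} :=
      measurableSet_lt (by fun_prop) (by fun_prop)
    rw [← lintegral_indicator_one hS]
    refine lintegral_mono fun y => ?_
    by_cases hy : y ∈ {y : Vec d | s * √d < ‖y‖}
    · rw [Set.indicator_of_mem hy, ← ENNReal.ofReal_mul (exp_pos _).le, ← exp_add, Pi.one_apply,
        ← ENNReal.ofReal_one]
      apply ENNReal.ofReal_le_ofReal
      rw [one_le_exp_iff]
      have hy' : 2 * √d ≤ ‖y‖ :=
        (mul_le_mul_of_nonneg_right hs (by positivity)).trans (le_of_lt hy)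
      have : (2 * √d) ^ 2 ≤ ‖y‖ ^ 2 := by gcongr
      rw [mul_pow, sq_sqrt (by positivity)] at this
      linarith
    · rw [Set.indicator_of_notMem hy]
      exact zero_le
  refine h1.trans ?_
  rw [lintegral_const_mul' _ _ ENNReal.ofReal_ne_top]
  refine (mul_le_mul_right (lintegral_exp_sq_norm_le (by norm_num) le_rfl) _).trans ?_
  rw [← ENNReal.ofReal_mul (exp_pos _).le, ← exp_add]
  apply ENNReal.ofReal_le_ofReal
  calc exp (-d + 2 * (1 / 4) * d) ≤ exp (-(1 / 2)) := exp_le_exp.2 (by linarith)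
    _ ≤ 2 / 3 := by
      rw [exp_neg, inv_le_comm₀ (exp_pos _) (by norm_num)]
      have := add_one_le_exp (1 / 2 : ℝ)
      linarith

lemma one_third_le_measure_norm_le (hd : 1 ≤ d) {s : ℝ} (hs : 2 ≤ s) :
    ENNReal.ofReal (1 / 3) ≤ stdGaussian (Vec d) {y | ‖y‖ ≤ s * √d} := by
  have hS : MeasurableSet {y : Vec d | s * √d < ‖y‖} :=
    measurableSet_lt (by fun_prop) (by fun_prop)
  have e : {y : Vec d | ‖y‖ ≤ s * √d} = {y | s * √d < ‖y‖}ᶜ := by ext; simp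
  rw [e, prob_compl_eq_one_sub hS]
  apply ENNReal.le_sub_of_add_le_left (by simp)
  calc _ ≤ ENNReal.ofReal (2 / 3) + ENNReal.ofReal (1 / 3) := by
        gcongr; exact measure_lt_norm_le hd hs
    _ = 1 := by rw [← ENNReal.ofReal_add (by norm_num) (by norm_num)]; norm_num

/-- Decoupling, then integration in the independent copy, replaces the cubic exponential by the
Gaussian one `exp (‖a (13/3) B x x‖²/2)`. This is quartic in `x`; truncation bounds one factor
`‖x‖²` and leaves an integrable `exp (q‖x‖²)`. -/
lemma TriForm.IsSymm.setLIntegral_exp_le_of_small (hB : B.IsSymm) (hd : 1 ≤ d) {σ s a : ℝ}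
    (hσ : 0 ≤ σ) (hs : 13 ≤ s) (hb : ∀ y, |B y y y| ≤ σ / d * ‖y‖ ^ 3) (ha : |a| = 2 / 3)
    (hsm : 26 * (σ * s) ≤ √d) :
    ∫⁻ y in {y : Vec d | ‖y‖ ≤ s * √d}, ENNReal.ofReal (exp (a * B y y y)) ∂stdGaussian (Vec d) ≤
      ENNReal.ofReal (3 * exp (4 * σ ^ 2 * s ^ 4)) := by
  have hd' : (1 : ℝ) ≤ d := by exact_mod_cast hd
  set U : Set (Vec d) := {y | ‖y‖ ≤ s * √d} with hU
  have hUm : MeasurableSet U := measurableSet_le (by fun_prop) (by fun_prop)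
  -- The ball itself is not rotation invariant on pairs. The total norm is, and this set contains
  -- the product of two balls. Discarding the second ball costs its mass, at least `1/3`, hence the
  -- factor `3` in the bound.
  set ψ : ℝ → ℝ≥0∞ := Set.indicator (Set.Iic (2 * (s ^ 2 * d))) 1 with hψ
  have hψm : Measurable ψ := measurable_one.indicator measurableSet_Iic
  have hconv : ConvexOn ℝ Set.univ fun x => exp (a * x) :=
    convexOn_exp.comp_linearMap (LinearMap.mulLeft ℝ a)
  have hdec := hB.lintegral_convex_le hconv (by fun_prop) (fun x => (exp_pos _).le) hψm
  have hsq : (s * √d) ^ 2 = s ^ 2 * d := by rw [mul_pow, sq_sqrt (by positivity)]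
  have hleft : (∫⁻ y in U, ENNReal.ofReal (exp (a * B y y y)) ∂stdGaussian (Vec d)) *
      stdGaussian (Vec d) U ≤
      ∫⁻ z, ENNReal.ofReal (exp (a * B z.1 z.1 z.1)) * ψ (‖z.1‖ ^ 2 + ‖z.2‖ ^ 2)
        ∂(stdGaussian (Vec d)).prod (stdGaussian (Vec d)) := by
    rw [← lintegral_indicator hUm, ← lintegral_indicator_one hUm, ← lintegral_prod_mul]
    · refine lintegral_mono fun z => ?_
      by_cases h1 : z.1 ∈ U
      · by_cases h2 : z.2 ∈ U
        · rw [Set.indicator_of_mem h1, Set.indicator_of_mem h2, hψ, Set.indicator_of_mem]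
          · rfl
          · have e1 : ‖z.1‖ ^ 2 ≤ (s * √d) ^ 2 := by gcongr; exact h1
            have e2 : ‖z.2‖ ^ 2 ≤ (s * √d) ^ 2 := by gcongr; exact h2
            rw [Set.mem_Iic]
            linarith
        · rw [Set.indicator_of_notMem h2, mul_zero]; exact zero_le
      · rw [Set.indicator_of_notMem h1, zero_mul]; exact zero_le
    · refine (Measurable.indicator (Measurable.ennreal_ofReal ?_) hUm).aemeasurable
      exact Continuous.measurable (by fun_prop)
    · exact (measurable_one.indicator hUm).aemeasurable
  -- `(2/3 · 13/3)²/2` is rounded up to `38/9`, and `76 = 38/9 · 18`, with `18` from `‖B x x‖² ≤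
  -- 9σ²‖x‖⁴/d²` and `‖x‖² ≤ 2s²d`. The smallness assumption makes `q ≤ 1/4`.
  set q : ℝ := 76 * σ ^ 2 * s ^ 2 / d with hq
  have hq4 : q ≤ 1 / 4 := by
    have h1 : (26 * (σ * s)) ^ 2 ≤ (√d) ^ 2 := by gcongr
    rw [sq_sqrt (by positivity)] at h1
    rw [hq, div_le_iff₀ (by positivity)]
    nlinarith
  have hinner : ∀ x : Vec d, ∫⁻ y, ENNReal.ofReal (exp (a * (13 / 3 * B x x y))) *
      ψ (‖x‖ ^ 2 + ‖y‖ ^ 2) ∂stdGaussian (Vec d) ≤ ENNReal.ofReal (exp (q * ‖x‖ ^ 2)) := by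
    intro x
    by_cases hx : ‖x‖ ^ 2 ≤ 2 * (s ^ 2 * d)
    · have h1 : ∀ y, ENNReal.ofReal (exp (a * (13 / 3 * B x x y))) * ψ (‖x‖ ^ 2 + ‖y‖ ^ 2) ≤
          ENNReal.ofReal (exp (((a * (13 / 3)) • B x x) y)) := by
        intro y
        have : ψ (‖x‖ ^ 2 + ‖y‖ ^ 2) ≤ 1 := Set.indicator_le (fun _ _ => le_rfl) _
        calc _ ≤ ENNReal.ofReal (exp (a * (13 / 3 * B x x y))) * 1 := by gcongr
          _ = _ := by simp [mul_assoc]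
      refine (lintegral_mono h1).trans ?_
      rw [lintegral_exp_dual]
      apply ENNReal.ofReal_le_ofReal
      rw [exp_le_exp, norm_smul, norm_eq_abs, abs_mul, ha]
      have h2 := hB.norm_apply_le (by positivity) hb x
      have h3 : ‖B x x‖ ^ 2 ≤ (3 * (σ / d) * ‖x‖ ^ 2) ^ 2 := by gcongr
      have h4 : (3 * (σ / d) * ‖x‖ ^ 2) ^ 2 ≤ 18 * σ ^ 2 * s ^ 2 / d * ‖x‖ ^ 2 := by
        have : (3 * (σ / d) * ‖x‖ ^ 2) ^ 2 = 9 * σ ^ 2 / d ^ 2 * ‖x‖ ^ 2 * ‖x‖ ^ 2 := by ring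
        rw [this]
        calc _ ≤ 9 * σ ^ 2 / d ^ 2 * ‖x‖ ^ 2 * (2 * (s ^ 2 * d)) := by gcongr
          _ = _ := by field_simp; ring
      rw [mul_pow, abs_of_pos (by norm_num : (0 : ℝ) < 13 / 3)]
      have h5 : q * ‖x‖ ^ 2 = 38 / 9 * (18 * σ ^ 2 * s ^ 2 / d * ‖x‖ ^ 2) := by
        rw [hq]; ring
      rw [h5]
      have : 0 ≤ 18 * σ ^ 2 * s ^ 2 / d * ‖x‖ ^ 2 := by positivity
      norm_num
      linarith
    · have h1 : ∀ y : Vec d, ENNReal.ofReal (exp (a * (13 / 3 * B x x y))) *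
          ψ (‖x‖ ^ 2 + ‖y‖ ^ 2) = 0 := by
        intro y
        rw [hψ, Set.indicator_of_notMem, mul_zero]
        rw [Set.mem_Iic, not_le]
        have : 0 ≤ ‖y‖ ^ 2 := by positivity
        linarith
      simp [h1]
  have hright : ∫⁻ z, ENNReal.ofReal (exp (a * (13 / 3 * B z.1 z.1 z.2))) *
      ψ (‖z.1‖ ^ 2 + ‖z.2‖ ^ 2) ∂(stdGaussian (Vec d)).prod (stdGaussian (Vec d)) ≤
      ENNReal.ofReal (exp (4 * σ ^ 2 * s ^ 4)) := by
    rw [lintegral_prod]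
    · refine (lintegral_mono hinner).trans ((lintegral_exp_sq_norm_le (by positivity) hq4).trans ?_)
      apply ENNReal.ofReal_le_ofReal
      rw [exp_le_exp]
      have e : 2 * q * d = 152 * (σ ^ 2 * s ^ 2) := by rw [hq]; field_simp; ring
      rw [e]
      have h1 : 152 ≤ 4 * s ^ 2 := by nlinarith
      have h2 : 0 ≤ σ ^ 2 * s ^ 2 := by positivity
      nlinarith
    · refine (Measurable.mul ?_ (hψm.comp (by fun_prop))).aemeasurable
      refine Measurable.ennreal_ofReal (Continuous.measurable (by fun_prop))
  have hfin := (hleft.trans hdec).trans hright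
  have hthird := one_third_le_measure_norm_le hd (by linarith : 2 ≤ s)
  calc _ = ENNReal.ofReal 3 * ((∫⁻ y in U, ENNReal.ofReal (exp (a * B y y y))
          ∂stdGaussian (Vec d)) * ENNReal.ofReal (1 / 3)) := by
        rw [mul_comm, mul_assoc, ← ENNReal.ofReal_mul (by norm_num)]; norm_num
    _ ≤ ENNReal.ofReal 3 * ENNReal.ofReal (exp (4 * σ ^ 2 * s ^ 4)) := by
        gcongr
        exact (mul_le_mul_right hthird _).trans hfin
    _ = _ := by rw [← ENNReal.ofReal_mul (by norm_num)]

/-- Three regimes for `σs` against `√d`. If it is small, decoupling applies with both signs of `a`,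
where `2/3 = 4/6`. In the middle range the cubic is at most `a‖y‖²` on the ball with `a ≤ 1/4`. If
it is large, the supremum over the ball is already below `4σ²s⁴`. -/
lemma TriForm.IsSymm.setLIntegral_exp_le (hB : B.IsSymm) (hd : 1 ≤ d) {σ s : ℝ}
    (hσ : 0 ≤ σ) (hs : 13 ≤ s) (hb : ∀ y, |B y y y| ≤ σ / d * ‖y‖ ^ 3) :
    ∫⁻ y in {y : Vec d | ‖y‖ ≤ s * √d},
      ENNReal.ofReal (exp (4 * |B y y y / 6|)) ∂stdGaussian (Vec d) ≤
      ENNReal.ofReal (6 * exp (4 * σ ^ 2 * s ^ 4)) := by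
  have hd' : (1 : ℝ) ≤ d := by exact_mod_cast hd
  have hUm : MeasurableSet {y : Vec d | ‖y‖ ≤ s * √d} :=
    measurableSet_le (by fun_prop) (by fun_prop)
  have hsqd : √(d : ℝ) ^ 2 = d := sq_sqrt (by positivity)
  have hsd : 0 < √(d : ℝ) := by positivity
  rcases le_total (26 * (σ * s)) √d with hsm | hbig
  · have h1 := hB.setLIntegral_exp_le_of_small hd hσ hs hb (a := 2 / 3) (by norm_num) hsm
    have h2 := hB.setLIntegral_exp_le_of_small hd hσ hs hb (a := -(2 / 3)) (by norm_num) hsm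
    calc _ ≤ ∫⁻ y in {y : Vec d | ‖y‖ ≤ s * √d}, (ENNReal.ofReal (exp (2 / 3 * B y y y)) +
          ENNReal.ofReal (exp (-(2 / 3) * B y y y))) ∂stdGaussian (Vec d) := by
          refine lintegral_mono fun y => ?_
          rw [← ENNReal.ofReal_add (exp_pos _).le (exp_pos _).le]
          apply ENNReal.ofReal_le_ofReal
          rcases abs_cases (B y y y / 6) with ⟨h, -⟩ | ⟨h, -⟩
          · rw [h, show 4 * (B y y y / 6) = 2 / 3 * B y y y by ring]
            linarith [exp_pos (-(2 / 3) * B y y y)]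
          · rw [h, show 4 * -(B y y y / 6) = -(2 / 3) * B y y y by ring]
            linarith [exp_pos (2 / 3 * B y y y)]
      _ ≤ ENNReal.ofReal (3 * exp (4 * σ ^ 2 * s ^ 4)) +
          ENNReal.ofReal (3 * exp (4 * σ ^ 2 * s ^ 4)) := by
          rw [lintegral_add_left]
          · exact add_le_add h1 h2
          · exact Measurable.ennreal_ofReal (Continuous.measurable (by fun_prop))
      _ = _ := by rw [← ENNReal.ofReal_add (by positivity) (by positivity)]; ring_nf
  · have hpt : ∀ y ∈ {y : Vec d | ‖y‖ ≤ s * √d},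
        4 * |B y y y / 6| ≤ 2 / 3 * (σ * s) / √d * ‖y‖ ^ 2 := by
      intro y hy
      have h1 := hb y
      have h2 : σ / d * ‖y‖ ^ 3 ≤ (σ * s) / √d * ‖y‖ ^ 2 := by
        calc σ / d * ‖y‖ ^ 3 = σ / d * ‖y‖ ^ 2 * ‖y‖ := by ring
          _ ≤ σ / d * ‖y‖ ^ 2 * (s * √d) := by gcongr; exact hy
          _ = _ := by
            rw [show σ / (d : ℝ) = σ / √d ^ 2 by rw [hsqd]]
            field_simp
      rw [abs_div, abs_of_pos (by norm_num : (0 : ℝ) < 6)]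
      calc _ = 2 / 3 * |B y y y| := by ring
        _ ≤ 2 / 3 * ((σ * s) / √d * ‖y‖ ^ 2) := by gcongr; exact h1.trans h2
        _ = _ := by ring
    rcases le_total (8 / 3 * (σ * s)) √d with hmid | hlarge
    · set a : ℝ := 2 / 3 * (σ * s) / √d with ha
      have ha0 : 0 ≤ a := by positivity
      have ha4 : a ≤ 1 / 4 := by
        rw [ha, div_le_iff₀ hsd]; linarith
      calc _ ≤ ∫⁻ y in {y : Vec d | ‖y‖ ≤ s * √d}, ENNReal.ofReal (exp (a * ‖y‖ ^ 2))
            ∂stdGaussian (Vec d) :=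
            setLIntegral_mono' hUm fun y hy =>
              ENNReal.ofReal_le_ofReal (exp_le_exp.2 (hpt y hy))
        _ ≤ _ := setLIntegral_le_lintegral _ _
        _ ≤ _ := lintegral_exp_sq_norm_le ha0 ha4
        _ ≤ _ := by
          apply ENNReal.ofReal_le_ofReal
          have h1 : 2 * a * d ≤ 4 * σ ^ 2 * s ^ 4 := by
            have e : 2 * a * d = 4 / 3 * (σ * s) * √d := by
              rw [ha]; nth_rewrite 2 [← hsqd]; field_simp; ring
            rw [e]
            have h2 : 26 ≤ 3 * s ^ 2 := by nlinarith
            have h0 : 0 ≤ σ * s := by positivity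
            calc 4 / 3 * (σ * s) * √d ≤ 4 / 3 * (σ * s) * (26 * (σ * s)) := by gcongr
              _ = 4 / 3 * (σ * s) ^ 2 * 26 := by ring
              _ ≤ 4 / 3 * (σ * s) ^ 2 * (3 * s ^ 2) := by gcongr
              _ = _ := by ring
          have h3 := exp_le_exp.2 h1
          have h4 := exp_pos (4 * σ ^ 2 * s ^ 4)
          linarith
    · calc _ ≤ ∫⁻ y in {y : Vec d | ‖y‖ ≤ s * √d}, ENNReal.ofReal (6 * exp (4 * σ ^ 2 * s ^ 4))
            ∂stdGaussian (Vec d) := by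
            refine setLIntegral_mono' hUm fun y hy => ENNReal.ofReal_le_ofReal ?_
            have h1 : 4 * |B y y y / 6| ≤ 4 * σ ^ 2 * s ^ 4 := by
              refine (hpt y hy).trans ?_
              have hy2 : ‖y‖ ^ 2 ≤ (s * √d) ^ 2 := by gcongr; exact hy
              have h0 : 0 ≤ σ * s := by positivity
              calc _ ≤ 2 / 3 * (σ * s) / √d * (s * √d) ^ 2 := by gcongr
                _ = 2 / 3 * (σ * s) * s ^ 2 * √d := by field_simp
                _ ≤ 2 / 3 * (σ * s) * s ^ 2 * (8 / 3 * (σ * s)) := by gcongr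
                _ = 16 / 9 * σ ^ 2 * s ^ 4 := by ring
                _ ≤ _ := by gcongr; norm_num
            have h3 := exp_le_exp.2 h1
            have h4 := exp_pos (4 * σ ^ 2 * s ^ 4)
            linarith
        _ ≤ _ := by
            rw [setLIntegral_const]
            exact mul_le_of_le_one_right zero_le prob_le_one

/-- `w^k ≤ k! 4^k e^{w/4}` with `w = ‖y‖²/d`, and `e^{w/4}` has mean at most `√e ≤ 2`. -/
lemma lintegral_norm_sq_div_pow_le (hd : 1 ≤ d) (k : ℕ) :
    ∫⁻ y, ENNReal.ofReal ((‖y‖ ^ 2 / d) ^ k) ∂stdGaussian (Vec d) ≤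
      ENNReal.ofReal (k.factorial * 4 ^ k * 2) := by
  have hd' : (1 : ℝ) ≤ d := by exact_mod_cast hd
  calc _ ≤ ∫⁻ y, ENNReal.ofReal (k.factorial * 4 ^ k) *
        ENNReal.ofReal (exp (1 / (4 * d) * ‖y‖ ^ 2)) ∂stdGaussian (Vec d) := by
        refine lintegral_mono fun y => ?_
        rw [← ENNReal.ofReal_mul (by positivity)]
        apply ENNReal.ofReal_le_ofReal
        have h := pow_div_factorial_le_exp (x := ‖y‖ ^ 2 / d / 4) (by positivity) k
        rw [div_le_iff₀ (by positivity), div_pow, div_le_iff₀ (by positivity)] at h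
        have e : 1 / (4 * d) * ‖y‖ ^ 2 = ‖y‖ ^ 2 / d / 4 := by field_simp
        rw [e]
        linarith
    _ ≤ ENNReal.ofReal (k.factorial * 4 ^ k) * ENNReal.ofReal (exp (2 * (1 / (4 * d)) * d)) := by
        rw [lintegral_const_mul' _ _ ENNReal.ofReal_ne_top]
        gcongr
        refine lintegral_exp_sq_norm_le (by positivity) ?_
        gcongr
        linarith
    _ ≤ _ := by
        rw [← ENNReal.ofReal_mul (by positivity)]
        gcongr
        have e : 2 * (1 / (4 * d)) * d = (1 / 2 : ℝ) := by field_simp; norm_num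
        rw [e]
        have h1 : exp (1 / 2) ^ 2 ≤ 2 ^ 2 := by
          rw [← exp_nat_mul]
          have := exp_one_lt_d9
          norm_num
          linarith
        exact le_of_sq_le_sq h1 (by norm_num)

/-- After decoupling with the convex function `x^k`, the form is conditionally a centred Gaussian of
standard deviation at most `13σ‖x‖²/d`. Only moments of `‖x‖²/d` remain, and these do not grow with
`d`. -/
lemma exists_lintegral_cubic_pow_le {k : ℕ} (hk : Even k) :
    ∃ C : ℝ, 0 ≤ C ∧ ∀ (d : ℕ) (B : TriForm d) (σ : ℝ), 1 ≤ d → B.IsSymm → 0 ≤ σ →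
      (∀ y, |B y y y| ≤ σ / d * ‖y‖ ^ 3) →
      ∫⁻ y, ENNReal.ofReal (B y y y ^ k) ∂stdGaussian (Vec d) ≤ ENNReal.ofReal (C * σ ^ k) := by
  set m : ℝ≥0∞ := ∫⁻ x, ENNReal.ofReal (x ^ k) ∂gaussianReal 0 1 with hm
  have hmt : m ≠ ∞ := (lintegral_gaussianReal_pow_lt_top hk).ne
  refine ⟨m.toReal * 13 ^ k * (k.factorial * 4 ^ k * 2), by positivity, ?_⟩
  intro d B σ hd hB hσ hb
  have hd' : (1 : ℝ) ≤ d := by exact_mod_cast hd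
  have h := hB.lintegral_convex_le (hk.convexOn_pow) (by fun_prop) (fun x => hk.pow_nonneg x)
    (ψ := 1) measurable_one
  simp only [Pi.one_apply, mul_one] at h
  rw [lintegral_prod _ (Measurable.aemeasurable
    (Measurable.ennreal_ofReal (Continuous.measurable (by fun_prop)))),
    lintegral_prod _ (Measurable.aemeasurable
    (Measurable.ennreal_ofReal (Continuous.measurable (by fun_prop))))] at h
  simp only [lintegral_const, measure_univ, mul_one] at h
  refine h.trans ?_
  calc _ ≤ ∫⁻ x, ENNReal.ofReal ((13 * σ) ^ k) * m * ENNReal.ofReal ((‖x‖ ^ 2 / d) ^ k)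
        ∂stdGaussian (Vec d) := by
        refine lintegral_mono fun x => ?_
        have e := lintegral_dual_pow ((13 / 3 : ℝ) • B x x) k
        simp only [smul_apply, smul_eq_mul] at e
        rw [e, ← hm, mul_right_comm]
        gcongr
        rw [← ENNReal.ofReal_mul (by positivity), ← mul_pow]
        gcongr
        rw [norm_smul]
        have := hB.norm_apply_le (by positivity) hb x
        calc ‖(13 / 3 : ℝ)‖ * ‖B x x‖ ≤ 13 / 3 * (3 * (σ / d) * ‖x‖ ^ 2) := by
              rw [norm_of_nonneg (by norm_num)]; gcongr
          _ = _ := by ring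
    _ ≤ ENNReal.ofReal ((13 * σ) ^ k) * m * ENNReal.ofReal (k.factorial * 4 ^ k * 2) := by
        rw [lintegral_const_mul' _ _ (by finiteness)]
        gcongr
        exact lintegral_norm_sq_div_pow_le hd k
    _ = _ := by
        rw [← ENNReal.ofReal_toReal hmt, ← ENNReal.ofReal_mul (by positivity),
          ← ENNReal.ofReal_mul (by positivity), ENNReal.toReal_ofReal ENNReal.toReal_nonneg]
        congr 1
        rw [mul_pow]
        ring

end Cubic

end SkewLaplace

/-! ### Scalar expansions of `exp (-r)` by parity, and a common dominating function. -/

namespace SkewLaplace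

open ProbabilityTheory Real
open scoped ENNReal RealInnerProductSpace

lemma exp_sub_one_le_mul_exp (x : ℝ) : exp x - 1 ≤ x * exp x := by
  have h := one_sub_le_exp_neg x
  have h2 : exp x * exp (-x) = 1 := by rw [← exp_add]; simp
  nlinarith [exp_pos x]

lemma abs_exp_neg_sub_one_le (x : ℝ) : |exp (-x) - 1| ≤ |x| * exp |x| := by
  rw [abs_le]
  have h1 := exp_sub_one_le_mul_exp (-x)
  have h2 := add_one_le_exp (-x)
  have h3 : exp (-x) ≤ exp |x| := exp_le_exp.2 (neg_le_abs x)
  have h4 : 1 ≤ exp |x| := one_le_exp (abs_nonneg x)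
  have h5 := le_abs_self x
  have h6 := neg_le_abs x
  constructor
  · nlinarith [abs_nonneg x]
  · nlinarith [abs_nonneg x, exp_pos (-x)]

lemma sinh_le_mul_exp {x : ℝ} (hx : 0 ≤ x) : sinh x ≤ x * exp x := by
  rw [sinh_eq]
  have h := exp_sub_one_le_mul_exp x
  have h2 := one_sub_le_exp_neg x
  have h3 : x ≤ x * exp x := le_mul_of_one_le_right hx (one_le_exp hx)
  linarith

lemma cosh_sub_one_le_sq_mul_exp {x : ℝ} (hx : 0 ≤ x) : cosh x - 1 ≤ x ^ 2 * exp x := by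
  have h := sinh_le_mul_exp (by linarith : 0 ≤ x / 2)
  have h0 : 0 ≤ sinh (x / 2) := sinh_nonneg_iff.2 (by linarith)
  have e : cosh x = 1 + 2 * sinh (x / 2) ^ 2 := by
    have := cosh_two_mul (x / 2)
    rw [cosh_sq, mul_div_cancel₀ x two_ne_zero] at this
    linarith
  have h2 : sinh (x / 2) ^ 2 ≤ (x / 2 * exp (x / 2)) ^ 2 := by gcongr
  have e2 : (x / 2 * exp (x / 2)) ^ 2 = x ^ 2 / 4 * exp x := by
    rw [mul_pow, ← exp_nat_mul]; push_cast; ring_nf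
  have : 0 ≤ x ^ 2 * exp x := by positivity
  rw [e]
  linarith

/-- Both sides vanish at `0`, and the derivatives compare by `cosh_sub_one_le_sq_mul_exp`. -/
lemma sinh_sub_self_le {x : ℝ} (hx : 0 ≤ x) : sinh x - x ≤ x ^ 3 * exp x := by
  have hmono : MonotoneOn (fun x : ℝ => x ^ 3 * exp x - (sinh x - x)) (Set.Ici 0) := by
    apply monotoneOn_of_hasDerivWithinAt_nonneg (convex_Ici 0) (by fun_prop)
      (f' := fun x => 3 * x ^ 2 * exp x + x ^ 3 * exp x - (cosh x - 1))
    · intro y _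
      have h1 : HasDerivAt (fun x : ℝ => x ^ 3 * exp x - (sinh x - x))
          (((3 : ℕ) * y ^ (3 - 1)) * exp y + y ^ 3 * exp y - (cosh y - 1)) y :=
        ((hasDerivAt_pow 3 y).mul (hasDerivAt_exp y)).sub
          ((hasDerivAt_sinh y).sub (hasDerivAt_id y))
      exact (by simpa using h1 : HasDerivAt _ _ _).hasDerivWithinAt
    · intro y hy
      rw [interior_Ici] at hy
      have hy' : (0 : ℝ) < y := hy
      have := cosh_sub_one_le_sq_mul_exp hy'.le
      have h2 : 0 ≤ y ^ 2 * exp y := by positivity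
      have h3 : 0 ≤ y ^ 3 * exp y := by positivity
      linarith
  have := hmono (Set.self_mem_Ici) hx hx
  simp at this
  linarith

lemma abs_sinh_le (x : ℝ) : |sinh x| ≤ |x| * exp |x| := by
  rw [abs_sinh]; exact sinh_le_mul_exp (abs_nonneg x)

lemma cosh_sub_one_le (x : ℝ) : cosh x - 1 ≤ |x| ^ 2 * exp |x| := by
  rw [← cosh_abs]; exact cosh_sub_one_le_sq_mul_exp (abs_nonneg x)

lemma abs_sinh_sub_self_le (x : ℝ) : |sinh x - x| ≤ |x| ^ 3 * exp |x| := by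
  rcases le_total 0 x with h | h
  · rw [abs_of_nonneg h, abs_of_nonneg (sub_nonneg.2 (self_le_sinh_iff.2 h))]
    exact sinh_sub_self_le h
  · have h' : 0 ≤ -x := by linarith
    have h1 := sinh_sub_self_le h'
    have h2 : sinh x ≤ x := sinh_le_self_iff.2 h
    rw [abs_of_nonpos h, abs_of_nonpos (by linarith)]
    rw [sinh_neg] at h1
    linarith

lemma cosh_le_exp_abs (x : ℝ) : cosh x ≤ exp |x| := by
  rw [cosh_eq]
  have h1 : exp x ≤ exp |x| := exp_le_exp.2 (le_abs_self x)
  have h2 : exp (-x) ≤ exp |x| := exp_le_exp.2 (neg_le_abs x)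
  linarith

/-- The odd part of `exp (-r)` is `-p` up to errors of higher order. -/
lemma abs_odd_part_exp_neg_add_le {a b p P β : ℝ} (hp : |p| ≤ P) (hab : |a + b| ≤ 2 * β)
    (hba : |a - b - 2 * p| ≤ 2 * β) :
    |(exp (-a) - exp (-b)) / 2 + p| ≤
      exp (2 * β) * exp P * (β * (P + β) + (P + β) ^ 3) + |a - b - 2 * p| / 2 := by
  set e := (a + b) / 2 with he
  set o := (a - b) / 2 with ho
  have hae : a = e + o := by rw [he, ho]; ring
  have hbe : b = e - o := by rw [he, ho]; ring
  have heβ : |e| ≤ β := by rw [he, abs_div, abs_two]; linarith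
  have hoP : |o| ≤ P + β := by
    have : o = (a - b - 2 * p) / 2 + p := by rw [ho]; ring
    rw [this]
    refine (abs_add_le _ _).trans ?_
    rw [abs_div, abs_two]
    linarith
  have hβ0 : 0 ≤ β := (abs_nonneg _).trans heβ
  have hP0 : 0 ≤ P := (abs_nonneg _).trans hp
  -- With `e` and `o` the even and odd parts of the exponent, the left side is `p - e^{-e} sinh o`.
  -- It splits into three errors: replacing `e^{-e}` by `1`, `sinh o` by `o`, and `o` by `p`.
  have key : (exp (-a) - exp (-b)) / 2 + p =
      -((exp (-e) - 1) * sinh o) - (sinh o - o) - (a - b - 2 * p) / 2 := by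
    have h1 : exp (-a) = exp (-e) * exp (-o) := by rw [← exp_add, hae]; ring_nf
    have h2 : exp (-b) = exp (-e) * exp o := by rw [← exp_add, hbe]; ring_nf
    rw [h1, h2, sinh_eq, hae, hbe]
    ring
  rw [key]
  have t1 : |(exp (-e) - 1) * sinh o| ≤ exp (2 * β) * exp P * (β * (P + β)) := by
    rw [abs_mul]
    calc _ ≤ (|e| * exp |e|) * (|o| * exp |o|) :=
          mul_le_mul (abs_exp_neg_sub_one_le e) (abs_sinh_le o) (abs_nonneg _) (by positivity)
      _ ≤ (β * exp β) * ((P + β) * exp (P + β)) := by gcongr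
      _ = _ := by rw [exp_add, two_mul, exp_add]; ring
  have t2 : |sinh o - o| ≤ exp (2 * β) * exp P * (P + β) ^ 3 := by
    calc _ ≤ |o| ^ 3 * exp |o| := abs_sinh_sub_self_le o
      _ ≤ (P + β) ^ 3 * exp (P + 2 * β) := by gcongr; linarith
      _ = _ := by rw [exp_add]; ring
  calc _ ≤ |(exp (-e) - 1) * sinh o| + |sinh o - o| + |(a - b - 2 * p) / 2| := by
        refine (abs_sub _ _).trans (add_le_add_left ((abs_sub _ _).trans ?_) _)
        rw [abs_neg]
    _ ≤ _ := by rw [abs_div, abs_two]; linarith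

/-- The even part of `exp (-r)` is `1` up to errors of higher order. -/
lemma abs_even_part_exp_neg_sub_one_le {a b p P β : ℝ} (hp : |p| ≤ P) (hab : |a + b| ≤ 2 * β)
    (hba : |a - b - 2 * p| ≤ 2 * β) :
    |(exp (-a) + exp (-b)) / 2 - 1| ≤ exp (2 * β) * exp P * (β + (P + β) ^ 2) := by
  set e := (a + b) / 2 with he
  set o := (a - b) / 2 with ho
  have hae : a = e + o := by rw [he, ho]; ring
  have hbe : b = e - o := by rw [he, ho]; ring
  have heβ : |e| ≤ β := by rw [he, abs_div, abs_two]; linarith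
  have hoP : |o| ≤ P + β := by
    have : o = (a - b - 2 * p) / 2 + p := by rw [ho]; ring
    rw [this]
    refine (abs_add_le _ _).trans ?_
    rw [abs_div, abs_two]
    linarith
  have hβ0 : 0 ≤ β := (abs_nonneg _).trans heβ
  have hP0 : 0 ≤ P := (abs_nonneg _).trans hp
  have key : (exp (-a) + exp (-b)) / 2 - 1 = (exp (-e) - 1) * cosh o + (cosh o - 1) := by
    have h1 : exp (-a) = exp (-e) * exp (-o) := by rw [← exp_add, hae]; ring_nf
    have h2 : exp (-b) = exp (-e) * exp o := by rw [← exp_add, hbe]; ring_nf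
    rw [h1, h2, cosh_eq]
    ring
  rw [key]
  have t1 : |(exp (-e) - 1) * cosh o| ≤ exp (2 * β) * exp P * β := by
    rw [abs_mul, abs_of_pos (cosh_pos o)]
    calc _ ≤ (|e| * exp |e|) * exp |o| :=
          mul_le_mul (abs_exp_neg_sub_one_le e) (cosh_le_exp_abs o) (cosh_pos o).le (by positivity)
      _ ≤ (β * exp β) * exp (P + β) := by gcongr
      _ = _ := by rw [exp_add, two_mul, exp_add]; ring
  have t2 : |cosh o - 1| ≤ exp (2 * β) * exp P * (P + β) ^ 2 := by
    rw [abs_of_nonneg (by linarith [one_le_cosh o])]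
    calc _ ≤ |o| ^ 2 * exp |o| := cosh_sub_one_le o
      _ ≤ (P + β) ^ 2 * exp (P + 2 * β) := by gcongr; linarith
      _ = _ := by rw [exp_add]; ring
  calc _ ≤ |(exp (-e) - 1) * cosh o| + |cosh o - 1| := abs_add_le _ _
    _ ≤ _ := by linarith

/-- A single function of bounded integral dominating all the integrands in the error analysis. -/
lemma exists_dominating : ∃ C : ℝ, 0 < C ∧ ∀ (d : ℕ) (B : TriForm d) (σ s c : ℝ) (g : Vec d → ℝ),
    1 ≤ d → B.IsSymm → 0 ≤ σ → 13 ≤ s → 0 < c → 8 / c * log (2 * exp 1 / c) ≤ s →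
    (∀ y, |B y y y| ≤ σ / d * ‖y‖ ^ 3) →
    Measurable g → Integrable (fun y => g y ^ 2) (stdGaussian (Vec d)) →
    ∫ y, g y ^ 2 ∂stdGaussian (Vec d) = 1 →
    ∃ D M : Vec d → ℝ, Integrable D (stdGaussian (Vec d)) ∧ ∫ y, D y ∂stdGaussian (Vec d) ≤ C ∧
      (∀ y, 1 ≤ M y) ∧ (∀ y, |B y y y / 6| ≤ σ * M y) ∧ (∀ y, (‖y‖ ^ 2 / d) ^ 2 ≤ M y) ∧
      (∀ y, g y ^ 2 + M y ^ 12 ≤ D y) ∧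
      (∀ y, ‖y‖ ≤ s * √d →
        g y ^ 2 + M y ^ 12 + (exp |B y y y / 6| / exp (σ ^ 2 * s ^ 4)) ^ 4 ≤ D y) ∧
      (∀ y, g y ^ 2 + M y ^ 12 + exp (‖y‖ ^ 2 / 4 - d / 2) ≤ D y) ∧
      (∀ y, s * √d < ‖y‖ →
        exp (‖y‖ ^ 2 / 2 - c * √d * ‖y‖ / 2) ≤ exp (-(c * s * d / 8)) * D y) := by
  obtain ⟨C₁, hC₁, h12⟩ := exists_lintegral_cubic_pow_le (k := 12) (by decide)
  refine ⟨1 + 3 ^ 12 * (1 + C₁ + (Nat.factorial 24) * 4 ^ 24 * 2) + 6 + 1 + 1, by positivity, ?_⟩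
  intro d B σ s c g hd hB hσ hs hc hsc hb hgm hgi hg1
  have hd' : (1 : ℝ) ≤ d := by exact_mod_cast hd
  set γ := stdGaussian (Vec d) with hγ
  set U : Set (Vec d) := {y | ‖y‖ ≤ s * √d} with hU
  have hUm : MeasurableSet U := measurableSet_le (by fun_prop) (by fun_prop)
  have hBc : Continuous fun y : Vec d => B y y y := by fun_prop
  have hBm := hBc.measurable
  -- For `σ = 0` the middle term is `0` by the convention for division; then the cubic form vanishes
  -- on the diagonal too.
  set M : Vec d → ℝ := fun y => 1 + |B y y y / 6| / σ + (‖y‖ ^ 2 / d) ^ 2 with hM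
  set X := exp (σ ^ 2 * s ^ 4) with hX
  set θ := exp (-(c * s * d / 8)) with hθ
  have hθ0 : 0 < θ := exp_pos _
  have hX0 : 0 < X := exp_pos _
  have hMm : Measurable M := by fun_prop
  -- `D` is the sum of five pieces, each with bounded integral: `g²`; the power of `M` that Young's
  -- inequality requires; the normalized exponential of the cubic on the ball; a Gaussian weight
  -- used to absorb bounded and polynomial terms outside the ball; and the normalized tail.
  set D₁ : Vec d → ℝ := fun y => g y ^ 2
  set D₂ : Vec d → ℝ := fun y => M y ^ 12
  set D₃ : Vec d → ℝ := U.indicator fun y => (exp |B y y y / 6| / X) ^ 4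
  set D₄ : Vec d → ℝ := fun y => exp (‖y‖ ^ 2 / 4 - d / 2)
  set D₅ : Vec d → ℝ := Uᶜ.indicator fun y => exp (‖y‖ ^ 2 / 2 - c * √d * ‖y‖ / 2) / θ
  have p2 : ∀ y, 0 ≤ D₂ y := fun y => by positivity
  have p3 : ∀ y, 0 ≤ D₃ y := fun y => Set.indicator_nonneg (fun _ _ => by positivity) _
  have p4 : ∀ y, 0 ≤ D₄ y := fun y => by positivity
  have p5 : ∀ y, 0 ≤ D₅ y := fun y => Set.indicator_nonneg (fun _ _ => by positivity) _
  have m3 : Measurable D₃ := Measurable.indicator (by fun_prop) hUm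
  have m5 : Measurable D₅ := Measurable.indicator (by fun_prop) hUm.compl
  have of_lintegral : ∀ {F : Vec d → ℝ} {K : ℝ}, Measurable F → (∀ y, 0 ≤ F y) → 0 ≤ K →
      ∫⁻ y, ENNReal.ofReal (F y) ∂γ ≤ ENNReal.ofReal K → Integrable F γ ∧ ∫ y, F y ∂γ ≤ K := by
    intro F K hF h0 hK hle
    have hi : Integrable F γ := by
      rw [← lintegral_ofReal_ne_top_iff_integrable hF.aestronglyMeasurable (ae_of_all _ h0)]
      exact (hle.trans_lt ENNReal.ofReal_lt_top).ne
    refine ⟨hi, ?_⟩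
    rw [integral_eq_lintegral_of_nonneg_ae (ae_of_all _ h0) hF.aestronglyMeasurable]
    exact ENNReal.toReal_le_of_le_ofReal hK hle
  have b2 := of_lintegral (K := 3 ^ 12 * (1 + C₁ + (Nat.factorial 24) * 4 ^ 24 * 2))
    (hMm.pow_const 12) p2 (by positivity) (by
      have hpt : ∀ y, ENNReal.ofReal (M y ^ 12) ≤ ENNReal.ofReal (3 ^ 12) *
          (1 + (ENNReal.ofReal (σ⁻¹ ^ 12) * ENNReal.ofReal (B y y y ^ 12) +
            ENNReal.ofReal ((‖y‖ ^ 2 / d) ^ 24))) := by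
        intro y
        rw [← ENNReal.ofReal_mul (by positivity), ← ENNReal.ofReal_add (by positivity)
          (by positivity), ← ENNReal.ofReal_one, ← ENNReal.ofReal_add (by positivity)
          (by positivity), ← ENNReal.ofReal_mul (by positivity)]
        apply ENNReal.ofReal_le_ofReal
        have key : ∀ u v : ℝ, 0 ≤ u → 0 ≤ v →
            (1 + u + v) ^ 12 ≤ 3 ^ 12 * (1 + (u ^ 12 + v ^ 12)) := by
          intro u v hu hv
          have hle : 1 + u + v ≤ 3 * max 1 (max u v) := by
            have h1 := le_max_left 1 (max u v)
            have h2 := (le_max_left u v).trans (le_max_right 1 (max u v))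
            have h3 := (le_max_right u v).trans (le_max_right 1 (max u v))
            linarith
          calc (1 + u + v) ^ 12 ≤ (3 * max 1 (max u v)) ^ 12 := by gcongr
            _ = 3 ^ 12 * max 1 (max u v) ^ 12 := mul_pow _ _ _
            _ ≤ _ := by
              gcongr
              have h1 : 0 ≤ u ^ 12 := by positivity
              have h2 : 0 ≤ v ^ 12 := by positivity
              rcases max_cases 1 (max u v) with ⟨h, -⟩ | ⟨h, -⟩
              · rw [h]; linarith
              · rw [h]
                rcases max_cases u v with ⟨h, -⟩ | ⟨h, -⟩ <;> rw [h] <;> linarith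
        refine (key _ _ (by positivity) (by positivity)).trans ?_
        have e1 : (|B y y y / 6| / σ) ^ 12 ≤ σ⁻¹ ^ 12 * B y y y ^ 12 := by
          rw [← mul_pow, div_eq_inv_mul, mul_pow, mul_pow, Even.pow_abs (by decide), div_pow]
          gcongr
          exact div_le_self (Even.pow_nonneg (by decide) _) (by norm_num)
        have e2 : ((‖y‖ ^ 2 / d) ^ 2) ^ 12 = (‖y‖ ^ 2 / d) ^ 24 := by rw [← pow_mul]
        rw [e2]
        gcongr
      refine (lintegral_mono hpt).trans ?_
      -- An inequality rather than an equality because of `σ = 0`, where the left side is `0`.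
      have hq : σ⁻¹ ^ 12 * (C₁ * σ ^ 12) ≤ C₁ := by
        rcases hσ.eq_or_lt with h | h
        · rw [← h]; simpa using hC₁
        · rw [inv_pow]; field_simp; exact le_rfl
      rw [lintegral_const_mul' _ _ ENNReal.ofReal_ne_top, lintegral_add_left measurable_const,
        lintegral_add_left (by fun_prop), lintegral_const_mul' _ _ ENNReal.ofReal_ne_top,
        ENNReal.ofReal_mul (by positivity)]
      gcongr
      rw [add_assoc, ENNReal.ofReal_add (by positivity) (by positivity),
        ENNReal.ofReal_add (by positivity) (by positivity)]
      refine add_le_add (by simp) (add_le_add ?_ (lintegral_norm_sq_div_pow_le hd 24))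
      calc _ ≤ ENNReal.ofReal (σ⁻¹ ^ 12) * ENNReal.ofReal (C₁ * σ ^ 12) := by
            gcongr; exact h12 d B σ hd hB hσ hb
        _ ≤ _ := by
            rw [← ENNReal.ofReal_mul (by positivity)]
            exact ENNReal.ofReal_le_ofReal hq)
  have b3 := of_lintegral (K := 6) m3 p3 (by norm_num) (by
      have h := hB.setLIntegral_exp_le hd hσ hs hb
      have e : ∀ y, ENNReal.ofReal (D₃ y) = U.indicator (fun y => ENNReal.ofReal (X⁻¹ ^ 4) *
          ENNReal.ofReal (exp (4 * |B y y y / 6|))) y := by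
        intro y
        by_cases hy : y ∈ U
        · simp only [D₃, Set.indicator_of_mem hy]
          rw [← ENNReal.ofReal_mul (by positivity), div_pow, ← exp_nat_mul, inv_pow,
            div_eq_inv_mul]
          norm_num
        · simp [D₃, Set.indicator_of_notMem hy]
      simp_rw [e]
      rw [lintegral_indicator hUm, lintegral_const_mul' _ _ ENNReal.ofReal_ne_top]
      refine (mul_le_mul_right h _).trans ?_
      rw [← ENNReal.ofReal_mul (by positivity)]
      apply ENNReal.ofReal_le_ofReal
      have : exp (4 * σ ^ 2 * s ^ 4) = X ^ 4 := by rw [hX, ← exp_nat_mul]; push_cast; ring_nf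
      rw [this, inv_pow]
      field_simp
      exact le_rfl)
  have b4 := of_lintegral (F := D₄) (K := 1) (by fun_prop) p4 (by norm_num) (by
      have e : ∀ y : Vec d, ENNReal.ofReal (D₄ y) =
          ENNReal.ofReal (exp (-(d / 2))) * ENNReal.ofReal (exp (1 / 4 * ‖y‖ ^ 2)) := by
        intro y
        rw [← ENNReal.ofReal_mul (exp_pos _).le, ← exp_add]
        simp only [D₄]
        ring_nf
      simp_rw [e]
      rw [lintegral_const_mul' _ _ ENNReal.ofReal_ne_top]
      refine (mul_le_mul_right (lintegral_exp_sq_norm_le (by norm_num) le_rfl) _).trans ?_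
      rw [← ENNReal.ofReal_mul (exp_pos _).le, ← exp_add]
      ring_nf
      simp)
  have b5 := of_lintegral (K := 1) m5 p5 (by norm_num) (by
      have h := lintegral_tail_le (d := d) hc hsc
      have e : ∀ y, ENNReal.ofReal (D₅ y) = Uᶜ.indicator (fun y => ENNReal.ofReal θ⁻¹ *
          ENNReal.ofReal (exp (‖y‖ ^ 2 / 2 - c * √d * ‖y‖ / 2))) y := by
        intro y
        by_cases hy : y ∈ Uᶜ
        · simp only [D₅, Set.indicator_of_mem hy]
          rw [← ENNReal.ofReal_mul (by positivity), div_eq_inv_mul]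
        · simp only [D₅, Set.indicator_of_notMem hy, ENNReal.ofReal_zero]
      simp_rw [e]
      have hUc : Uᶜ = {y : Vec d | s * √d < ‖y‖} := by ext; simp [hU]
      rw [lintegral_indicator hUm.compl, lintegral_const_mul' _ _ ENNReal.ofReal_ne_top, hUc]
      refine (mul_le_mul_right h _).trans ?_
      rw [← ENNReal.ofReal_mul (by positivity)]
      apply ENNReal.ofReal_le_ofReal
      rw [inv_mul_cancel₀ hθ0.ne'])
  have i2 : Integrable (fun y => D₁ y + D₂ y) γ := hgi.add b2.1
  have i3 : Integrable (fun y => D₁ y + D₂ y + D₃ y) γ := i2.add b3.1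
  have i4 : Integrable (fun y => D₁ y + D₂ y + D₃ y + D₄ y) γ := i3.add b4.1
  refine ⟨fun y => D₁ y + D₂ y + D₃ y + D₄ y + D₅ y, M, i4.add b5.1, ?_, ?_, ?_, ?_, ?_, ?_, ?_, ?_⟩
  · beta_reduce
    rw [integral_add i4 b5.1, integral_add i3 b4.1, integral_add i2 b3.1, integral_add hgi b2.1]
    linarith [b2.2, b3.2, b4.2, b5.2]
  · intro y
    have h1 : 0 ≤ |B y y y / 6| / σ := by positivity
    have h2 : 0 ≤ (‖y‖ ^ 2 / d) ^ 2 := by positivity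
    simp only [hM]; linarith
  · intro y
    rcases hσ.eq_or_lt with h | h
    · have := hb y
      rw [← h] at this ⊢
      simp only [zero_div, zero_mul, abs_nonpos_iff] at this
      simp [this]
    · have h2 : 0 ≤ (‖y‖ ^ 2 / d) ^ 2 := by positivity
      calc |B y y y / 6| = σ * (|B y y y / 6| / σ) := by field_simp
        _ ≤ σ * M y := by gcongr; simp only [hM]; linarith
  · intro y
    have h1 : 0 ≤ |B y y y / 6| / σ := by positivity
    simp only [hM]; linarith
  · intro y
    have := p3 y; have := p4 y; have := p5 y
    change D₁ y + D₂ y ≤ _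
    linarith
  · intro y hy
    have e3 : D₃ y = (exp |B y y y / 6| / X) ^ 4 := Set.indicator_of_mem (s := U) hy _
    have := p4 y; have := p5 y
    change D₁ y + D₂ y + _ ≤ _
    linarith
  · intro y
    have := p3 y; have := p5 y
    change D₁ y + D₂ y + D₄ y ≤ _
    linarith
  · intro y hy
    have hy' : y ∈ Uᶜ := by simpa [hU] using hy
    have e5 : D₅ y = exp (‖y‖ ^ 2 / 2 - c * √d * ‖y‖ / 2) / θ := Set.indicator_of_mem hy' _
    have h1 : 0 ≤ D₁ y := by positivity
    have h2 := p2 y; have h3 := p3 y; have h4 := p4 y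
    calc _ = θ * D₅ y := by rw [e5]; field_simp
      _ ≤ _ := by gcongr; linarith

end SkewLaplace

/-! ### Pointwise domination of the odd and even parts of the density. -/

namespace SkewLaplace

open ProbabilityTheory Real
open scoped ENNReal RealInnerProductSpace

/-- A density `ρ` with respect to the standard Gaussian measure, which on the ball of radius `s√d`
is `exp (-r)` with `r` close to a cubic form, and which has light tails outside of that ball. -/
structure LocalExpansion {d : ℕ} (B : TriForm d) (σ η δ s c : ℝ) (ρ r : Vec d → ℝ) : Prop where
  one_le_dim : 1 ≤ d
  symm : B.IsSymm
  σ_nonneg : 0 ≤ σ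
  η_nonneg : 0 ≤ η
  δ_nonneg : 0 ≤ δ
  le_radius : 13 ≤ s
  c_pos : 0 < c
  c_le_one : c ≤ 1
  log_le_radius : 8 / c * log (2 * exp 1 / c) ≤ s
  cubic_le : ∀ y, |B y y y| ≤ σ / d * ‖y‖ ^ 3
  measurable : Measurable ρ
  nonneg : ∀ y, 0 ≤ ρ y
  eq_exp : ∀ y, ‖y‖ ≤ s * √d → ρ y = exp (-r y)
  even_le : ∀ y, ‖y‖ ≤ s * √d → |r y + r (-y)| ≤ η / 12 * (‖y‖ ^ 2 / d) ^ 2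
  odd_le : ∀ y, ‖y‖ ≤ s * √d → |r y - r (-y) - B y y y / 3| ≤ η / 12 * (‖y‖ ^ 2 / d) ^ 2
  odd_le' : ∀ y, ‖y‖ ≤ s * √d → |r y - r (-y) - B y y y / 3| ≤ δ * (‖y‖ ^ 5 / d ^ 3)
  tail_le : ∀ y, s * √d < ‖y‖ → ρ y ≤ exp (‖y‖ ^ 2 / 2 - c * √d * ‖y‖)

/-- The pointwise properties of the pair of functions provided by `exists_dominating`. -/
structure Dominates {d : ℕ} (B : TriForm d) (σ s c : ℝ) (g D M : Vec d → ℝ) : Prop where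
  one_le : ∀ y, 1 ≤ M y
  cubic_le : ∀ y, |B y y y / 6| ≤ σ * M y
  norm_le : ∀ y, (‖y‖ ^ 2 / d) ^ 2 ≤ M y
  global_le : ∀ y, g y ^ 2 + M y ^ 12 ≤ D y
  local_le : ∀ y, ‖y‖ ≤ s * √d →
    g y ^ 2 + M y ^ 12 + (exp |B y y y / 6| / exp (σ ^ 2 * s ^ 4)) ^ 4 ≤ D y
  gauss_le : ∀ y, g y ^ 2 + M y ^ 12 + exp (‖y‖ ^ 2 / 4 - d / 2) ≤ D y
  tail_le : ∀ y, s * √d < ‖y‖ →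
    exp (‖y‖ ^ 2 / 2 - c * √d * ‖y‖ / 2) ≤ exp (-(c * s * d / 8)) * D y

lemma mul_mul_le_sq_add_pow_four (x y z : ℝ) : x * y * z ≤ x ^ 2 / 2 + y ^ 4 / 4 + z ^ 4 / 4 := by
  nlinarith [sq_nonneg (x - y * z), sq_nonneg (y ^ 2 - z ^ 2)]

/-- Young's inequality with exponents `2, 4, 4`. It explains the shape of the dominating function:
`g` squared, `M³` to the fourth power, the exponential factor to the fourth power. -/
lemma abs_mul_pow_mul_le {x m z T : ℝ} {k : ℕ} (hk : k ≤ 3) (hm : 1 ≤ m) (hz : 0 ≤ z)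
    (h : x ^ 2 + m ^ 12 + z ^ 4 ≤ T) : |x| * m ^ k * z ≤ T := by
  calc |x| * m ^ k * z ≤ |x| * m ^ 3 * z := by gcongr
    _ ≤ |x| ^ 2 / 2 + (m ^ 3) ^ 4 / 4 + z ^ 4 / 4 := mul_mul_le_sq_add_pow_four _ _ _
    _ ≤ T := by
      rw [sq_abs, ← pow_mul]
      have h1 : 0 ≤ x ^ 2 := sq_nonneg x
      have h2 : 0 ≤ m ^ 12 := by positivity
      have h3 : 0 ≤ z ^ 4 := by positivity
      norm_num
      linarith

lemma pow_mul_le {x m z T : ℝ} {k : ℕ} (hk : k ≤ 3) (hm : 1 ≤ m) (hz : 0 ≤ z)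
    (h : x ^ 2 + m ^ 12 + z ^ 4 ≤ T) : m ^ k * z ≤ T := by
  have h4 := mul_mul_le_sq_add_pow_four 1 (m ^ 3) z
  rw [one_mul, ← pow_mul] at h4
  have h1 : 0 ≤ x ^ 2 := sq_nonneg x
  have h2 : 1 ≤ m ^ 12 := one_le_pow₀ hm
  have h3 : 0 ≤ z ^ 4 := by positivity
  calc m ^ k * z ≤ m ^ 3 * z := by gcongr
    _ ≤ T := by norm_num at h4; linarith

section Pointwise

variable {d : ℕ} {B : TriForm d} {σ η δ s c a K : ℝ} {ρ r g D M : Vec d → ℝ}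

lemma LocalExpansion.dim_pos (h : LocalExpansion B σ η δ s c ρ r) : (0 : ℝ) < d := by
  exact_mod_cast h.one_le_dim

lemma LocalExpansion.norm_sq_div_le (h : LocalExpansion B σ η δ s c ρ r) {y : Vec d}
    (hy : ‖y‖ ≤ s * √d) : (‖y‖ ^ 2 / d) ^ 2 ≤ s ^ 4 := by
  have hd := h.dim_pos
  have h1 : ‖y‖ ^ 2 ≤ (s * √d) ^ 2 := by gcongr
  rw [mul_pow, sq_sqrt hd.le] at h1
  have h2 : ‖y‖ ^ 2 / d ≤ s ^ 2 := by rwa [div_le_iff₀ hd]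
  calc (‖y‖ ^ 2 / d) ^ 2 ≤ (s ^ 2) ^ 2 := by gcongr
    _ = s ^ 4 := by ring

/-- On the ball, the exponential factors are controlled by the dominating function. -/
lemma LocalExpansion.exp_mul_exp_le (h : LocalExpansion B σ η δ s c ρ r) {y : Vec d}
    (hy : ‖y‖ ≤ s * √d) :
    exp (2 * (η / 24 * (‖y‖ ^ 2 / d) ^ 2)) * exp |B y y y / 6| ≤
      exp ((σ ^ 2 + η) * s ^ 4) * (exp |B y y y / 6| / exp (σ ^ 2 * s ^ 4)) := by
  have h1 := h.norm_sq_div_le hy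
  have h2 := h.η_nonneg
  have h0 : 0 ≤ (‖y‖ ^ 2 / d) ^ 2 := by positivity
  rw [add_mul, exp_add]
  have e : exp (σ ^ 2 * s ^ 4) * exp (η * s ^ 4) * (exp |B y y y / 6| / exp (σ ^ 2 * s ^ 4)) =
      exp (η * s ^ 4) * exp |B y y y / 6| := by
    field_simp
  rw [e]
  refine mul_le_mul_of_nonneg_right (exp_le_exp.2 ?_) (exp_pos _).le
  calc 2 * (η / 24 * (‖y‖ ^ 2 / d) ^ 2) ≤ 2 * (η / 24 * s ^ 4) := by gcongr
    _ ≤ _ := by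
      have : 0 ≤ η * s ^ 4 := by have := h.le_radius; positivity
      linarith

/-- The bound on `η` lowers `η²` to a multiple of `η`, so that a single factor `σ² + η` collects all
second-order terms. -/
lemma add_sq_le {σ η K : ℝ} (hη : 0 ≤ η) (hK : η ≤ K ^ 2) :
    η + (σ + η) ^ 2 ≤ (3 + 2 * K ^ 2) * (σ ^ 2 + η) := by
  nlinarith [sq_nonneg (σ - η), mul_le_mul_of_nonneg_left hK hη, sq_nonneg (σ * K), sq_nonneg σ]

lemma LocalExpansion.two_mul_beta (h : LocalExpansion B σ η δ s c ρ r) {y : Vec d}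
    (hy : ‖y‖ ≤ s * √d) :
    |r y + r (-y)| ≤ 2 * (η / 24 * (‖y‖ ^ 2 / d) ^ 2) ∧
    |r y - r (-y) - 2 * (B y y y / 6)| ≤ 2 * (η / 24 * (‖y‖ ^ 2 / d) ^ 2) := by
  have h1 := h.even_le y hy
  have h2 := h.odd_le y hy
  rw [show r y - r (-y) - 2 * (B y y y / 6) = r y - r (-y) - B y y y / 3 by ring]
  constructor <;> linarith

lemma LocalExpansion.beta_le (h : LocalExpansion B σ η δ s c ρ r)
    (hD : Dominates B σ s c g D M) (y : Vec d) : η / 24 * (‖y‖ ^ 2 / d) ^ 2 ≤ η * M y := by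
  have h1 := hD.norm_le y
  have h2 := h.η_nonneg
  have h3 : 0 ≤ M y := zero_le_one.trans (hD.one_le y)
  calc η / 24 * (‖y‖ ^ 2 / d) ^ 2 ≤ η / 24 * M y := by gcongr
    _ ≤ η * M y := by gcongr; linarith

/-- With `w = ‖y‖²/d`, `‖y‖⁵/d³ = d^{-1/2} w^{5/2}`; this is where the factor `d^{-1/2}` of the
fifth-order term arises. -/
lemma Dominates.fifth_power_le (hd : 1 ≤ d) (hD : Dominates B σ s c g D M) (y : Vec d) :
    |g y| * (‖y‖ ^ 5 / d ^ 3) ≤ (d : ℝ) ^ (-(1 / 2) : ℝ) * D y := by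
  have hd' : (0 : ℝ) < d := by exact_mod_cast hd
  set w := ‖y‖ ^ 2 / d with hw
  have hw0 : 0 ≤ w := by positivity
  have e1 : ‖y‖ ^ 5 / d ^ 3 = (d : ℝ) ^ (-(1 / 2) : ℝ) * (w ^ 2 * √w) := by
    rw [rpow_neg hd'.le, ← sqrt_eq_rpow, hw, sqrt_div (by positivity), sqrt_sq (norm_nonneg y)]
    have : √(d : ℝ) * √d = d := mul_self_sqrt hd'.le
    field_simp
    rw [sq_sqrt hd'.le]
  rw [e1, mul_left_comm]
  gcongr
  have h1 := hD.one_le y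
  have h2 : w ^ 2 ≤ M y := hD.norm_le y
  have h3 := hD.global_le y
  have h4 : w ≤ M y := by nlinarith [sq_nonneg (w - 1)]
  have h5 : (w ^ 2 * √w) ^ 2 ≤ M y ^ 12 := by
    rw [mul_pow, sq_sqrt hw0]
    calc (w ^ 2) ^ 2 * w ≤ M y ^ 2 * M y := by gcongr
      _ = M y ^ 3 := by ring
      _ ≤ M y ^ 12 := pow_le_pow_right₀ h1 (by norm_num)
  have h6 : |g y| * (w ^ 2 * √w) ≤ (|g y| ^ 2 + (w ^ 2 * √w) ^ 2) / 2 := by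
    nlinarith [sq_nonneg (|g y| - w ^ 2 * √w)]
  rw [sq_abs] at h6
  have h7 : 0 ≤ g y ^ 2 := sq_nonneg _
  have h8 : 0 ≤ M y ^ 12 := by positivity
  linarith

lemma LocalExpansion.abs_mul_odd_le_of_mem (h : LocalExpansion B σ η δ s c ρ r)
    (hD : Dominates B σ s c g D M) (hK : η ≤ K ^ 2) {y : Vec d} (hy : ‖y‖ ≤ s * √d) :
    |g y| * |(ρ y - ρ (-y)) / 2 + B y y y / 6| ≤
      (exp ((σ ^ 2 + η) * s ^ 4) * ((3 + 2 * K ^ 2) * (σ ^ 2 + η) * (σ + η)) +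
        δ * (d : ℝ) ^ (-(1 / 2) : ℝ)) * D y := by
  have hη := h.η_nonneg
  have hσ := h.σ_nonneg
  have hM := hD.one_le y
  have hy' : ‖-y‖ ≤ s * √d := by rwa [norm_neg]
  obtain ⟨h1, h2⟩ := h.two_mul_beta hy
  have h3 := abs_odd_part_exp_neg_add_le le_rfl h1 h2
  rw [h.eq_exp y hy, h.eq_exp (-y) hy']
  set β := η / 24 * (‖y‖ ^ 2 / d) ^ 2 with hβ
  set P := |B y y y / 6| with hP
  set F := exp P / exp (σ ^ 2 * s ^ 4) with hF
  have hβ0 : 0 ≤ β := by positivity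
  have hP0 : 0 ≤ P := abs_nonneg _
  have hPβ : P + β ≤ (σ + η) * M y := by
    have := hD.cubic_le y
    have := h.beta_le hD y
    linarith
  have hpoly : β * (P + β) + (P + β) ^ 3 ≤
      (3 + 2 * K ^ 2) * (σ ^ 2 + η) * (σ + η) * M y ^ 3 := by
    calc β * (P + β) + (P + β) ^ 3
        ≤ (η * M y) * ((σ + η) * M y) + ((σ + η) * M y) ^ 3 := by
          have := h.beta_le hD y
          gcongr
      -- A spare factor `M y ≥ 1` brings both terms to the common power `M³`.
      _ ≤ (η * M y) * ((σ + η) * M y) * M y + ((σ + η) * M y) ^ 3 :=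
          add_le_add_left (le_mul_of_one_le_right (by positivity) hM) _
      _ = (η + (σ + η) ^ 2) * ((σ + η) * M y ^ 3) := by ring
      _ ≤ (3 + 2 * K ^ 2) * (σ ^ 2 + η) * ((σ + η) * M y ^ 3) := by
          have := add_sq_le (σ := σ) hη hK
          gcongr
      _ = _ := by ring
  have hmain : |g y| * (exp (2 * β) * exp P * (β * (P + β) + (P + β) ^ 3)) ≤
      exp ((σ ^ 2 + η) * s ^ 4) * ((3 + 2 * K ^ 2) * (σ ^ 2 + η) * (σ + η)) * D y := by
    calc _ ≤ |g y| * ((exp ((σ ^ 2 + η) * s ^ 4) * F) *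
          ((3 + 2 * K ^ 2) * (σ ^ 2 + η) * (σ + η) * M y ^ 3)) := by
          exact mul_le_mul_of_nonneg_left
            (mul_le_mul (h.exp_mul_exp_le hy) hpoly (by positivity) (by positivity)) (abs_nonneg _)
      _ = exp ((σ ^ 2 + η) * s ^ 4) * ((3 + 2 * K ^ 2) * (σ ^ 2 + η) * (σ + η)) *
          (|g y| * M y ^ 3 * F) := by ring
      _ ≤ _ := by
          gcongr
          exact abs_mul_pow_mul_le le_rfl hM (by positivity) (hD.local_le y hy)
  have hrem : |g y| * (|r y - r (-y) - 2 * (B y y y / 6)| / 2) ≤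
      δ * (d : ℝ) ^ (-(1 / 2) : ℝ) * D y := by
    have h5 := h.odd_le' y hy
    rw [show r y - r (-y) - 2 * (B y y y / 6) = r y - r (-y) - B y y y / 3 by ring]
    have h6 := hD.fifth_power_le h.one_le_dim y
    have hδ := h.δ_nonneg
    have hnn : 0 ≤ ‖y‖ ^ 5 / (d : ℝ) ^ 3 := by positivity
    calc |g y| * (|r y - r (-y) - B y y y / 3| / 2) ≤ |g y| * (δ * (‖y‖ ^ 5 / d ^ 3)) := by
          gcongr
          linarith [mul_nonneg hδ hnn]
      _ = δ * (|g y| * (‖y‖ ^ 5 / d ^ 3)) := by ring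
      _ ≤ δ * ((d : ℝ) ^ (-(1 / 2) : ℝ) * D y) := by gcongr
      _ = _ := by ring
  calc _ ≤ |g y| * (exp (2 * β) * exp P * (β * (P + β) + (P + β) ^ 3) +
        |r y - r (-y) - 2 * (B y y y / 6)| / 2) := by gcongr
    _ ≤ _ := by rw [mul_add, add_mul]; exact add_le_add hmain hrem

lemma LocalExpansion.abs_even_sub_one_le_of_mem (h : LocalExpansion B σ η δ s c ρ r)
    (hD : Dominates B σ s c g D M) (hK : η ≤ K ^ 2) {y : Vec d} (hy : ‖y‖ ≤ s * √d) :
    |(ρ y + ρ (-y)) / 2 - 1| ≤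
      exp ((σ ^ 2 + η) * s ^ 4) * ((3 + 2 * K ^ 2) * (σ ^ 2 + η)) * D y := by
  have hη := h.η_nonneg
  have hσ := h.σ_nonneg
  have hM := hD.one_le y
  have hy' : ‖-y‖ ≤ s * √d := by rwa [norm_neg]
  obtain ⟨h1, h2⟩ := h.two_mul_beta hy
  have h3 := abs_even_part_exp_neg_sub_one_le le_rfl h1 h2
  rw [h.eq_exp y hy, h.eq_exp (-y) hy']
  refine h3.trans ?_
  set β := η / 24 * (‖y‖ ^ 2 / d) ^ 2 with hβ
  set P := |B y y y / 6| with hP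
  set F := exp P / exp (σ ^ 2 * s ^ 4) with hF
  have hβ0 : 0 ≤ β := by positivity
  have hP0 : 0 ≤ P := abs_nonneg _
  have hPβ : P + β ≤ (σ + η) * M y := by
    have := hD.cubic_le y
    have := h.beta_le hD y
    linarith
  have hpoly : β + (P + β) ^ 2 ≤ (3 + 2 * K ^ 2) * (σ ^ 2 + η) * M y ^ 2 := by
    calc β + (P + β) ^ 2 ≤ η * M y + ((σ + η) * M y) ^ 2 := by
          have := h.beta_le hD y
          gcongr
      _ ≤ η * M y * M y + ((σ + η) * M y) ^ 2 :=
          add_le_add_left (le_mul_of_one_le_right (by positivity) hM) _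
      _ = (η + (σ + η) ^ 2) * M y ^ 2 := by ring
      _ ≤ _ := by
          have := add_sq_le (σ := σ) hη hK
          gcongr
  calc _ ≤ (exp ((σ ^ 2 + η) * s ^ 4) * F) * ((3 + 2 * K ^ 2) * (σ ^ 2 + η) * M y ^ 2) := by
        exact mul_le_mul (h.exp_mul_exp_le hy) hpoly (by positivity) (by positivity)
    _ = exp ((σ ^ 2 + η) * s ^ 4) * ((3 + 2 * K ^ 2) * (σ ^ 2 + η)) * (M y ^ 2 * F) := by ring
    _ ≤ _ := by
        gcongr
        exact pow_mul_le (by norm_num) hM (by positivity) (hD.local_le y hy)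

lemma LocalExpansion.density_le_of_mem (h : LocalExpansion B σ η δ s c ρ r) {y : Vec d}
    (hy : ‖y‖ ≤ s * √d) :
    ρ y ≤ exp ((σ ^ 2 + η) * s ^ 4) * (exp |B y y y / 6| / exp (σ ^ 2 * s ^ 4)) := by
  refine le_trans ?_ (h.exp_mul_exp_le hy)
  rw [h.eq_exp y hy, ← exp_add, exp_le_exp]
  obtain ⟨h1, h2⟩ := h.two_mul_beta hy
  rw [abs_le] at h1 h2
  have := neg_le_abs (B y y y / 6)
  linarith [h1.1, h2.1]

/-- Outside the ball, `‖y‖²/16 ≥ s²d/16` exceeds `d/8 + csd/8`. Terms without decay of their own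
thus acquire the tail factor at the price of a Gaussian weight, whose fourth power is still
dominated. -/
lemma LocalExpansion.one_le_exp_mul (h : LocalExpansion B σ η δ s c ρ r) {y : Vec d}
    (hy : s * √d < ‖y‖) : 1 ≤ exp (-(c * s * d / 8)) * exp (‖y‖ ^ 2 / 16 - d / 8) := by
  have hd := h.dim_pos
  have hs := h.le_radius
  have hc := h.c_le_one
  rw [← exp_add, one_le_exp_iff]
  have h1 : (s * √d) ^ 2 ≤ ‖y‖ ^ 2 := by gcongr
  rw [mul_pow, sq_sqrt hd.le] at h1
  have h2 : c * s ≤ s := by nlinarith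
  have h3 : 0 ≤ (s ^ 2 - 2 - 2 * (c * s)) * d := mul_nonneg (by nlinarith) hd.le
  linarith

lemma exp_sixteenth_pow (d : ℕ) (y : Vec d) :
    exp (‖y‖ ^ 2 / 16 - d / 8) ^ 4 = exp (‖y‖ ^ 2 / 4 - d / 2) := by
  rw [← exp_nat_mul]; push_cast; ring_nf

lemma LocalExpansion.abs_mul_cubic_le_of_notMem (h : LocalExpansion B σ η δ s c ρ r)
    (hD : Dominates B σ s c g D M) {y : Vec d} (hy : s * √d < ‖y‖) :
    |g y| * |B y y y / 6| ≤ σ * exp (-(c * s * d / 8)) * D y := by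
  have hσ := h.σ_nonneg
  have hM := hD.one_le y
  have h0 := hD.gauss_le y
  rw [← exp_sixteenth_pow] at h0
  calc |g y| * |B y y y / 6| ≤ |g y| * (σ * M y) * 1 := by
        rw [mul_one]; gcongr; exact hD.cubic_le y
    _ ≤ |g y| * (σ * M y) * (exp (-(c * s * d / 8)) * exp (‖y‖ ^ 2 / 16 - d / 8)) := by
        gcongr; exact h.one_le_exp_mul hy
    _ = σ * exp (-(c * s * d / 8)) * (|g y| * M y ^ 1 * exp (‖y‖ ^ 2 / 16 - d / 8)) := by ring
    _ ≤ _ := by gcongr; exact abs_mul_pow_mul_le (by norm_num) hM (by positivity) h0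

lemma LocalExpansion.one_le_of_notMem (h : LocalExpansion B σ η δ s c ρ r)
    (hD : Dominates B σ s c g D M) {y : Vec d} (hy : s * √d < ‖y‖) :
    1 ≤ exp (-(c * s * d / 8)) * D y := by
  have h0 := hD.gauss_le y
  rw [← exp_sixteenth_pow] at h0
  calc 1 ≤ exp (-(c * s * d / 8)) * exp (‖y‖ ^ 2 / 16 - d / 8) := h.one_le_exp_mul hy
    _ = exp (-(c * s * d / 8)) * (M y ^ 0 * exp (‖y‖ ^ 2 / 16 - d / 8)) := by ring
    _ ≤ _ := by gcongr; exact pow_mul_le (by norm_num) (hD.one_le y) (by positivity) h0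

lemma LocalExpansion.density_le_of_notMem (h : LocalExpansion B σ η δ s c ρ r)
    (hD : Dominates B σ s c g D M) {y : Vec d} (hy : s * √d < ‖y‖) :
    ρ y ≤ exp (-(c * s * d / 8)) * D y := by
  refine (h.tail_le y hy).trans (le_trans (exp_le_exp.2 ?_) (hD.tail_le y hy))
  have : 0 ≤ c * √d * ‖y‖ := by have := h.c_pos; positivity
  linarith

/-- The growth of `g` consumes half of the decay `exp (-c√d‖y‖)`; the other half gives the tail
integral. -/
lemma LocalExpansion.abs_mul_density_le_of_notMem (h : LocalExpansion B σ η δ s c ρ r)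
    (hD : Dominates B σ s c g D M) (ha : 0 ≤ a) {y : Vec d}
    (hg : |g y| ≤ a * exp (c * √d * ‖y‖ / 2)) (hy : s * √d < ‖y‖) :
    |g y| * ρ y ≤ a * exp (-(c * s * d / 8)) * D y := by
  have h1 := h.nonneg y
  calc |g y| * ρ y ≤ (a * exp (c * √d * ‖y‖ / 2)) * exp (‖y‖ ^ 2 / 2 - c * √d * ‖y‖) := by
        gcongr; exact h.tail_le y hy
    _ = a * exp (‖y‖ ^ 2 / 2 - c * √d * ‖y‖ / 2) := by rw [mul_assoc, ← exp_add]; ring_nf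
    _ ≤ a * (exp (-(c * s * d / 8)) * D y) := by gcongr; exact hD.tail_le y hy
    _ = _ := by ring

lemma Dominates.nonneg (hD : Dominates B σ s c g D M) (y : Vec d) : 0 ≤ D y := by
  have := hD.global_le y
  have h1 := hD.one_le y
  have h2 : 0 ≤ M y ^ 12 := by positivity
  linarith [sq_nonneg (g y)]

lemma LocalExpansion.abs_mul_odd_le (h : LocalExpansion B σ η δ s c ρ r)
    (hD : Dominates B σ s c g D M) (hK : η ≤ K ^ 2) (ha : 0 ≤ a)
    (hg : ∀ y, |g y| ≤ a * exp (c * √d * ‖y‖ / 2)) (y : Vec d) :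
    |g y| * |(ρ y - ρ (-y)) / 2 + B y y y / 6| ≤
      (exp ((σ ^ 2 + η) * s ^ 4) * ((3 + 2 * K ^ 2) * (σ ^ 2 + η) * (σ + η)) +
        δ * (d : ℝ) ^ (-(1 / 2) : ℝ) + (a + σ) * exp (-(c * s * d / 8))) * D y := by
  have hσ := h.σ_nonneg
  have hη := h.η_nonneg
  have hδ := h.δ_nonneg
  have hDn := hD.nonneg y
  rcases le_or_gt ‖y‖ (s * √d) with hy | hy
  · have : 0 ≤ (a + σ) * exp (-(c * s * d / 8)) := by positivity
    exact (h.abs_mul_odd_le_of_mem hD hK hy).trans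
      (mul_le_mul_of_nonneg_right (by linarith) hDn)
  · have h1 := h.abs_mul_density_le_of_notMem hD ha (hg y) hy
    have h2 : |g y| * ρ (-y) ≤ a * exp (-(c * s * d / 8)) * D y := by
      have hy' : s * √d < ‖-y‖ := by rwa [norm_neg]
      calc |g y| * ρ (-y) ≤ (a * exp (c * √d * ‖y‖ / 2)) *
            exp (‖-y‖ ^ 2 / 2 - c * √d * ‖-y‖) :=
            mul_le_mul (hg y) (h.tail_le (-y) hy') (h.nonneg _) (by positivity)
        _ = a * exp (‖y‖ ^ 2 / 2 - c * √d * ‖y‖ / 2) := by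
            rw [norm_neg, mul_assoc, ← exp_add]; ring_nf
        _ ≤ a * (exp (-(c * s * d / 8)) * D y) := by gcongr; exact hD.tail_le y hy
        _ = _ := by ring
    have h3 := h.abs_mul_cubic_le_of_notMem hD hy
    have h4 : |(ρ y - ρ (-y)) / 2 + B y y y / 6| ≤ (ρ y + ρ (-y)) / 2 + |B y y y / 6| := by
      refine (abs_add_le _ _).trans (add_le_add_left ?_ _)
      have h5 := h.nonneg y
      have h6 := h.nonneg (-y)
      rw [abs_le]
      constructor <;> linarith
    have h7 : 0 ≤ exp ((σ ^ 2 + η) * s ^ 4) * ((3 + 2 * K ^ 2) * (σ ^ 2 + η) * (σ + η)) +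
        δ * (d : ℝ) ^ (-(1 / 2) : ℝ) := by positivity
    calc _ ≤ |g y| * ((ρ y + ρ (-y)) / 2 + |B y y y / 6|) := by gcongr
      _ = (|g y| * ρ y + |g y| * ρ (-y)) / 2 + |g y| * |B y y y / 6| := by ring
      _ ≤ (a + σ) * exp (-(c * s * d / 8)) * D y := by linarith
      _ ≤ _ := by gcongr; linarith

lemma LocalExpansion.density_neg_le_of_notMem (h : LocalExpansion B σ η δ s c ρ r)
    (hD : Dominates B σ s c g D M) {y : Vec d} (hy : s * √d < ‖y‖) :
    ρ (-y) ≤ exp (-(c * s * d / 8)) * D y := by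
  have hy' : s * √d < ‖-y‖ := by rwa [norm_neg]
  refine (h.tail_le (-y) hy').trans (le_trans (exp_le_exp.2 ?_) (hD.tail_le y hy))
  have : 0 ≤ c * √d * ‖y‖ := by have := h.c_pos; positivity
  rw [norm_neg]
  linarith

lemma LocalExpansion.abs_even_sub_one_le (h : LocalExpansion B σ η δ s c ρ r)
    (hD : Dominates B σ s c g D M) (hK : η ≤ K ^ 2) (y : Vec d) :
    |(ρ y + ρ (-y)) / 2 - 1| ≤
      (exp ((σ ^ 2 + η) * s ^ 4) * ((3 + 2 * K ^ 2) * (σ ^ 2 + η)) +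
        2 * exp (-(c * s * d / 8))) * D y := by
  have hσ := h.σ_nonneg
  have hη := h.η_nonneg
  have hDn := hD.nonneg y
  rcases le_or_gt ‖y‖ (s * √d) with hy | hy
  · have : 0 ≤ 2 * exp (-(c * s * d / 8)) := by positivity
    exact (h.abs_even_sub_one_le_of_mem hD hK hy).trans
      (mul_le_mul_of_nonneg_right (by linarith) hDn)
  · have h1 := h.density_le_of_notMem hD hy
    have h2 := h.density_neg_le_of_notMem hD hy
    have h3 := h.one_le_of_notMem hD hy
    have h5 := h.nonneg y
    have h6 := h.nonneg (-y)
    have h7 : 0 ≤ exp ((σ ^ 2 + η) * s ^ 4) * ((3 + 2 * K ^ 2) * (σ ^ 2 + η)) * D y := by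
      positivity
    rw [add_mul, abs_le]
    constructor <;> linarith

lemma LocalExpansion.abs_mul_density_le (h : LocalExpansion B σ η δ s c ρ r)
    (hD : Dominates B σ s c g D M) (ha : 0 ≤ a)
    (hg : ∀ y, |g y| ≤ a * exp (c * √d * ‖y‖ / 2)) (y : Vec d) :
    |g y| * ρ y ≤ (exp ((σ ^ 2 + η) * s ^ 4) + a * exp (-(c * s * d / 8))) * D y := by
  have hDn := hD.nonneg y
  rcases le_or_gt ‖y‖ (s * √d) with hy | hy
  · calc |g y| * ρ y ≤ |g y| * (exp ((σ ^ 2 + η) * s ^ 4) *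
          (exp |B y y y / 6| / exp (σ ^ 2 * s ^ 4))) := by gcongr; exact h.density_le_of_mem hy
      _ = exp ((σ ^ 2 + η) * s ^ 4) * (|g y| * M y ^ 0 *
          (exp |B y y y / 6| / exp (σ ^ 2 * s ^ 4))) := by ring
      _ ≤ exp ((σ ^ 2 + η) * s ^ 4) * D y := by
          gcongr
          exact abs_mul_pow_mul_le (by norm_num) (hD.one_le y) (by positivity) (hD.local_le y hy)
      _ ≤ _ := by
          gcongr
          have : 0 ≤ a * exp (-(c * s * d / 8)) := by positivity
          linarith
  · refine (h.abs_mul_density_le_of_notMem hD ha (hg y) hy).trans ?_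
    gcongr
    have : 0 ≤ exp ((σ ^ 2 + η) * s ^ 4) := by positivity
    linarith

lemma LocalExpansion.density_le (h : LocalExpansion B σ η δ s c ρ r)
    (hD : Dominates B σ s c g D M) (y : Vec d) :
    ρ y ≤ (exp ((σ ^ 2 + η) * s ^ 4) + exp (-(c * s * d / 8))) * D y := by
  have hDn := hD.nonneg y
  rcases le_or_gt ‖y‖ (s * √d) with hy | hy
  · calc ρ y ≤ exp ((σ ^ 2 + η) * s ^ 4) *
          (exp |B y y y / 6| / exp (σ ^ 2 * s ^ 4)) := h.density_le_of_mem hy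
      _ = exp ((σ ^ 2 + η) * s ^ 4) * (M y ^ 0 *
          (exp |B y y y / 6| / exp (σ ^ 2 * s ^ 4))) := by ring
      _ ≤ exp ((σ ^ 2 + η) * s ^ 4) * D y := by
          gcongr
          exact pow_mul_le (by norm_num) (hD.one_le y) (by positivity) (hD.local_le y hy)
      _ ≤ _ := by
          gcongr
          have : 0 ≤ exp (-(c * s * d / 8)) := by positivity
          linarith
  · refine (h.density_le_of_notMem hD hy).trans ?_
    gcongr
    have : 0 ≤ exp ((σ ^ 2 + η) * s ^ 4) := by positivity
    linarith

lemma Dominates.abs_mul_cubic_le (hσ : 0 ≤ σ) (hD : Dominates B σ s c g D M) (y : Vec d) :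
    |g y * (B y y y / 6)| ≤ σ * D y := by
  rw [abs_mul]
  calc |g y| * |B y y y / 6| ≤ |g y| * (σ * M y) := by gcongr; exact hD.cubic_le y
    _ = σ * (|g y| * M y) := by ring
    _ ≤ σ * D y := by
      gcongr
      have h1 := hD.one_le y
      have h2 := hD.global_le y
      have h3 : M y ^ 2 ≤ M y ^ 12 := pow_le_pow_right₀ h1 (by norm_num)
      have h4 : 0 ≤ M y ^ 12 := by positivity
      nlinarith [sq_nonneg (|g y| - M y), sq_abs (g y), sq_nonneg (g y)]

/-- By convexity of `exp`, the mean of `ρ(y)` and `ρ(-y)` is at least `exp (-(r(y) + r(-y))/2)`,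
where the cubic term has cancelled. No bound on `σ` enters. -/
lemma LocalExpansion.exp_neg_le_even (h : LocalExpansion B σ η δ s c ρ r) {y : Vec d}
    (hy : ‖y‖ ≤ 2 * √d) : exp (-η) ≤ (ρ y + ρ (-y)) / 2 := by
  have hd := h.dim_pos
  have hs := h.le_radius
  have hη := h.η_nonneg
  have hy1 : ‖y‖ ≤ s * √d := hy.trans (by gcongr; linarith)
  have hy' : ‖-y‖ ≤ s * √d := by rwa [norm_neg]
  rw [h.eq_exp y hy1, h.eq_exp (-y) hy']
  have h1 := h.even_le y hy1
  have h2 : (‖y‖ ^ 2 / d) ^ 2 ≤ 16 := by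
    have h3 : ‖y‖ ^ 2 ≤ (2 * √d) ^ 2 := by gcongr
    rw [mul_pow, sq_sqrt hd.le] at h3
    have h4 : ‖y‖ ^ 2 / d ≤ 4 := by rw [div_le_iff₀ hd]; linarith
    calc (‖y‖ ^ 2 / d) ^ 2 ≤ 4 ^ 2 := by gcongr
      _ = 16 := by norm_num
  have h3 : r y + r (-y) ≤ 2 * η := by
    have := (abs_le.1 h1).2
    nlinarith
  have h4 : exp (-η) ≤ exp (-((r y + r (-y)) / 2)) := exp_le_exp.2 (by linarith)
  refine h4.trans ?_
  have e1 : exp (-r y) = exp (-r y / 2) ^ 2 := by rw [← exp_nat_mul]; push_cast; ring_nf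
  have e2 : exp (-r (-y)) = exp (-r (-y) / 2) ^ 2 := by rw [← exp_nat_mul]; push_cast; ring_nf
  have e3 : exp (-((r y + r (-y)) / 2)) = exp (-r y / 2) * exp (-r (-y) / 2) := by
    rw [← exp_add]; ring_nf
  rw [e1, e2, e3]
  nlinarith [sq_nonneg (exp (-r y / 2) - exp (-r (-y) / 2))]

end Pointwise

end SkewLaplace

/-! ### Integration: the skew-corrected estimate in whitened coordinates. -/

namespace SkewLaplace

open ProbabilityTheory Real
open scoped ENNReal RealInnerProductSpace

lemma integral_comp_neg_stdGaussian {d : ℕ} (f : Vec d → ℝ) :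
    ∫ y, f (-y) ∂stdGaussian (Vec d) = ∫ y, f y ∂stdGaussian (Vec d) :=
  (measurePreserving_neg_stdGaussian d).integral_comp
    (MeasurableEquiv.neg (Vec d)).measurableEmbedding f

lemma integrable_comp_neg_stdGaussian {d : ℕ} {f : Vec d → ℝ}
    (hf : Integrable f (stdGaussian (Vec d))) :
    Integrable (fun y => f (-y)) (stdGaussian (Vec d)) :=
  (measurePreserving_neg_stdGaussian d).integrable_comp_of_integrable hf

lemma abs_integral_le_of_dominated {d : ℕ} {f D : Vec d → ℝ} {T C : ℝ} (hT : 0 ≤ T)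
    (hD : Integrable D (stdGaussian (Vec d))) (hC : ∫ y, D y ∂stdGaussian (Vec d) ≤ C)
    (hf : ∀ y, |f y| ≤ T * D y) : |∫ y, f y ∂stdGaussian (Vec d)| ≤ T * C := by
  have h1 := norm_integral_le_of_norm_le (hD.const_mul T)
    (ae_of_all _ fun y => (norm_eq_abs (f y)).trans_le (hf y))
  rw [integral_const_mul] at h1
  exact h1.trans (mul_le_mul_of_nonneg_left hC hT)

lemma integrable_of_dominated {d : ℕ} {f D : Vec d → ℝ} (T : ℝ)
    (hD : Integrable D (stdGaussian (Vec d))) (hm : Measurable f) (hf : ∀ y, |f y| ≤ T * D y) :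
    Integrable f (stdGaussian (Vec d)) :=
  (hD.const_mul T).mono' hm.aestronglyMeasurable
    (ae_of_all _ fun y => (norm_eq_abs (f y)).trans_le (hf y))

/-- The normalizing constant is bounded below. -/
lemma LocalExpansion.le_integral {d : ℕ} {B : TriForm d} {σ η δ s c K : ℝ} {ρ r : Vec d → ℝ}
    (h : LocalExpansion B σ η δ s c ρ r) (hK : η ≤ K ^ 2)
    (hi : Integrable ρ (stdGaussian (Vec d))) :
    exp (-K ^ 2) / 3 ≤ ∫ y, ρ y ∂stdGaussian (Vec d) := by
  set U : Set (Vec d) := {y | ‖y‖ ≤ 2 * √d} with hU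
  have hUm : MeasurableSet U := measurableSet_le (by fun_prop) (by fun_prop)
  -- Symmetrization makes the pointwise lower bound on the even part usable; the ball of radius
  -- `2√d` has mass at least `1/3`.
  have h1 : ∫ y, (ρ y + ρ (-y)) / 2 ∂stdGaussian (Vec d) = ∫ y, ρ y ∂stdGaussian (Vec d) := by
    rw [integral_div, integral_add hi (integrable_comp_neg_stdGaussian hi),
      integral_comp_neg_stdGaussian]
    ring
  rw [← h1]
  have h2 : ∫ y, U.indicator (fun _ => exp (-K ^ 2)) y ∂stdGaussian (Vec d) ≤
      ∫ y, (ρ y + ρ (-y)) / 2 ∂stdGaussian (Vec d) := by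
    refine integral_mono ((integrable_const _).indicator hUm)
      ((hi.add (integrable_comp_neg_stdGaussian hi)).div_const 2) fun y => ?_
    by_cases hy : y ∈ U
    · rw [Set.indicator_of_mem hy]
      exact (exp_le_exp.2 (neg_le_neg hK)).trans (h.exp_neg_le_even hy)
    · rw [Set.indicator_of_notMem hy]
      have := h.nonneg y
      have := h.nonneg (-y)
      change 0 ≤ (ρ y + ρ (-y)) / 2
      positivity
  refine le_trans ?_ h2
  rw [integral_indicator_const _ hUm, smul_eq_mul]
  have h3 : 1 / 3 ≤ (stdGaussian (Vec d)).real U := by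
    have := one_third_le_measure_norm_le h.one_le_dim (le_refl (2 : ℝ))
    rwa [ENNReal.ofReal_le_iff_le_toReal (measure_ne_top _ _)] at this
  have h4 := exp_pos (-K ^ 2)
  nlinarith

lemma linear_combination_le {k K E₁ E₂ E₃ x w : ℝ} (hk : 0 ≤ k) (hK : 0 ≤ K) (p1 : 0 ≤ E₁)
    (p2 : 0 ≤ E₂) (p3 : 0 ≤ E₃) (hx : x ≤ E₃) (hw : w ≤ K * E₃) :
    k * E₁ + E₂ + x + w ≤ (k + 2 + K) * (E₁ + E₂ + E₃) ∧
      ∀ u ≤ k * E₁, u + 2 * w ≤ (k + 2 * K) * (E₁ + E₂ + E₃) := by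
  have h1 := mul_nonneg hk p1
  have h2 := mul_nonneg hk p2
  have h3 := mul_nonneg hk p3
  have h4 := mul_nonneg hK p1
  have h5 := mul_nonneg hK p2
  constructor
  · linarith
  · intro u hu
    linarith

/-- The skew-corrected Gaussian approximation of a density with a local cubic expansion. -/
theorem exists_abs_div_add_integral_le (K : ℝ) (hK : 0 < K) : ∃ C : ℝ, 0 < C ∧
    ∀ (d : ℕ) (B : TriForm d) (σ η δ s c a : ℝ) (ρ r g : Vec d → ℝ),
      LocalExpansion B σ η δ s c ρ r → σ ≤ K → η ≤ K ^ 2 →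
      Measurable g → (∀ y, g (-y) = -g y) → Integrable (fun y => g y ^ 2) (stdGaussian (Vec d)) →
      ∫ y, g y ^ 2 ∂stdGaussian (Vec d) = 1 → 0 ≤ a →
      (∀ y, |g y| ≤ a * exp (c * √d * ‖y‖ / 2)) →
      Integrable ρ (stdGaussian (Vec d)) ∧ 0 < ∫ y, ρ y ∂stdGaussian (Vec d) ∧
      Integrable (fun y => g y * ρ y) (stdGaussian (Vec d)) ∧
      Integrable (fun y => g y * (B y y y / 6)) (stdGaussian (Vec d)) ∧
      |(∫ y, g y * ρ y ∂stdGaussian (Vec d)) / (∫ y, ρ y ∂stdGaussian (Vec d)) +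
          ∫ y, g y * (B y y y / 6) ∂stdGaussian (Vec d)| ≤
        C * (exp ((σ ^ 2 + η) * s ^ 4) * (σ ^ 2 + η) * (σ + η) + (d : ℝ) ^ (-(1 / 2) : ℝ) * δ +
          max a 1 * (d * exp (-(c * s * d / 8)))) := by
  obtain ⟨C₀, hC₀, hdom⟩ := exists_dominating
  set k := 3 + 2 * K ^ 2 with hk
  set z := exp (-K ^ 2) / 3 with hz
  have hz0 : 0 < z := by positivity
  have hk0 : 0 < k := by positivity
  refine ⟨(C₀ * (k + 2 + K) + C₀ ^ 2 * (k + 2 * K)) / z, by positivity, ?_⟩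
  intro d B σ η δ s c a ρ r g h hσK hηK hgm hodd hg2 hg1 ha hga
  obtain ⟨D, M, hDi, hDC, d1, d2, d3, d4, d5, d6, d7⟩ := hdom d B σ s c g h.one_le_dim h.symm
    h.σ_nonneg h.le_radius h.c_pos h.log_le_radius h.cubic_le hgm hg2 hg1
  have hD : Dominates B σ s c g D M := ⟨d1, d2, d3, d4, d5, d6, d7⟩
  set γ := stdGaussian (Vec d) with hγ
  set A := exp ((σ ^ 2 + η) * s ^ 4) with hA
  set θ := exp (-(c * s * d / 8)) with hθ
  have hσ := h.σ_nonneg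
  have hη := h.η_nonneg
  have hδ := h.δ_nonneg
  have hA0 : 0 < A := exp_pos _
  have hθ0 : 0 < θ := exp_pos _
  have hd1 : (1 : ℝ) ≤ d := by exact_mod_cast h.one_le_dim
  have hρm := h.measurable
  have hBm : Measurable fun y : Vec d => B y y y := Continuous.measurable (by fun_prop)
  have iρ : Integrable ρ γ := integrable_of_dominated _ hDi hρm fun y => by
    rw [abs_of_nonneg (h.nonneg y)]; exact h.density_le hD y
  have igρ : Integrable (fun y => g y * ρ y) γ :=
    integrable_of_dominated _ hDi (hgm.mul hρm) fun y => by
      rw [abs_mul, abs_of_nonneg (h.nonneg y)]; exact h.abs_mul_density_le hD ha hga y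
  have igp : Integrable (fun y => g y * (B y y y / 6)) γ :=
    integrable_of_dominated _ hDi (hgm.mul (hBm.div_const 6)) (hD.abs_mul_cubic_le hσ)
  set N := ∫ y, g y * ρ y ∂γ with hN
  set Q := ∫ y, g y * (B y y y / 6) ∂γ with hQ
  set Z := ∫ y, ρ y ∂γ with hZ
  have hzZ : z ≤ Z := h.le_integral hηK iρ
  have hZ0 : 0 < Z := hz0.trans_le hzZ
  refine ⟨iρ, hZ0, igρ, igp, ?_⟩
  set T := A * (k * (σ ^ 2 + η) * (σ + η)) + δ * (d : ℝ) ^ (-(1 / 2) : ℝ) + (a + σ) * θ with hT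
  have hNQ : |N + Q| ≤ T * C₀ := by
    -- Oddness of `g` replaces `ρ` by its odd part, which nearly cancels the cubic.
    have e : N + Q = ∫ y, g y * ((ρ y - ρ (-y)) / 2 + B y y y / 6) ∂γ := by
      have h1 : ∫ y, g y * ρ (-y) ∂γ = -N := by
        rw [hN, ← integral_comp_neg_stdGaussian, ← integral_neg]
        refine integral_congr_ae (ae_of_all _ fun y => ?_)
        simp [hodd]
      have i1 : Integrable (fun y => g y * ρ (-y)) γ := by
        have := (integrable_comp_neg_stdGaussian igρ).neg
        refine this.congr (ae_of_all _ fun y => ?_)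
        simp [hodd]
      have h2 : ∀ y, g y * ((ρ y - ρ (-y)) / 2 + B y y y / 6) =
          (g y * ρ y / 2 - g y * ρ (-y) / 2) + g y * (B y y y / 6) := fun y => by ring
      simp_rw [h2]
      have i2 : Integrable (fun y => g y * ρ y / 2 - g y * ρ (-y) / 2) γ :=
        (igρ.div_const 2).sub (i1.div_const 2)
      rw [integral_add i2 igp,
        integral_sub (igρ.div_const 2) (i1.div_const 2), integral_div, integral_div, h1]
      ring
    rw [e]
    refine abs_integral_le_of_dominated (by positivity) hDi hDC fun y => ?_
    rw [abs_mul]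
    exact h.abs_mul_odd_le hD hηK ha hga y
  have hQ' : |Q| ≤ σ * C₀ := abs_integral_le_of_dominated hσ hDi hDC (hD.abs_mul_cubic_le hσ)
  have hZ1 : |Z - 1| ≤ (A * (k * (σ ^ 2 + η)) + 2 * θ) * C₀ := by
    have e : Z - 1 = ∫ y, ((ρ y + ρ (-y)) / 2 - 1) ∂γ := by
      have i2 : Integrable (fun y => (ρ y + ρ (-y)) / 2) γ :=
        (iρ.add (integrable_comp_neg_stdGaussian iρ)).div_const 2
      rw [integral_sub i2 (integrable_const _), integral_div,
        integral_add iρ (integrable_comp_neg_stdGaussian iρ),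
        integral_comp_neg_stdGaussian]
      simp [← hγ, ← hZ]
    rw [e]
    exact abs_integral_le_of_dominated (by positivity) hDi hDC (h.abs_even_sub_one_le hD hηK)
  -- Each numerator term is of third order: `N + Q` by parity, and `Q (Z - 1)` as a product of
  -- orders one and two.
  have key : N / Z + Q = ((N + Q) + Q * (Z - 1)) / Z := by field_simp; ring
  set E₁ := A * (σ ^ 2 + η) * (σ + η) with hE₁
  set E₂ := (d : ℝ) ^ (-(1 / 2) : ℝ) * δ with hE₂
  set E₃ := max a 1 * (d * θ) with hE₃
  have p1 : 0 ≤ E₁ := by positivity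
  have p2 : 0 ≤ E₂ := by positivity
  have p3 : 0 ≤ E₃ := by positivity
  have q3 : a * θ ≤ E₃ := by
    rw [hE₃]
    have := le_max_left a 1
    calc a * θ ≤ max a 1 * θ := by gcongr
      _ ≤ max a 1 * (d * θ) := by gcongr; exact le_mul_of_one_le_left hθ0.le hd1
  have q4 : θ ≤ E₃ := by
    rw [hE₃]
    calc θ ≤ d * θ := le_mul_of_one_le_left hθ0.le hd1
      _ ≤ _ := le_mul_of_one_le_left (by positivity) (le_max_right a 1)
  have q5 : σ * θ ≤ K * E₃ := mul_le_mul hσK q4 hθ0.le hK.le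
  have hT' : T ≤ (k + 2 + K) * (E₁ + E₂ + E₃) := by
    have : T = k * E₁ + E₂ + a * θ + σ * θ := by rw [hT, hE₁, hE₂]; ring
    rw [this]
    exact (linear_combination_le hk0.le hK.le p1 p2 p3 q3 q5).1
  have hQZ : σ * (A * (k * (σ ^ 2 + η)) + 2 * θ) ≤ (k + 2 * K) * (E₁ + E₂ + E₃) := by
    have h1 : σ * (A * (k * (σ ^ 2 + η))) ≤ k * E₁ := by
      have : k * E₁ = (σ + η) * (A * (k * (σ ^ 2 + η))) := by rw [hE₁]; ring
      rw [this]
      gcongr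
      linarith
    rw [mul_add, mul_left_comm σ 2 θ]
    exact (linear_combination_le hk0.le hK.le p1 p2 p3 q3 q5).2 _ h1
  rw [key, abs_div, abs_of_pos hZ0]
  calc |N + Q + Q * (Z - 1)| / Z ≤ |N + Q + Q * (Z - 1)| / z := by gcongr
    _ ≤ (T * C₀ + (σ * C₀) * ((A * (k * (σ ^ 2 + η)) + 2 * θ) * C₀)) / z := by
        gcongr
        refine (abs_add_le _ _).trans (add_le_add hNQ ?_)
        rw [abs_mul]
        gcongr
    _ = (C₀ * T + C₀ ^ 2 * (σ * (A * (k * (σ ^ 2 + η)) + 2 * θ))) / z := by ring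
    _ ≤ (C₀ * ((k + 2 + K) * (E₁ + E₂ + E₃)) + C₀ ^ 2 * ((k + 2 * K) * (E₁ + E₂ + E₃))) / z := by
        gcongr
    _ = _ := by ring

end SkewLaplace

/-! ### Derivatives under affine maps, Taylor's formula along a segment, symmetry of the third
derivative. -/

namespace SkewLaplace

open ProbabilityTheory Real
open scoped ENNReal RealInnerProductSpace
open scoped Matrix MatrixOrder ContDiff

section Calculus

variable {E F : Type*} [NormedAddCommGroup E] [NormedSpace ℝ E] [NormedAddCommGroup F]
  [NormedSpace ℝ F]

lemma iteratedFDeriv_const_mul_comp_add {d : ℕ} {Θ : Set E} (hΘ : IsOpen Θ) {v : E → ℝ}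
    {m : ℕ} (hv : ContDiffOn ℝ m v Θ) (n : ℝ) (x₀ : E) (A : Vec d →L[ℝ] E) {y : Vec d}
    (hy : x₀ + A y ∈ Θ) {k : ℕ} (hk : k ≤ m) (u : Fin k → Vec d) :
    iteratedFDeriv ℝ k (fun y => n * v (x₀ + A y)) y u =
      n * iteratedFDeriv ℝ k v (x₀ + A y) (fun i => A (u i)) := by
  set s : Set E := (fun z => x₀ + z) ⁻¹' Θ with hs
  have hso : IsOpen s := hΘ.preimage (by fun_prop)
  have hv' : ContDiffOn ℝ m (fun z => v (x₀ + z)) s :=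
    hv.comp (contDiffOn_const.add contDiffOn_id) fun z hz => hz
  have hsA : IsOpen (A ⁻¹' s) := hso.preimage A.continuous
  have h1 := A.iteratedFDerivWithin_comp_right hv' hso.uniqueDiffOn hsA.uniqueDiffOn
    (x := y) hy (i := k) (by exact_mod_cast hk)
  rw [iteratedFDerivWithin_of_isOpen k hsA hy, iteratedFDerivWithin_of_isOpen k hso hy,
    iteratedFDeriv_comp_add_left] at h1
  have h2 : ContDiffAt ℝ k ((fun z => v (x₀ + z)) ∘ A) y :=
    ((hv'.comp A.contDiff.contDiffOn (fun z hz => hz)).contDiffAt (hsA.mem_nhds hy)).of_le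
      (by exact_mod_cast hk)
  have h3 := iteratedFDeriv_const_smul_apply (a := n) (i := k) h2
  have e : (fun y => n * v (x₀ + A y)) = n • ((fun z => v (x₀ + z)) ∘ A) := by
    ext z; simp
  rw [e, h3, h1]
  rfl

lemma iteratedDeriv_comp_smul {Ω : Set E} (hΩ : IsOpen Ω) {w : E → ℝ} {m : ℕ}
    (hw : ContDiffOn ℝ m w Ω) (h : E) {t : ℝ} (ht : t • h ∈ Ω) {k : ℕ} (hk : k ≤ m) :
    iteratedDeriv k (fun t : ℝ => w (t • h)) t = iteratedFDeriv ℝ k w (t • h) (fun _ => h) := by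
  set L : ℝ →L[ℝ] E := ContinuousLinearMap.toSpanSingleton ℝ h with hL
  have hLo : IsOpen (L ⁻¹' Ω) := hΩ.preimage L.continuous
  have ht' : L t ∈ Ω := by simpa [hL] using ht
  have h1 := L.iteratedFDerivWithin_comp_right hw hΩ.uniqueDiffOn hLo.uniqueDiffOn
    (x := t) ht' (i := k) (by exact_mod_cast hk)
  rw [iteratedFDerivWithin_of_isOpen k hLo ht', iteratedFDerivWithin_of_isOpen k hΩ ht'] at h1
  rw [iteratedDeriv_eq_iteratedFDeriv]
  have e : (fun t : ℝ => w (t • h)) = w ∘ L := by ext; simp [hL]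
  rw [e, h1]
  simp [hL]

/-- The one-variable Lagrange remainder for `t ↦ w (t • h)` evaluates the derivative on equal
arguments, which is what the diagonal norm `opNorm` controls. -/
lemma exists_taylor_along {Ω : Set E} (hΩ : IsOpen Ω) {w : E → ℝ} {m : ℕ}
    (hw : ContDiffOn ℝ (m + 1 : ℕ) w Ω) (h : E) (hseg : ∀ t ∈ Set.Icc (0 : ℝ) 1, t • h ∈ Ω) :
    ∃ t ∈ Set.Ioo (0 : ℝ) 1, w h =
      (∑ k ∈ Finset.range (m + 1), iteratedFDeriv ℝ k w 0 (fun _ => h) / k.factorial) +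
        iteratedFDeriv ℝ (m + 1) w (t • h) (fun _ => h) / (m + 1).factorial := by
  have hat : ∀ t ∈ Set.Icc (0 : ℝ) 1, ContDiffAt ℝ (m + 1 : ℕ) (fun t : ℝ => w (t • h)) t := by
    intro t ht
    have : ContDiffAt ℝ (m + 1 : ℕ) w (t • h) := hw.contDiffAt (hΩ.mem_nhds (hseg t ht))
    exact this.comp t (contDiffAt_id.smul contDiffAt_const)
  have huI : Set.uIcc (0 : ℝ) 1 = Set.Icc 0 1 := Set.uIcc_of_le zero_le_one
  obtain ⟨t, ht, he⟩ := taylor_mean_remainder_lagrange_iteratedDeriv (f := fun t : ℝ => w (t • h))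
    (x₀ := 0) (x := 1) (n := m) zero_ne_one (by
      rw [huI]; exact fun t ht => (hat t ht).contDiffWithinAt)
  rw [Set.uIoo_of_le zero_le_one] at ht
  refine ⟨t, ht, ?_⟩
  have hu := hseg t (Set.Ioo_subset_Icc_self ht)
  rw [iteratedDeriv_comp_smul hΩ hw h hu le_rfl, taylor_within_apply, huI] at he
  have hsum : ∑ k ∈ Finset.range (m + 1), ((k.factorial : ℝ)⁻¹ * (1 - 0) ^ k) •
      iteratedDerivWithin k (fun t : ℝ => w (t • h)) (Set.Icc 0 1) 0 =
      ∑ k ∈ Finset.range (m + 1), iteratedFDeriv ℝ k w 0 (fun _ => h) / k.factorial := by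
    refine Finset.sum_congr rfl fun k hk => ?_
    have hk' : k ≤ m + 1 := (Finset.mem_range.1 hk).le
    have h0 : (0 : ℝ) ∈ Set.Icc (0 : ℝ) 1 := by simp
    rw [iteratedDerivWithin_eq_iteratedDeriv (uniqueDiffOn_Icc zero_lt_one)
      ((hat 0 h0).of_le (by exact_mod_cast hk')) h0,
      iteratedDeriv_comp_smul hΩ hw h (hseg 0 h0) hk', zero_smul]
    simp [div_eq_inv_mul]
  rw [hsum] at he
  simp only [one_smul, sub_zero, one_pow, mul_one] at he
  linarith

lemma iteratedFDeriv_three_apply (w : E → F) (x : E) (u : Fin 3 → E) :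
    iteratedFDeriv ℝ 3 w x u = fderiv ℝ (fderiv ℝ (fderiv ℝ w)) x (u 0) (u 1) (u 2) := by
  rw [iteratedFDeriv_succ_apply_right, iteratedFDeriv_two_apply]
  rfl

/-- The third derivative is a symmetric trilinear form. -/
lemma isSymm_fderiv_three {d : ℕ} {w : Vec d → ℝ} {x : Vec d} (hw : ContDiffAt ℝ 3 w x) :
    TriForm.IsSymm (fderiv ℝ (fderiv ℝ (fderiv ℝ w)) x) where
  swap_left y z u := by
    have h1 : ContDiffAt ℝ 2 (fderiv ℝ w) x := hw.fderiv_right (by norm_num)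
    have h2 : IsSymmSndFDerivAt ℝ (fderiv ℝ w) x := h1.isSymmSndFDerivAt (by simp)
    exact congrArg (fun L => L u) (h2.eq y z)
  swap_right y z u := by
    have h1 : ContDiffAt ℝ 2 (fderiv ℝ w) x := hw.fderiv_right (by norm_num)
    have h2 : DifferentiableAt ℝ (fderiv ℝ (fderiv ℝ w)) x :=
      (h1.fderiv_right (m := 1) (by norm_num)).differentiableAt (by norm_num)
    have happ : ∀ p q : Vec d, fderiv ℝ (fun t => fderiv ℝ (fderiv ℝ w) t p q) x y =
        fderiv ℝ (fderiv ℝ (fderiv ℝ w)) x y p q := by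
      intro p q
      have h3 : DifferentiableAt ℝ (fun t => fderiv ℝ (fderiv ℝ w) t p) x :=
        h2.clm_apply (differentiableAt_const p)
      rw [fderiv_clm_apply h3 (differentiableAt_const q),
        fderiv_clm_apply h2 (differentiableAt_const p)]
      simp
    rw [← happ, ← happ]
    -- The second derivative is symmetric at every nearby point, so the symmetry survives one more
    -- differentiation.
    have hev : (fun t => fderiv ℝ (fderiv ℝ w) t z u) =ᶠ[nhds x]
        fun t => fderiv ℝ (fderiv ℝ w) t u z := by
      filter_upwards [hw.eventually (by norm_num)] with t ht
      exact (ht.isSymmSndFDerivAt (by simp; norm_num)).eq z u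
    rw [hev.fderiv_eq]

end Calculus

end SkewLaplace

/-! ### The weighted norm, whitening, and bounds from the weighted operator norms. -/

namespace SkewLaplace

open ProbabilityTheory Real
open scoped ENNReal RealInnerProductSpace
open scoped Matrix MatrixOrder ContDiff

section WeightedNorm

variable {d : ℕ} {H : Matrix (Fin d) (Fin d) ℝ}

/-- The linear map `y ↦ H^{-1/2} y`. -/
noncomputable def whiten (H : Matrix (Fin d) (Fin d) ℝ) : Vec d →L[ℝ] Vec d :=
  Matrix.toEuclideanCLM (𝕜 := ℝ) (CFC.sqrt H⁻¹)

lemma sqrt_inv_mul_mul_sqrt_inv (hH : H.PosDef) : CFC.sqrt H⁻¹ * H * CFC.sqrt H⁻¹ = 1 := by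
  have h1 : CFC.sqrt H⁻¹ * CFC.sqrt H⁻¹ = H⁻¹ :=
    CFC.sqrt_mul_sqrt_self _ hH.inv.posSemidef.nonneg
  have h2 : CFC.sqrt H⁻¹ * (CFC.sqrt H⁻¹ * H) = 1 := by
    rw [← mul_assoc, h1]
    exact Matrix.nonsing_inv_mul _ ((Matrix.isUnit_iff_isUnit_det _).1 hH.isUnit)
  exact mul_eq_one_comm.1 h2

lemma dotProduct_whiten (hH : H.PosDef) (y : Vec d) :
    (whiten H y).ofLp ⬝ᵥ (H *ᵥ (whiten H y).ofLp) = ‖y‖ ^ 2 := by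
  have hs : (CFC.sqrt H⁻¹)ᵀ = CFC.sqrt H⁻¹ := by
    have := (CFC.sqrt_nonneg H⁻¹).isSelfAdjoint
    rwa [IsSelfAdjoint, Matrix.star_eq_conjTranspose, Matrix.conjTranspose_eq_transpose_of_trivial]
      at this
  have e : (whiten H y).ofLp = CFC.sqrt H⁻¹ *ᵥ y.ofLp := by
    simp [whiten, Matrix.ofLp_toEuclideanCLM]
  rw [e, Matrix.mulVec_mulVec, ← Matrix.vecMul_transpose, ← Matrix.dotProduct_mulVec,
    Matrix.mulVec_mulVec, hs, ← mul_assoc, sqrt_inv_mul_mul_sqrt_inv hH, Matrix.one_mulVec,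
    EuclideanSpace.real_norm_sq_eq]
  simp [dotProduct, sq]

lemma wNorm_whiten (hH : H.PosDef) (y : Vec d) : wNorm H (whiten H y) = ‖y‖ := by
  rw [wNorm, dotProduct_whiten hH, sqrt_sq (norm_nonneg y)]

lemma wNorm_nonneg (x : Vec d) : 0 ≤ wNorm H x := sqrt_nonneg _

lemma wNorm_smul (t : ℝ) (x : Vec d) : wNorm H (t • x) = |t| * wNorm H x := by
  rw [wNorm, wNorm]
  have : (t • x).ofLp ⬝ᵥ (H *ᵥ (t • x).ofLp) = t ^ 2 * (x.ofLp ⬝ᵥ (H *ᵥ x.ofLp)) := by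
    simp [Matrix.mulVec_smul]; ring
  rw [this, sqrt_mul (sq_nonneg t), sqrt_sq_eq_abs]

lemma wNorm_smul_matrix {n : ℝ} (hn : 0 ≤ n) (x : Vec d) : wNorm (n • H) x = √n * wNorm H x := by
  rw [wNorm, wNorm, Matrix.smul_mulVec, dotProduct_smul, smul_eq_mul, sqrt_mul hn]

lemma continuous_wNorm : Continuous (wNorm H) := by
  unfold wNorm
  refine continuous_sqrt.comp ?_
  exact Continuous.dotProduct (by fun_prop) (Continuous.matrix_mulVec (by fun_prop) (by fun_prop))

lemma whiten_injective (hH : H.PosDef) : Function.Injective (whiten H) := by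
  rw [injective_iff_map_eq_zero]
  intro y hy
  have := wNorm_whiten hH y
  rw [hy] at this
  have h0 : wNorm H (0 : Vec d) = 0 := by simp [wNorm]
  rw [h0] at this
  exact norm_eq_zero.1 this.symm

lemma whiten_surjective (hH : H.PosDef) : Function.Surjective (whiten H) :=
  LinearMap.surjective_of_injective (f := (whiten H : Vec d →ₗ[ℝ] Vec d)) (whiten_injective hH)

lemma norm_le_wNorm (hH : H.PosDef) (x : Vec d) : ‖x‖ ≤ ‖whiten H‖ * wNorm H x := by
  obtain ⟨y, rfl⟩ := whiten_surjective hH x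
  rw [wNorm_whiten hH]
  exact (whiten H).le_opNorm y

lemma det_whiten_ne_zero (hH : H.PosDef) :
    LinearMap.det (whiten H : Vec d →ₗ[ℝ] Vec d) ≠ 0 := by
  have := LinearMap.isUnit_iff_ker_eq_bot (whiten H : Vec d →ₗ[ℝ] Vec d)
  have h2 : IsUnit (whiten H : Vec d →ₗ[ℝ] Vec d) :=
    this.2 (LinearMap.ker_eq_bot.2 (whiten_injective hH))
  exact (LinearMap.isUnit_det _ h2).ne_zero

variable {k : ℕ}

lemma abs_apply_le_of_wNorm_eq_one (hH : H.PosDef)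
    (T : ContinuousMultilinearMap ℝ (fun _ : Fin k => Vec d) ℝ) {u : Vec d} (hu : wNorm H u = 1) :
    |T fun _ => u| ≤ ‖T‖ * ‖whiten H‖ ^ k := by
  have h1 := norm_le_wNorm hH u
  rw [hu, mul_one] at h1
  have h2 := T.le_opNorm fun _ => u
  rw [Finset.prod_const, Finset.card_univ, Fintype.card_fin, norm_eq_abs] at h2
  exact h2.trans (by gcongr)

/-- No boundedness is needed, since the real supremum of an empty or unbounded set is `0`. -/
lemma opNorm_nonneg (T : ContinuousMultilinearMap ℝ (fun _ : Fin k => Vec d) ℝ) :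
    0 ≤ opNorm H T :=
  Real.sSup_nonneg (by rintro _ ⟨u, -, rfl⟩; exact abs_nonneg _)

lemma opNorm_le (hH : H.PosDef) (T : ContinuousMultilinearMap ℝ (fun _ : Fin k => Vec d) ℝ) :
    opNorm H T ≤ ‖T‖ * ‖whiten H‖ ^ k :=
  Real.sSup_le (by rintro _ ⟨u, hu, rfl⟩; exact abs_apply_le_of_wNorm_eq_one hH T hu)
    (by positivity)

lemma abs_apply_le_opNorm (hH : H.PosDef) (hk : k ≠ 0)
    (T : ContinuousMultilinearMap ℝ (fun _ : Fin k => Vec d) ℝ) (x : Vec d) :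
    |T fun _ => x| ≤ opNorm H T * wNorm H x ^ k := by
  rcases eq_or_ne (wNorm H x) 0 with h0 | h0
  · have hx : x = 0 := by
      have := norm_le_wNorm hH x
      rw [h0, mul_zero] at this
      exact norm_le_zero_iff.1 this
    subst hx
    have : Nonempty (Fin k) := ⟨⟨0, Nat.pos_of_ne_zero hk⟩⟩
    have e : (T fun _ => (0 : Vec d)) = 0 := T.map_zero
    rw [e, abs_zero]
    have := opNorm_nonneg (H := H) T
    have := wNorm_nonneg (H := H) (0 : Vec d)
    positivity
  · have hpos : 0 < wNorm H x := lt_of_le_of_ne (wNorm_nonneg x) h0.symm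
    set u : Vec d := (wNorm H x)⁻¹ • x with hu
    have hu1 : wNorm H u = 1 := by
      rw [hu, wNorm_smul, abs_of_pos (by positivity), inv_mul_cancel₀ h0]
    have hle : |T fun _ => u| ≤ opNorm H T :=
      le_csSup ⟨‖T‖ * ‖whiten H‖ ^ k, by
        rintro _ ⟨z, hz, rfl⟩; exact abs_apply_le_of_wNorm_eq_one hH T hz⟩ ⟨u, hu1, rfl⟩
    have e : (T fun _ => x) = wNorm H x ^ k * T fun _ => u := by
      have h1 : (fun _ : Fin k => x) = fun _ : Fin k => wNorm H x • u := by
        funext _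
        rw [hu, smul_inv_smul₀ h0]
      rw [h1, T.map_smul_univ (fun _ => wNorm H x) (fun _ => u)]
      simp
    rw [e, abs_mul, abs_of_pos (by positivity), mul_comm]
    gcongr

variable {n : ℝ} {v : Vec d → ℝ} {xhat : Vec d} {s : ℝ}

lemma derivBound_nonneg : 0 ≤ derivBound n v xhat k s :=
  Real.sSup_nonneg (by rintro _ ⟨x, -, rfl⟩; exact opNorm_nonneg _)

lemma isCompact_localRegion (hH : (hessian v xhat).PosDef) :
    IsCompact (localRegion n v xhat s) := by
  apply Metric.isCompact_of_isClosed_isBounded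
  · exact isClosed_le (continuous_wNorm.comp (by fun_prop)) continuous_const
  · rw [isBounded_iff_forall_norm_le]
    refine ⟨‖xhat‖ + ‖whiten (hessian v xhat)‖ * (s * √((d : ℝ) / n)), fun x hx => ?_⟩
    have h1 := norm_le_wNorm hH (x - xhat)
    have h2 : ‖x‖ ≤ ‖xhat‖ + ‖x - xhat‖ := by
      calc ‖x‖ = ‖xhat + (x - xhat)‖ := by rw [add_sub_cancel]
        _ ≤ _ := norm_add_le _ _
    refine h2.trans ?_
    have h3 : wNorm (hessian v xhat) (x - xhat) ≤ s * √((d : ℝ) / n) := hx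
    gcongr
    exact h1.trans (by gcongr)

/-- The supremum must be shown finite before it bounds anything: the local region is compact and the
derivative is continuous on it. -/
lemma opNorm_le_derivBound {Θ : Set (Vec d)} (hΘ : IsOpen Θ) {m : ℕ} (hv : ContDiffOn ℝ m v Θ)
    (hH : (hessian v xhat).PosDef) (hsub : localRegion n v xhat s ⊆ Θ) (hk : k ≤ m) {x : Vec d}
    (hx : x ∈ localRegion n v xhat s) :
    opNorm (hessian v xhat) (iteratedFDeriv ℝ k v x) ≤ derivBound n v xhat k s := by
  have hc : ContinuousOn (fun x => ‖iteratedFDeriv ℝ k v x‖) (localRegion n v xhat s) := by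
    have h1 : ContinuousOn (iteratedFDerivWithin ℝ k v Θ) Θ :=
      hv.continuousOn_iteratedFDerivWithin (by exact_mod_cast hk) hΘ.uniqueDiffOn
    exact (h1.congr fun y hy => (iteratedFDerivWithin_of_isOpen k hΘ hy).symm).norm.mono hsub
  obtain ⟨C, hC⟩ := (isCompact_localRegion (n := n) (s := s) hH).bddAbove_image hc
  refine le_csSup ⟨C * ‖whiten (hessian v xhat)‖ ^ k, ?_⟩ ⟨x, hx, rfl⟩
  rintro _ ⟨y, hy, rfl⟩
  refine (opNorm_le hH _).trans ?_
  gcongr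
  exact hC ⟨y, hy, rfl⟩

/-- The second derivative as a quadratic form in the Hessian matrix. -/
lemma iteratedFDeriv_two_eq_hessian (f : Vec d → ℝ) (x u : Vec d) :
    iteratedFDeriv ℝ 2 f x (fun _ => u) = u.ofLp ⬝ᵥ (hessian f x *ᵥ u.ofLp) := by
  have hu : u = ∑ i, u i • EuclideanSpace.single i (1 : ℝ) := by
    ext j; simp [Pi.single_apply]
  rw [iteratedFDeriv_two_apply]
  conv_lhs => rw [hu]
  simp only [map_sum, map_smul, sum_apply, smul_apply, smul_eq_mul, dotProduct, Matrix.mulVec,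
    hessian, Matrix.of_apply, iteratedFDeriv_two_apply, Finset.mul_sum, Matrix.cons_val_zero,
    Matrix.cons_val_one]
  rw [Finset.sum_comm]
  refine Finset.sum_congr rfl fun i _ => Finset.sum_congr rfl fun j _ => ?_
  ring

lemma hessian_const_mul {x : Vec d} (hv : ContDiffAt ℝ 2 v x) :
    hessian (fun y => n * v y) x = n • hessian v x := by
  ext i j
  have := iteratedFDeriv_const_smul_apply (a := n) (i := 2) hv
  have e : (fun y => n * v y) = n • v := rfl
  rw [hessian, e, Matrix.of_apply, this]
  rfl

end WeightedNorm

end SkewLaplace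

/-! ### Change of variables from the posterior to a density against the standard Gaussian. -/

namespace SkewLaplace

open ProbabilityTheory Real
open scoped ENNReal RealInnerProductSpace
open scoped Matrix MatrixOrder

section ChangeOfVariables

variable {d : ℕ} {n : ℝ} {Θ : Set (Vec d)} {v : Vec d → ℝ} {xhat : Vec d}

/-- The affine map `y ↦ x₀ + H^{-1/2} y`. -/
noncomputable def unwhiten (H : Matrix (Fin d) (Fin d) ℝ) (x₀ y : Vec d) : Vec d :=
  x₀ + whiten H y

lemma continuous_unwhiten (H : Matrix (Fin d) (Fin d) ℝ) (x₀ : Vec d) :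
    Continuous (unwhiten H x₀) := by
  unfold unwhiten; fun_prop

lemma laplaceApprox_eq_map : laplaceApprox n v xhat =
    (stdGaussian (Vec d)).map (unwhiten (hessian (fun y => n * v y) xhat) xhat) := rfl

/-- The density of the posterior with respect to the standard Gaussian measure in whitened
coordinates, up to normalization. -/
noncomputable def relDensity (n : ℝ) (Θ : Set (Vec d)) (v : Vec d → ℝ)
    (H : Matrix (Fin d) (Fin d) ℝ) (x₀ : Vec d) : Vec d → ℝ :=
  (unwhiten H x₀ ⁻¹' Θ).indicator fun y => exp (‖y‖ ^ 2 / 2 - n * (v (unwhiten H x₀ y) - v x₀))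

variable {H : Matrix (Fin d) (Fin d) ℝ} {x₀ : Vec d}

lemma relDensity_nonneg (y : Vec d) : 0 ≤ relDensity n Θ v H x₀ y :=
  Set.indicator_nonneg (fun _ _ => (exp_pos _).le) _

lemma measurable_indicator_of_continuousOn {f : Vec d → ℝ} {s : Set (Vec d)} (hs : IsOpen s)
    (hf : ContinuousOn f s) : Measurable (s.indicator f) := by
  classical
  rw [← Set.piecewise_eq_indicator]
  exact hf.measurable_piecewise continuousOn_const hs.measurableSet

lemma measurable_relDensity (hΘ : IsOpen Θ) (hv : ContinuousOn v Θ) :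
    Measurable (relDensity n Θ v H x₀) := by
  refine measurable_indicator_of_continuousOn (hΘ.preimage (continuous_unwhiten H x₀)) ?_
  have h1 : ContinuousOn (fun y => v (unwhiten H x₀ y)) (unwhiten H x₀ ⁻¹' Θ) :=
    hv.comp (continuous_unwhiten H x₀).continuousOn fun y hy => hy
  exact continuous_exp.comp_continuousOn ((by fun_prop : Continuous fun y : Vec d => ‖y‖ ^ 2 / 2)
    |>.continuousOn.sub (continuousOn_const.mul (h1.sub continuousOn_const)))

lemma map_unwhiten_volume (hH : H.PosDef) : (volume : Measure (Vec d)).map (unwhiten H x₀) =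
    ENNReal.ofReal |(LinearMap.det (whiten H : Vec d →ₗ[ℝ] Vec d))⁻¹| • volume := by
  have hm : Measurable (whiten H : Vec d →ₗ[ℝ] Vec d) := (whiten H).continuous.measurable
  have e : unwhiten H x₀ = (fun z => x₀ + z) ∘ (whiten H : Vec d →ₗ[ℝ] Vec d) := rfl
  rw [e, ← Measure.map_map (by fun_prop) hm,
    Measure.map_linearMap_addHaar_eq_smul_addHaar _ (det_whiten_ne_zero hH), Measure.map_smul,
    map_add_left_eq_self]

lemma exists_map_withDensity_relDensity (hΘ : IsOpen Θ) (hv : ContinuousOn v Θ) (hH : H.PosDef) :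
    ∃ κ : ℝ≥0∞, κ ≠ 0 ∧ κ ≠ ∞ ∧
      ((stdGaussian (Vec d)).withDensity fun y => ENNReal.ofReal (relDensity n Θ v H x₀ y)).map
        (unwhiten H x₀) =
      κ • (volume.restrict Θ).withDensity fun x => ENNReal.ofReal (exp (-(n * v x))) := by
  set Ψ := unwhiten H x₀ with hΨ
  have hΨm : Measurable Ψ := (continuous_unwhiten H x₀).measurable
  set h : Vec d → ℝ≥0∞ := fun x =>
    ENNReal.ofReal (Θ.indicator (fun x => exp (-(n * v x))) x) with hh
  have hhm : Measurable h :=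
    (measurable_indicator_of_continuousOn hΘ (by fun_prop)).ennreal_ofReal
  set k₀ : ℝ := (2 * π) ^ (-(d / 2) : ℝ) * exp (n * v x₀) with hk₀
  have hk0 : 0 < k₀ := by positivity
  set δ : ℝ := |(LinearMap.det (whiten H : Vec d →ₗ[ℝ] Vec d))⁻¹| with hδ
  have hδ0 : 0 < δ := abs_pos.2 (inv_ne_zero (det_whiten_ne_zero hH))
  have hρm : Measurable fun y => ENNReal.ofReal (relDensity n Θ v H x₀ y) :=
    (measurable_relDensity hΘ hv).ennreal_ofReal
  have hφm : Measurable fun y : Vec d => ENNReal.ofReal (stdDensity d y) :=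
    (continuous_stdDensity d).measurable.ennreal_ofReal
  -- `k₀` collects the Gaussian normalization and `e^{n v(x₀)}`; `δ` is the inverse Jacobian. Only
  -- `0 < κ < ∞` matters, as `κ` cancels on normalizing.
  refine ⟨ENNReal.ofReal k₀ * ENNReal.ofReal δ, by positivity, by finiteness, ?_⟩
  have hprod : (fun y : Vec d => ENNReal.ofReal (stdDensity d y)) *
      (fun y => ENNReal.ofReal (relDensity n Θ v H x₀ y)) =
      fun y => ENNReal.ofReal k₀ * h (Ψ y) := by
    ext y
    rw [Pi.mul_apply, ← ENNReal.ofReal_mul (stdDensity_pos y).le, hh, ← ENNReal.ofReal_mul hk0.le]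
    congr 1
    by_cases hy : Ψ y ∈ Θ
    · rw [relDensity, Set.indicator_of_mem (by exact hy), Set.indicator_of_mem hy, stdDensity, hk₀,
        mul_assoc, mul_assoc, ← exp_add, ← exp_add]
      congr 2
      ring
    · rw [relDensity, Set.indicator_of_notMem (by exact hy), Set.indicator_of_notMem hy]
      simp
  have hind : (volume.restrict Θ).withDensity (fun x => ENNReal.ofReal (exp (-(n * v x)))) =
      volume.withDensity h := by
    rw [← withDensity_indicator hΘ.measurableSet]
    congr 1
    ext x
    by_cases hx : x ∈ Θ <;> simp [hh, hx]
  rw [stdGaussian_eq_withDensity, ← withDensity_mul _ hφm hρm, hprod, hind]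
  ext s hs
  rw [Measure.map_apply hΨm hs, withDensity_apply _ (hΨm hs), Measure.smul_apply,
    withDensity_apply _ hs, lintegral_const_mul' _ _ ENNReal.ofReal_ne_top,
    ← setLIntegral_map hs hhm hΨm, map_unwhiten_volume hH, Measure.restrict_smul,
    lintegral_smul_measure, smul_eq_mul, smul_eq_mul, mul_assoc]

lemma posterior_eq_map (hΘ : IsOpen Θ) (hv : ContinuousOn v Θ) (hH : H.PosDef) :
    posterior n Θ v =
      (∫⁻ y, ENNReal.ofReal (relDensity n Θ v H x₀ y) ∂stdGaussian (Vec d))⁻¹ •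
      ((stdGaussian (Vec d)).withDensity fun y => ENNReal.ofReal (relDensity n Θ v H x₀ y)).map
        (unwhiten H x₀) := by
  obtain ⟨κ, h0, ht, he⟩ := exists_map_withDensity_relDensity (n := n) (x₀ := x₀) hΘ hv hH
  have h1 := congrArg (fun μ => μ Set.univ) he
  simp only [Measure.smul_apply, withDensity_apply _ MeasurableSet.univ, Measure.restrict_univ,
    Measure.map_apply (continuous_unwhiten H x₀).measurable MeasurableSet.univ, Set.preimage_univ,
    smul_eq_mul] at h1
  rw [h1, he, posterior, smul_smul, ENNReal.mul_inv (Or.inl h0) (Or.inl ht), mul_right_comm,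
    ENNReal.inv_mul_cancel h0 ht, one_mul]

lemma lintegral_relDensity (hi : Integrable (relDensity n Θ v H x₀) (stdGaussian (Vec d))) :
    (∫⁻ y, ENNReal.ofReal (relDensity n Θ v H x₀ y) ∂stdGaussian (Vec d)) =
      ENNReal.ofReal (∫ y, relDensity n Θ v H x₀ y ∂stdGaussian (Vec d)) :=
  (ofReal_integral_eq_lintegral_ofReal hi (ae_of_all _ relDensity_nonneg)).symm

lemma isProbabilityMeasure_posterior (hΘ : IsOpen Θ) (hv : ContinuousOn v Θ) (hH : H.PosDef)
    (hi : Integrable (relDensity n Θ v H x₀) (stdGaussian (Vec d)))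
    (hpos : 0 < ∫ y, relDensity n Θ v H x₀ y ∂stdGaussian (Vec d)) :
    IsProbabilityMeasure (posterior n Θ v) := by
  refine ⟨?_⟩
  rw [posterior_eq_map hΘ hv hH, Measure.smul_apply,
    Measure.map_apply (continuous_unwhiten H x₀).measurable MeasurableSet.univ, Set.preimage_univ,
    withDensity_apply _ MeasurableSet.univ, Measure.restrict_univ, smul_eq_mul,
    lintegral_relDensity hi]
  exact ENNReal.inv_mul_cancel (ENNReal.ofReal_pos.2 hpos).ne' ENNReal.ofReal_ne_top

lemma integrable_posterior (hΘ : IsOpen Θ) (hv : ContinuousOn v Θ) (hH : H.PosDef)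
    (hi : Integrable (relDensity n Θ v H x₀) (stdGaussian (Vec d)))
    (hpos : 0 < ∫ y, relDensity n Θ v H x₀ y ∂stdGaussian (Vec d)) {f : Vec d → ℝ}
    (hf : Measurable f)
    (hfi : Integrable (fun y => f (unwhiten H x₀ y) * relDensity n Θ v H x₀ y)
      (stdGaussian (Vec d))) : Integrable f (posterior n Θ v) := by
  rw [posterior_eq_map hΘ hv hH, lintegral_relDensity hi]
  refine Integrable.smul_measure ?_ (ENNReal.inv_ne_top.2 (ENNReal.ofReal_pos.2 hpos).ne')
  rw [integrable_map_measure hf.aestronglyMeasurable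
    (continuous_unwhiten H x₀).measurable.aemeasurable,
    integrable_withDensity_iff (measurable_relDensity hΘ hv).ennreal_ofReal
      (ae_of_all _ fun _ => ENNReal.ofReal_lt_top)]
  simpa only [Function.comp_apply, ENNReal.toReal_ofReal (relDensity_nonneg _)] using hfi

lemma integral_posterior (hΘ : IsOpen Θ) (hv : ContinuousOn v Θ) (hH : H.PosDef)
    (hi : Integrable (relDensity n Θ v H x₀) (stdGaussian (Vec d)))
    {f : Vec d → ℝ} (hf : Measurable f) : ∫ x, f x ∂posterior n Θ v =
      (∫ y, f (unwhiten H x₀ y) * relDensity n Θ v H x₀ y ∂stdGaussian (Vec d)) /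
        ∫ y, relDensity n Θ v H x₀ y ∂stdGaussian (Vec d) := by
  rw [posterior_eq_map hΘ hv hH, lintegral_relDensity hi, integral_smul_measure,
    integral_map (continuous_unwhiten H x₀).measurable.aemeasurable hf.aestronglyMeasurable,
    integral_withDensity_eq_integral_toReal_smul (measurable_relDensity hΘ hv).ennreal_ofReal
      (ae_of_all _ fun _ => ENNReal.ofReal_lt_top), ENNReal.toReal_inv,
    ENNReal.toReal_ofReal (integral_nonneg relDensity_nonneg), smul_eq_mul, div_eq_inv_mul]
  simp only [ENNReal.toReal_ofReal (relDensity_nonneg _), smul_eq_mul, mul_comm]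

end ChangeOfVariables

end SkewLaplace

/-! ### Taylor expansion of the whitened potential and verification of `LocalExpansion`. -/

namespace SkewLaplace

open ProbabilityTheory Real
open scoped ENNReal RealInnerProductSpace
open scoped Matrix MatrixOrder

section Taylor

variable {d : ℕ} {w : Vec d → ℝ} {Ω : Set (Vec d)} {h : Vec d} {M : ℝ}

lemma iteratedFDeriv_apply_neg (w : Vec d → ℝ) (k : ℕ) (x h : Vec d) :
    iteratedFDeriv ℝ k w x (fun _ => -h) = (-1) ^ k * iteratedFDeriv ℝ k w x fun _ => h := by
  have e : (fun _ : Fin k => -h) = fun _ : Fin k => (-1 : ℝ) • h := by simp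
  rw [e, (iteratedFDeriv ℝ k w x).map_smul_univ (fun _ => (-1 : ℝ)) (fun _ => h)]
  simp

lemma abs_sub_taylor_three_le (hΩ : IsOpen Ω) (hw : ContDiffOn ℝ 5 w Ω)
    (hseg : ∀ t ∈ Set.Icc (0 : ℝ) 1, t • h ∈ Ω) (h1 : iteratedFDeriv ℝ 1 w 0 (fun _ => h) = 0)
    (h2 : iteratedFDeriv ℝ 2 w 0 (fun _ => h) = ‖h‖ ^ 2)
    (hM : ∀ t ∈ Set.Icc (0 : ℝ) 1, |iteratedFDeriv ℝ 4 w (t • h) fun _ => h| ≤ M) :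
    |w h - w 0 - ‖h‖ ^ 2 / 2 - iteratedFDeriv ℝ 3 w 0 (fun _ => h) / 6| ≤ M / 24 := by
  obtain ⟨t, ht, he⟩ := exists_taylor_along (m := 3) hΩ (hw.of_le (by norm_num)) h hseg
  have hb := hM t (Set.Ioo_subset_Icc_self ht)
  simp only [Finset.sum_range_succ, Finset.sum_range_zero, iteratedFDeriv_zero_apply, h1, h2,
    Nat.factorial] at he
  norm_num at he
  have e : w h - w 0 - ‖h‖ ^ 2 / 2 - iteratedFDeriv ℝ 3 w 0 (fun _ => h) / 6 =
      (iteratedFDeriv ℝ 4 w (t • h) fun _ => h) / 24 := by rw [he]; ring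
  rw [e, abs_div, abs_of_pos (by norm_num : (0 : ℝ) < 24)]
  gcongr

lemma abs_sub_taylor_four_le (hΩ : IsOpen Ω) (hw : ContDiffOn ℝ 5 w Ω)
    (hseg : ∀ t ∈ Set.Icc (0 : ℝ) 1, t • h ∈ Ω) (h1 : iteratedFDeriv ℝ 1 w 0 (fun _ => h) = 0)
    (h2 : iteratedFDeriv ℝ 2 w 0 (fun _ => h) = ‖h‖ ^ 2)
    (hM : ∀ t ∈ Set.Icc (0 : ℝ) 1, |iteratedFDeriv ℝ 5 w (t • h) fun _ => h| ≤ M) :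
    |w h - w 0 - ‖h‖ ^ 2 / 2 - iteratedFDeriv ℝ 3 w 0 (fun _ => h) / 6 -
      iteratedFDeriv ℝ 4 w 0 (fun _ => h) / 24| ≤ M / 120 := by
  obtain ⟨t, ht, he⟩ := exists_taylor_along (m := 4) hΩ (hw.of_le (by norm_num)) h hseg
  have hb := hM t (Set.Ioo_subset_Icc_self ht)
  simp only [Finset.sum_range_succ, Finset.sum_range_zero, iteratedFDeriv_zero_apply, h1, h2,
    Nat.factorial] at he
  norm_num at he
  have e : w h - w 0 - ‖h‖ ^ 2 / 2 - iteratedFDeriv ℝ 3 w 0 (fun _ => h) / 6 -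
      iteratedFDeriv ℝ 4 w 0 (fun _ => h) / 24 =
      (iteratedFDeriv ℝ 5 w (t • h) fun _ => h) / 120 := by rw [he]; ring
  rw [e, abs_div, abs_of_pos (by norm_num : (0 : ℝ) < 120)]
  gcongr

end Taylor

/-- A smooth potential with a nondegenerate minimizer and a local region inside its domain. -/
structure IsRegular {d : ℕ} (n : ℝ) (Θ : Set (Vec d)) (v : Vec d → ℝ) (xhat : Vec d) (s : ℝ) :
    Prop where
  one_le_dim : 1 ≤ d
  n_pos : 0 < n
  isOpen : IsOpen Θ
  contDiffOn : ContDiffOn ℝ 5 v Θ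
  isMinOn : IsMinOn v Θ xhat
  posDef : (hessian v xhat).PosDef
  radius_nonneg : 0 ≤ s
  subset : localRegion n v xhat s ⊆ Θ

namespace IsRegular

variable {d : ℕ} {n : ℝ} {Θ : Set (Vec d)} {v : Vec d → ℝ} {xhat : Vec d} {s : ℝ} {y : Vec d}
  {k : ℕ}

lemma mem (hr : IsRegular n Θ v xhat s) : xhat ∈ Θ := by
  refine hr.subset ?_
  have h0 : wNorm (hessian v xhat) (0 : Vec d) = 0 := by simp [wNorm]
  have := hr.radius_nonneg
  rw [localRegion, Set.mem_ofPred_eq, sub_self, h0]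
  positivity

lemma contDiffAt (hr : IsRegular n Θ v xhat s) : ContDiffAt ℝ 5 v xhat :=
  hr.contDiffOn.contDiffAt (hr.isOpen.mem_nhds hr.mem)

lemma hessian_eq (hr : IsRegular n Θ v xhat s) :
    hessian (fun y => n * v y) xhat = n • hessian v xhat :=
  hessian_const_mul (hr.contDiffAt.of_le (by norm_num))

lemma posDef_scaled (hr : IsRegular n Θ v xhat s) :
    (hessian (fun y => n * v y) xhat).PosDef := by
  rw [hr.hessian_eq]; exact hr.posDef.smul hr.n_pos

lemma wNorm_whiten (hr : IsRegular n Θ v xhat s) (y : Vec d) :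
    wNorm (hessian v xhat) (whiten (hessian (fun y => n * v y) xhat) y) = ‖y‖ / √n := by
  have h1 := SkewLaplace.wNorm_whiten hr.posDef_scaled y
  nth_rewrite 1 [hr.hessian_eq] at h1
  rw [wNorm_smul_matrix hr.n_pos.le] at h1
  have := sqrt_pos.2 hr.n_pos
  rw [← h1]; field_simp

lemma unwhiten_mem_localRegion_iff (hr : IsRegular n Θ v xhat s) (t : ℝ) (y : Vec d) :
    unwhiten (hessian (fun y => n * v y) xhat) xhat y ∈ localRegion n v xhat t ↔ ‖y‖ ≤ t * √d := by
  have := sqrt_pos.2 hr.n_pos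
  rw [localRegion, Set.mem_ofPred_eq, unwhiten, add_sub_cancel_left, hr.wNorm_whiten,
    sqrt_div (Nat.cast_nonneg d), ← mul_div_assoc, div_le_div_iff_of_pos_right this]

/-- The potential in whitened coordinates. -/
noncomputable def _root_.SkewLaplace.whitenedPotential {d : ℕ} (n : ℝ) (v : Vec d → ℝ)
    (xhat y : Vec d) : ℝ :=
  n * v (unwhiten (hessian (fun y => n * v y) xhat) xhat y)

lemma unwhiten_mem (hr : IsRegular n Θ v xhat s) (hy : ‖y‖ ≤ s * √d) :
    unwhiten (hessian (fun y => n * v y) xhat) xhat y ∈ Θ :=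
  hr.subset ((hr.unwhiten_mem_localRegion_iff s y).2 hy)

lemma isOpen_preimage (hr : IsRegular n Θ v xhat s) :
    IsOpen (unwhiten (hessian (fun y => n * v y) xhat) xhat ⁻¹' Θ) :=
  hr.isOpen.preimage (continuous_unwhiten _ _)

lemma contDiffOn_whitenedPotential (hr : IsRegular n Θ v xhat s) :
    ContDiffOn ℝ 5 (whitenedPotential n v xhat)
      (unwhiten (hessian (fun y => n * v y) xhat) xhat ⁻¹' Θ) :=
  contDiffOn_const.mul (hr.contDiffOn.comp
    (contDiff_const.add (ContinuousLinearMap.contDiff _)).contDiffOn fun _ hy => hy)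

lemma iteratedFDeriv_whitenedPotential (hr : IsRegular n Θ v xhat s)
    (hy : unwhiten (hessian (fun y => n * v y) xhat) xhat y ∈ Θ) (hk : k ≤ 5)
    (u : Fin k → Vec d) :
    iteratedFDeriv ℝ k (whitenedPotential n v xhat) y u =
      n * iteratedFDeriv ℝ k v (unwhiten (hessian (fun y => n * v y) xhat) xhat y)
        fun i => whiten (hessian (fun y => n * v y) xhat) (u i) :=
  iteratedFDeriv_const_mul_comp_add (m := 5) hr.isOpen hr.contDiffOn n xhat _ hy hk u

lemma unwhiten_zero (H : Matrix (Fin d) (Fin d) ℝ) (x₀ : Vec d) : unwhiten H x₀ 0 = x₀ := by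
  simp [unwhiten]

lemma iteratedFDeriv_whitenedPotential_zero (hr : IsRegular n Θ v xhat s) (hk : k ≤ 5)
    (u : Fin k → Vec d) :
    iteratedFDeriv ℝ k (whitenedPotential n v xhat) 0 u =
      n * iteratedFDeriv ℝ k v xhat
        fun i => whiten (hessian (fun y => n * v y) xhat) (u i) := by
  have h := hr.iteratedFDeriv_whitenedPotential (y := 0) (by rw [unwhiten_zero]; exact hr.mem) hk u
  rwa [unwhiten_zero] at h

lemma iteratedFDeriv_one_eq_zero (hr : IsRegular n Θ v xhat s) (u : Fin 1 → Vec d) :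
    iteratedFDeriv ℝ 1 (whitenedPotential n v xhat) 0 u = 0 := by
  rw [hr.iteratedFDeriv_whitenedPotential_zero (by norm_num), iteratedFDeriv_one_apply,
    (hr.isMinOn.isLocalMin (hr.isOpen.mem_nhds hr.mem)).fderiv_eq_zero]
  simp

lemma iteratedFDeriv_two_eq (hr : IsRegular n Θ v xhat s) (y : Vec d) :
    iteratedFDeriv ℝ 2 (whitenedPotential n v xhat) 0 (fun _ => y) = ‖y‖ ^ 2 := by
  rw [hr.iteratedFDeriv_whitenedPotential_zero (by norm_num), iteratedFDeriv_two_eq_hessian,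
    ← dotProduct_whiten hr.posDef_scaled, ← smul_eq_mul, ← dotProduct_smul, ← Matrix.smul_mulVec,
    ← hr.hessian_eq]

/-- The radius `t` is kept free so that `t = 0` yields `c₃(0)` at the minimizer and `t = s` yields
`c₄(s)` and `c₅(s)`. -/
lemma abs_iteratedFDeriv_le (hr : IsRegular n Θ v xhat s) {t : ℝ} (hts : t ≤ s) {y' : Vec d}
    (hy' : ‖y'‖ ≤ t * √d) (hk : k ≤ 5) (hk0 : k ≠ 0) (y : Vec d) :
    |iteratedFDeriv ℝ k (whitenedPotential n v xhat) y' fun _ => y| ≤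
      n * (derivBound n v xhat k t * (‖y‖ / √n) ^ k) := by
  have hsub : localRegion n v xhat t ⊆ Θ := fun x hx =>
    hr.subset (le_trans hx (mul_le_mul_of_nonneg_right hts (sqrt_nonneg _)))
  have hm := (hr.unwhiten_mem_localRegion_iff t y').2 hy'
  rw [hr.iteratedFDeriv_whitenedPotential (hsub hm) hk, abs_mul, abs_of_pos hr.n_pos]
  have := hr.n_pos
  gcongr
  refine (abs_apply_le_opNorm hr.posDef hk0 _ _).trans ?_
  rw [hr.wNorm_whiten]
  gcongr
  exact opNorm_le_derivBound hr.isOpen (m := 5) hr.contDiffOn hr.posDef hsub hk hm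

/-- The Taylor remainder of order two in whitened coordinates. -/
noncomputable def _root_.SkewLaplace.whitenedRemainder {d : ℕ} (n : ℝ) (v : Vec d → ℝ)
    (xhat y : Vec d) : ℝ :=
  whitenedPotential n v xhat y - whitenedPotential n v xhat 0 - ‖y‖ ^ 2 / 2

/-- The third derivative at the minimizer in whitened coordinates. -/
noncomputable def _root_.SkewLaplace.whitenedCubic {d : ℕ} (n : ℝ) (v : Vec d → ℝ)
    (xhat : Vec d) : TriForm d :=
  fderiv ℝ (fderiv ℝ (fderiv ℝ (whitenedPotential n v xhat))) 0

lemma iteratedFDeriv_three_eq (y : Vec d) :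
    iteratedFDeriv ℝ 3 (whitenedPotential n v xhat) 0 (fun _ => y) =
      whitenedCubic n v xhat y y y := iteratedFDeriv_three_apply _ _ _

lemma norm_smul_le_radius (hy : ‖y‖ ≤ s * √d) {t : ℝ} (ht : t ∈ Set.Icc (0 : ℝ) 1) :
    ‖t • y‖ ≤ s * √d := by
  rw [norm_smul, norm_of_nonneg ht.1]
  exact (mul_le_of_le_one_left (norm_nonneg y) ht.2).trans hy

lemma abs_remainder_sub_cubic_le (hr : IsRegular n Θ v xhat s) (hy : ‖y‖ ≤ s * √d) :
    |whitenedRemainder n v xhat y - whitenedCubic n v xhat y y y / 6| ≤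
      eps4 n v xhat s ^ 2 / 24 * (‖y‖ ^ 2 / d) ^ 2 := by
  have h := abs_sub_taylor_three_le hr.isOpen_preimage hr.contDiffOn_whitenedPotential
    (fun t ht => hr.unwhiten_mem (norm_smul_le_radius hy ht))
    (hr.iteratedFDeriv_one_eq_zero _) (hr.iteratedFDeriv_two_eq y)
    (fun t ht => hr.abs_iteratedFDeriv_le le_rfl (norm_smul_le_radius hy ht) (k := 4)
      (by norm_num) (by norm_num) y)
  rw [iteratedFDeriv_three_eq] at h
  refine h.trans (le_of_eq ?_)
  have hn := hr.n_pos
  have hd : (0 : ℝ) < d := by exact_mod_cast hr.one_le_dim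
  have h4 : √n ^ 4 = n ^ 2 := by rw [show 4 = 2 * 2 by rfl, pow_mul, sq_sqrt hn.le]
  rw [eps4, mul_pow, ← rpow_natCast (_ ^ (1 / 2 : ℝ)), ← rpow_mul derivBound_nonneg, div_pow,
    div_pow _ (√n), h4, sq_sqrt hn.le]
  norm_num
  field_simp

lemma abs_remainder_sub_quartic_le (hr : IsRegular n Θ v xhat s) (hy : ‖y‖ ≤ s * √d) :
    |whitenedRemainder n v xhat y - whitenedCubic n v xhat y y y / 6 -
      iteratedFDeriv ℝ 4 (whitenedPotential n v xhat) 0 (fun _ => y) / 24| ≤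
      eps5 n v xhat s ^ 3 / 120 * (‖y‖ ^ 5 / d ^ 3) := by
  have h := abs_sub_taylor_four_le hr.isOpen_preimage hr.contDiffOn_whitenedPotential
    (fun t ht => hr.unwhiten_mem (norm_smul_le_radius hy ht))
    (hr.iteratedFDeriv_one_eq_zero _) (hr.iteratedFDeriv_two_eq y)
    (fun t ht => hr.abs_iteratedFDeriv_le le_rfl (norm_smul_le_radius hy ht) (k := 5)
      (by norm_num) (by norm_num) y)
  rw [iteratedFDeriv_three_eq] at h
  refine h.trans (le_of_eq ?_)
  have hn := hr.n_pos
  have hd : (0 : ℝ) < d := by exact_mod_cast hr.one_le_dim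
  have hq := sqrt_pos.2 hn
  have h5 : √n ^ 5 = n * √n ^ 3 := by rw [show 5 = 2 + 3 by rfl, pow_add, sq_sqrt hn.le]
  rw [eps5, mul_pow, ← rpow_natCast (_ ^ (1 / 3 : ℝ)), ← rpow_mul derivBound_nonneg, div_pow,
    div_pow _ (√n), h5]
  norm_num
  field_simp

lemma abs_cubic_le (hr : IsRegular n Θ v xhat s) (y : Vec d) :
    |whitenedCubic n v xhat y y y| ≤ eps3 n v xhat / d * ‖y‖ ^ 3 := by
  have h := hr.abs_iteratedFDeriv_le hr.radius_nonneg (y' := 0) (k := 3) (by simp)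
    (by norm_num) (by norm_num) y
  rw [iteratedFDeriv_three_eq] at h
  refine h.trans (le_of_eq ?_)
  have hn := hr.n_pos
  have hd : (0 : ℝ) < d := by exact_mod_cast hr.one_le_dim
  have hq := sqrt_pos.2 hn
  have h3 : √n ^ 3 = n * √n := by rw [pow_succ, sq_sqrt hn.le]
  rw [eps3, div_pow, h3]
  field_simp

lemma cubic_neg (y : Vec d) :
    whitenedCubic n v xhat (-y) (-y) (-y) = -whitenedCubic n v xhat y y y := by simp

lemma localExpansion (hr : IsRegular n Θ v xhat s) {s₀ c₀ : ℝ} (hc0 : 0 < c₀) (hc1 : c₀ ≤ 1)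
    (hs : sStar s₀ c₀ ≤ s)
    (hgrow : ∀ x ∈ Θ \ localRegion n v xhat s₀,
      c₀ * √((d : ℝ) / n) * wNorm (hessian v xhat) (x - xhat) ≤ v x - v xhat) :
    LocalExpansion (whitenedCubic n v xhat) (eps3 n v xhat) (eps4 n v xhat s ^ 2)
      (eps5 n v xhat s ^ 3) s c₀
      (relDensity n Θ v (hessian (fun y => n * v y) xhat) xhat)
      (whitenedRemainder n v xhat) where
  one_le_dim := hr.one_le_dim
  symm := isSymm_fderiv_three ((hr.contDiffOn_whitenedPotential.contDiffAt
    (hr.isOpen_preimage.mem_nhds (by rw [Set.mem_preimage, unwhiten_zero]; exact hr.mem))).of_le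
      (by norm_num))
  σ_nonneg := mul_nonneg derivBound_nonneg (by positivity)
  η_nonneg := sq_nonneg _
  δ_nonneg := pow_nonneg (mul_nonneg (rpow_nonneg derivBound_nonneg _) (by positivity)) 3
  le_radius := by
    refine le_trans ?_ ((le_max_right _ _).trans hs)
    -- Since `c₀ ≤ 1`, the second entry of `sStar` is at least `8(1 + log 2) > 13`.
    have h1 : 8 ≤ 8 / c₀ := by rw [le_div_iff₀ hc0]; linarith
    have h2 : log (2 * exp 1) ≤ log (2 * exp 1 / c₀) :=
      log_le_log (by positivity) (by rw [le_div_iff₀ hc0]; nlinarith [exp_pos 1])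
    rw [log_mul (by norm_num) (exp_pos 1).ne', log_exp] at h2
    have h3 := log_two_gt_d9
    nlinarith
  c_pos := hc0
  c_le_one := hc1
  log_le_radius := (le_max_right _ _).trans hs
  cubic_le := hr.abs_cubic_le
  measurable := measurable_relDensity hr.isOpen hr.contDiffOn.continuousOn
  nonneg := fun _ => relDensity_nonneg _
  eq_exp := fun y hy => by
    rw [relDensity, Set.indicator_of_mem (by exact hr.unwhiten_mem hy), whitenedRemainder,
      whitenedPotential, whitenedPotential, unwhiten_zero]
    congr 1; ring
  even_le := fun y hy => by
    have h1 := hr.abs_remainder_sub_cubic_le hy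
    have h2 := hr.abs_remainder_sub_cubic_le (y := -y) (by rwa [norm_neg])
    rw [cubic_neg, norm_neg] at h2
    rw [abs_le] at *
    constructor <;> linarith [h1.1, h1.2, h2.1, h2.2]
  odd_le := fun y hy => by
    have h1 := hr.abs_remainder_sub_cubic_le hy
    have h2 := hr.abs_remainder_sub_cubic_le (y := -y) (by rwa [norm_neg])
    rw [cubic_neg, norm_neg] at h2
    rw [abs_le] at *
    constructor <;> linarith [h1.1, h1.2, h2.1, h2.2]
  -- The quartic Taylor term is even, so it disappears from `r(y) - r(-y)` and the fifth-order
  -- remainder controls the difference.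
  odd_le' := fun y hy => by
    have h1 := hr.abs_remainder_sub_quartic_le hy
    have h2 := hr.abs_remainder_sub_quartic_le (y := -y) (by rwa [norm_neg])
    have h0 := (abs_nonneg _).trans h1
    rw [cubic_neg, norm_neg, iteratedFDeriv_apply_neg] at h2
    rw [abs_le] at *
    constructor <;> linarith [h1.1, h1.2, h2.1, h2.2]
  tail_le := fun y hy => by
    by_cases hm : unwhiten (hessian (fun y => n * v y) xhat) xhat y ∈ Θ
    · rw [relDensity, Set.indicator_of_mem (by exact hm)]
      have hn := hr.n_pos
      have hq := sqrt_pos.2 hn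
      have hs0 : s₀ ≤ s := (le_max_left _ _).trans hs
      have h1 := hgrow _ ⟨hm, fun h => by
        have h2 := (hr.unwhiten_mem_localRegion_iff s₀ y).1 h
        have : s₀ * √d ≤ s * √d := by gcongr
        linarith⟩
      rw [unwhiten, add_sub_cancel_left, hr.wNorm_whiten, sqrt_div (Nat.cast_nonneg d)] at h1
      -- The powers of `n` cancel: linear growth in the original scale is `c₀√d‖y‖` after whitening.
      -- Outside `Θ` the density is `0`.
      have h3 : n * (c₀ * (√d / √n) * (‖y‖ / √n)) = c₀ * √d * ‖y‖ := by
        field_simp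
        rw [sq_sqrt hn.le]
        ring
      have h4 := mul_le_mul_of_nonneg_left h1 hn.le
      rw [h3] at h4
      exact exp_le_exp.2 (sub_le_sub_left h4 _)
    · rw [relDensity, Set.indicator_of_notMem (by exact hm)]
      exact (exp_pos _).le

end IsRegular

end SkewLaplace

/-! ### Standardized observables, the skew correction after whitening, and the main theorem. -/

namespace SkewLaplace

open ProbabilityTheory Real
open scoped ENNReal RealInnerProductSpace
open scoped Matrix MatrixOrder

section Main

variable {d : ℕ} {n : ℝ} {Θ : Set (Vec d)} {v : Vec d → ℝ} {xhat : Vec d} {s : ℝ}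

lemma measurable_standardize {μ : Measure (Vec d)} {G : Vec d → ℝ} (hG : Measurable G) :
    Measurable (standardize μ G) :=
  (hG.sub_const _).div_const _

lemma integral_standardize_sq {μ : Measure (Vec d)} {G : Vec d → ℝ} (hG : Measurable G)
    (hvar : 0 < variance G μ) : ∫ x, standardize μ G x ^ 2 ∂μ = 1 := by
  have h : ∀ x, standardize μ G x ^ 2 = (G x - ∫ y, G y ∂μ) ^ 2 / variance G μ := fun x => by
    rw [standardize, div_pow, sq_sqrt hvar.le]
  simp_rw [h]
  rw [integral_div, ← variance_eq_integral hG.aemeasurable, div_self hvar.ne']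

lemma skewCorrection_unwhiten (hr : IsRegular n Θ v xhat s) (y : Vec d) :
    skewCorrection n v xhat (unwhiten (hessian (fun y => n * v y) xhat) xhat y) =
      -(whitenedCubic n v xhat y y y / 6) := by
  rw [← IsRegular.iteratedFDeriv_three_eq, hr.iteratedFDeriv_whitenedPotential_zero (by norm_num),
    skewCorrection, unwhiten, add_sub_cancel_left]
  have h := iteratedFDeriv_const_smul_apply (a := n) (i := 3)
    (hr.contDiffAt.of_le (m := 3) (by norm_num))
  have e : (fun y => n * v y) = n • v := rfl
  rw [e, h, smul_apply, smul_eq_mul]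
  ring

lemma measurable_skewCorrection : Measurable (skewCorrection n v xhat) := by
  unfold skewCorrection
  refine Continuous.measurable ?_
  refine continuous_const.mul ((ContinuousMultilinearMap.cont _).comp ?_)
  fun_prop

lemma integral_eq_zero_of_odd {f : Vec d → ℝ} (hf : ∀ y, f (-y) = -f y) :
    ∫ y, f y ∂stdGaussian (Vec d) = 0 := by
  have h := integral_comp_neg_stdGaussian f
  simp only [hf, integral_neg] at h
  linarith

end Main

end SkewLaplace

theorem theorem2p2 (K : ℝ) (hK : 0 < K) :
    ∃ C : ℝ, 0 < C ∧
      ∀ (d : ℕ) (n : ℝ) (Θ : Set (Vec d)) (v : Vec d → ℝ) (xhat : Vec d)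
        (s₀ c₀ s aG : ℝ) (G : Vec d → ℝ),
        1 ≤ d → 0 < n →
        -- regularity and unique strict minimum
        IsOpen Θ → ContDiffOn ℝ 5 v Θ →
        xhat ∈ Θ → (∀ x ∈ Θ, x ≠ xhat → v xhat < v x) → (hessian v xhat).PosDef →
        -- linear growth
        0 < s₀ → 0 < c₀ → c₀ ≤ 1 →
        (∀ x ∈ Θ \ localRegion n v xhat s₀,
          c₀ * √((d : ℝ) / n) * wNorm (hessian v xhat) (x - xhat) ≤ v x - v xhat) →
        -- the radius and the size of the small quantities
        sStar s₀ c₀ ≤ s → localRegion n v xhat s ⊆ Θ →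
        eps3 n v xhat ≤ K → eps4 n v xhat s ≤ K →
        -- the observable
        Measurable G → 0 ≤ aG →
        (∀ x, |G x - ∫ y, G y ∂laplaceApprox n v xhat| ≤
          aG * Real.exp
            (c₀ * √(d : ℝ) * wNorm (hessian (fun y => n * v y) xhat) (x - xhat) / 2)) →
        0 < ProbabilityTheory.variance G (laplaceApprox n v xhat) →
        (∀ y, standardize (laplaceApprox n v xhat) G (xhat - y) =
          -standardize (laplaceApprox n v xhat) G (xhat + y)) →
        IsProbabilityMeasure (posterior n Θ v) ∧
        Integrable (standardize (laplaceApprox n v xhat) G) (posterior n Θ v) ∧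
        Integrable (fun x => standardize (laplaceApprox n v xhat) G x *
          (1 + skewCorrection n v xhat x)) (laplaceApprox n v xhat) ∧
        |skewError n Θ v xhat (standardize (laplaceApprox n v xhat) G)| ≤
          C * (expFactor n v xhat s * (eps3 n v xhat ^ 2 + eps4 n v xhat s ^ 2) *
                (eps3 n v xhat + eps4 n v xhat s ^ 2) +
              (d : ℝ) ^ (-(1 / 2) : ℝ) * eps5 n v xhat s ^ 3 +
              max (aG / √(ProbabilityTheory.variance G (laplaceApprox n v xhat))) 1 *
                tailTerm d c₀ s) := by
  obtain ⟨C, hC, hcore⟩ := exists_abs_div_add_integral_le K hK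
  refine ⟨C, hC, ?_⟩
  intro d n Θ v xhat s₀ c₀ s aG G hd hn hΘ hv hx hmin hH hs0 hc0 hc1 hgrow hs hsub he3 he4 hG haG
    hGb hvar hodd
  have hr : IsRegular n Θ v xhat s := ⟨hd, hn, hΘ, hv, fun x hxΘ => by
    rcases eq_or_ne x xhat with rfl | hne
    · exact le_refl (v x)
    · exact (hmin x hxΘ hne).le, hH, hs0.le.trans ((le_max_left _ _).trans hs), hsub⟩
  have hexp := hr.localExpansion hc0 hc1 hs hgrow
  set μ := laplaceApprox n v xhat with hμ
  set Hn := hessian (fun y => n * v y) xhat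
  have hΨm : Measurable (unwhiten Hn xhat) := (continuous_unwhiten _ _).measurable
  have hμmap : μ = (ProbabilityTheory.stdGaussian (Vec d)).map (unwhiten Hn xhat) :=
    laplaceApprox_eq_map
  set f := standardize μ G with hf
  have hfm : Measurable f := measurable_standardize hG
  set g : Vec d → ℝ := fun y => f (unwhiten Hn xhat y) with hg
  have hgm : Measurable g := hfm.comp hΨm
  have hgodd : ∀ y, g (-y) = -g y := fun y => by
    have := hodd (whiten Hn y)
    simpa only [hg, unwhiten, map_neg, ← sub_eq_add_neg] using this
  have hg1 : ∫ y, g y ^ 2 ∂ProbabilityTheory.stdGaussian (Vec d) = 1 := by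
    rw [← integral_standardize_sq hG hvar, ← hf, hμmap,
      integral_map hΨm.aemeasurable (hfm.pow_const 2).aestronglyMeasurable]
  -- Square integrability follows from the value of the integral, which would be `0` by convention
  -- otherwise.
  have hg2 : Integrable (fun y => g y ^ 2) (ProbabilityTheory.stdGaussian (Vec d)) := by
    by_contra h
    rw [integral_undef h] at hg1
    exact zero_ne_one hg1
  have hgb : ∀ y, |g y| ≤
      aG / √(ProbabilityTheory.variance G μ) * Real.exp (c₀ * √d * ‖y‖ / 2) := fun y => by
    have h := hGb (unwhiten Hn xhat y)
    rw [unwhiten, add_sub_cancel_left, wNorm_whiten hr.posDef_scaled] at h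
    rw [hg, hf]
    simp only [standardize, unwhiten]
    rw [abs_div, abs_of_nonneg (Real.sqrt_nonneg _), div_mul_eq_mul_div]
    gcongr
  have hgi : Integrable g (ProbabilityTheory.stdGaussian (Vec d)) :=
    ((memLp_two_iff_integrable_sq hgm.aestronglyMeasurable).2 hg2).integrable one_le_two
  obtain ⟨hρi, hρ0, hgρ, hgB, hbound⟩ := hcore d _ _ _ _ s c₀ _ _ _ g hexp he3
    (pow_le_pow_left₀ (mul_nonneg (Real.rpow_nonneg derivBound_nonneg _) (by positivity)) he4 2)
    hgm hgodd hg2 hg1 (by positivity) hgb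
  have hvc := hv.continuousOn
  have hSm : Measurable fun x => f x * (1 + skewCorrection n v xhat x) :=
    hfm.mul (measurable_skewCorrection.const_add 1)
  have hcomp : ∀ y, f (unwhiten Hn xhat y) * (1 + skewCorrection n v xhat (unwhiten Hn xhat y)) =
      g y - g y * (whitenedCubic n v xhat y y y / 6) := fun y => by
    rw [skewCorrection_unwhiten hr]
    simp only [hg]
    ring
  -- The uncorrected Laplace integral of `g` vanishes by oddness, so only the skew term is left.
  have hint : ∫ x, f x * (1 + skewCorrection n v xhat x) ∂μ =
      -∫ y, g y * (whitenedCubic n v xhat y y y / 6) ∂ProbabilityTheory.stdGaussian (Vec d) := by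
    rw [hμmap, integral_map hΨm.aemeasurable hSm.aestronglyMeasurable]
    simp only [hcomp]
    rw [integral_sub hgi hgB, integral_eq_zero_of_odd hgodd, zero_sub]
  refine ⟨isProbabilityMeasure_posterior hΘ hvc hr.posDef_scaled hρi hρ0,
    integrable_posterior hΘ hvc hr.posDef_scaled hρi hρ0 hfm hgρ, ?_, ?_⟩
  · rw [hμmap, integrable_map_measure hSm.aestronglyMeasurable hΨm.aemeasurable]
    simp only [Function.comp_def, hcomp]
    exact hgi.sub hgB
  · rw [skewError, ← hμ, integral_posterior hΘ hvc hr.posDef_scaled hρi hfm, hint, sub_neg_eq_add]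
    exact hbound
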